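/- **Conventions.** Work near $0$ on the Riemann surface of the logarithm and put $\ell=-1/\log z$. With $\zeta=-\log z$, a *standard quadratic domain* $\mathcal R_C$ is the image of $\{\operatorname{Re}\zeta>0,\ |\zeta|>R\}$ under $\zeta\mapsto\zeta+C(\zeta+1)^{1/2}$, where $C,R>0$. Put $\ell_1=\ell$ and $\ell_{j+1}=-1/\log\ell_j$. A set of real exponents is *finitely generated* if it lies in $c+\mathbb Z_{\ge0}\,\gamma_1+\dots+\mathbb Z_{\ge0}\,\gamma_r$ for some $c\in\mathbb R$ and finitely many $\gamma_i>0$. Let $\widehat{\mathcal L}_k^\infty(\mathbb R)$ be the set of transseries in $z,\ell_1,\dots,\ell_k$ with real coefficients, real finitely generated exponents of $z$ (possibly starting with negative ones), integer exponents of the $\ell_j$, and support well-ordered for the lexicographic order; let $\widehat{\mathcal L}^\infty(\mathbb R)=\bigcup_k\widehat{\mathcal L}_k^\infty(\mathbb R)$, and let $\widehat{\mathcal L}_\ell^\infty(\mathbb R)$ be the set of transseries with well-ordered support in integer powers of $\ell,\ell_2$ only, with real coefficients. For $\theta>0$, a *petal* of opening $\theta$ centered at the direction $d$ is a union, over $\theta'\in(0,\theta)$,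 of open sectors at $0$ centered at $d$, of opening $\theta'$, with radii depending on $\theta'$; its *$\ell$-cusp* is its image $S$ under $z\mapsto\ell$. As usual for germs, radii may be shrunk. A germ $F$ analytic on $S$ admits the Laurent series $\sum_{k\ge N}a_k\ell^k$ as *log-Gevrey expansion of order $\mu>0$* if on the image of every proper subsector there is a constant $K$ with $$\Bigl|\ell^{-N}F(\ell)-\sum_{k=0}^{n-1}a_{N+k}\ell^k\Bigr|\le K\mu^{-n}(\log n)^n e^{-n/\log n}|\ell|^n\qquad(n\ge2).$$ Let $\widehat F\in\widehat{\mathcal L}_\ell^\infty(\mathbb R)$ have at most one term containing $\ell_2$. It is *integrally summable of length $0$* on $S$ if it is a Laurent series in $\ell$ and is the log-Gevrey expansion of order $\mu$ of some analytic germ on $S$, for some $\mu>\pi/\theta$. It is *integrally summable of length $1$* on $S$ with *exponent of integration* $(\beta,p)\in\mathbb R\times\mathbb Z$ if it is not integrally summable of length $0$ on $S$ and $$\frac{d}{d\ell}\bigl(e^{-\beta/\ell}\ell^{p}\widehat F(\ell)\bigr)=e^{-\beta/\ell}\ell^{2p-2}\widehat R(\ell)\tag{1}$$ for some $\widehat R$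 integrally summable of length $0$ on $S$. Let $\alpha>1$, $a\in\mathbb R\setminus\{0\}$, $m\in\mathbb Z$. A *parabolic generalized Dulac germ* is a germ $f$ analytic on a standard quadratic domain $\mathcal R_C$, mapping $\{\arg z=0\}$ to itself, with $|f(z)-z+az^\alpha\ell^m|\le c\,|z^\alpha\ell^{m+1}|$ on $\mathcal R_C$ for some $c>0$, which on the petal of opening $\frac{2\pi}{\alpha-1}$ centered at each direction $\frac{k\pi}{\alpha-1}$, $k\in\mathbb Z$ (these are the attracting and repelling petals $V_j^{\pm}$, $j\in\mathbb Z$), has an asymptotic expansion $$f(z)=z+\sum_{i=1}^n z^{\alpha_i}R_i(\ell)+o(z^{\alpha_n+\delta_n}),\qquad\delta_n>0,\ n\in\mathbb N,$$ as $z\to0$ on proper subsectors. Here $\alpha_1=\alpha$, the $\alpha_i$ are strictly increasing to $+\infty$ and finitely generated, and the $R_i$ are analytic germs on the $\ell$-cusp of the petal (they may depend on the petal) with log-Gevrey expansions $\widehat R_i\in\mathbb R((\ell))$, common to all petals, of orders strictly bigger than $\frac{\alpha-1}2$. Its generalized Dulac expansion is $\widehat f(z)=z+\sum_{i\ge1}z^{\alpha_i}\widehat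 R_i(\ell)$. A *formal Fatou coordinate* of $\widehat f$ is a solution $\widehat\Psi$ of Abel's equation $\widehat\Psi\circ\widehat f-\widehat\Psi=1$, where $\widehat\Psi\circ\widehat f=\sum_{n\ge0}\frac1{n!}\widehat\Psi^{(n)}(\widehat f-\mathrm{id})^n$. **Proposition 6.7.** Let $f$ be a parabolic generalized Dulac germ with generalized Dulac expansion $\widehat f$. Then $\widehat f$ has a formal Fatou coordinate $\widehat\Psi\in\widehat{\mathcal L}^\infty(\mathbb R)$, unique in $\widehat{\mathcal L}^\infty(\mathbb R)$ up to an additive real constant. Moreover $\widehat\Psi\in\widehat{\mathcal L}_2^\infty(\mathbb R)$, and $$\widehat\Psi(z)=\sum_{i\in\mathbb N}z^{\beta_i}\widehat T_i(\ell),\qquad\widehat T_i\in\widehat{\mathcal L}_\ell^\infty(\mathbb R),\ \widehat T_1\ne0,$$ where $(\beta_i)$ is finitely generated and strictly increasing to $+\infty$, $\beta_1=-\alpha+1$, and only finitely many first $\beta_i$ are negative. Each $\widehat T_i$ has at most one term containing $\ell_2$, and on the $\ell$-cusp of every petal $V_j^\pm$ it satisfies (1) with exponent $(\beta_i,0)$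 and a right-hand side $\widehat R$ that is integrally summable of length $0$; that is, on this $\ell$-cusp $\widehat T_i$ is integrally summable of length $1$ with exponent of integration $(\beta_i,0)$, unless it is already integrally summable of length $0$ there. -/

import Mathlib

open Filter Topology
open scoped Nat

/-! ### Analytic side

All germs live near `0` on the Riemann surface of the logarithm and are written in the logarithmic
chart `ζ = -log z`: thus `z = exp (-ζ)`, `arg z = -Im ζ`, `z ^ β = exp (-β ζ)` and
`ℓ = -1 / log z = ζ⁻¹`; the limit `z → 0` is `Re ζ → +∞`. A germ `f` is represented by the function
`ζ ↦ f (z)`. -/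

/-- The power `z ^ β` at the point with logarithmic coordinate `ζ`. -/
noncomputable def zpowC (β : ℝ) (ζ : ℂ) : ℂ := Complex.exp (-(β : ℂ) * ζ)

/-- The standard quadratic domain, in the logarithmic chart: the image of `Re ζ > 0`, `|ζ| > R` under
`ζ ↦ ζ + C (ζ + 1) ^ (1/2)`. -/
noncomputable def standardQuadraticDomain (C R : ℝ) : Set ℂ :=
  (fun ζ : ℂ => ζ + (C : ℂ) * (ζ + 1) ^ (1 / 2 : ℂ)) '' {ζ | 0 < ζ.re ∧ R < ‖ζ‖}

/-- The open sector `|arg z - d| < θ / 2`, `|z| < exp (-M)`, in the logarithmic chart. -/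
def logSector (d θ M : ℝ) : Set ℂ := {ζ | |ζ.im + d| < θ / 2 ∧ M < ζ.re}

/-- The petal centered at the direction `d`, of opening `θ`, with radii `exp (-r θ')`: the union of the
open sectors of openings `θ' < θ` whose radii depend on `θ'`. -/
def logPetal (d θ : ℝ) (r : ℝ → ℝ) : Set ℂ :=
  ⋃ θ' ∈ Set.Ioo 0 θ, logSector d θ' (r θ')

/-- The image of a domain under `ℓ = ζ⁻¹`. For a sector or a petal this is an `ℓ`-cusp. -/
def ellCusp (V : Set ℂ) : Set ℂ := (fun ζ : ℂ => ζ⁻¹) '' V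

/-- `z → 0` on the sector centered at `d` of opening `θ`. -/
def sectorFilter (d θ : ℝ) : Filter ℂ :=
  comap Complex.re atTop ⊓ 𝓟 {ζ | |ζ.im + d| < θ / 2}

/-- The bisecting directions of the petals of `z - a z ^ α ℓ ^ m + ⋯`, `a ≠ 0`, on the Riemann
surface of the logarithm. For `a > 0` the even `k` give the attracting directions
`1 ^ (1 / (α - 1))` and the odd `k` the repelling directions `(-1) ^ (1 / (α - 1))`; for `a < 0` it
is the other way round. -/
noncomputable def petalDirection (α : ℝ) (k : ℤ) : ℝ := k * Real.pi / (α - 1)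

/-- The opening of the petals of `z - a z ^ α ℓ ^ m + ⋯`. -/
noncomputable def petalOpening (α : ℝ) : ℝ := 2 * Real.pi / (α - 1)

/-! ### Formal side: transseries -/

/-- The exponent `(b, n)` stands for the monomial `z ^ b ℓ₁ ^ (n 0) ℓ₂ ^ (n 1) ℓ₃ ^ (n 2) ⋯`, where
`ℓ₁ = ℓ` and `ℓ_{j+1} = -1 / log ℓ_j`. The order is lexicographic: larger exponents are smaller
monomials as `z → 0+`. -/
abbrev LogExponent := ℝ ×ₗ Lex (ℕ →₀ ℤ)

/-- Transseries with real coefficients and well-ordered support. -/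
abbrev Transseries := HahnSeries LogExponent ℝ

namespace Transseries

/-- The exponent of `z ^ b ℓ₁ ^ (n 0) ℓ₂ ^ (n 1) ⋯`. -/
def expo (b : ℝ) (n : ℕ →₀ ℤ) : LogExponent := toLex (b, toLex n)

/-- The exponent of `z` in a monomial. -/
def zExp (g : LogExponent) : ℝ := (ofLex g).1

/-- The exponent of `ℓ_{j+1}` in a monomial. -/
def ellExp (g : LogExponent) (j : ℕ) : ℤ := ofLex (ofLex g).2 j

/-- The monomial `z ^ b`. -/
noncomputable def zPow (b : ℝ) : Transseries := HahnSeries.single (expo b 0) 1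

/-- The monomial `ℓ ^ p`. -/
noncomputable def ellPow (p : ℤ) : Transseries := HahnSeries.single (expo 0 (Finsupp.single 0 p)) 1

/-- The monomial `ℓ₁ ℓ₂ ⋯ ℓ_{j+1}`. -/
noncomputable def ellProd (j : ℕ) : Transseries :=
  HahnSeries.single (expo 0 (∑ i ∈ Finset.range (j + 1), Finsupp.single i 1)) 1

/-- Multiply the coefficient of each monomial `g` by `w g`. -/
def scale (w : LogExponent → ℝ) (f : Transseries) : Transseries where
  coeff g := w g * f.coeff g
  isPWO_support' := f.isPWO_support.mono fun g hg => by
    simp only [Function.mem_support, HahnSeries.mem_support] at *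
    exact right_ne_zero_of_mul hg

/-- The formal derivation `z d/dz`. On monomials,
`z d/dz (z ^ b ∏ ℓ_{j+1} ^ (n j)) = (b + ∑ j, n j ℓ₁ ⋯ ℓ_{j+1}) z ^ b ∏ ℓ_{j+1} ^ (n j)`.
The sum over `j` is finite for transseries that involve finitely many iterated logarithms. -/
noncomputable def eulerDeriv (f : Transseries) : Transseries :=
  scale zExp f + ∑ᶠ j : ℕ, ellProd j * scale (fun g => (ellExp g j : ℝ)) f

/-- The formal derivative `d/dz`. -/
noncomputable def derivZ (f : Transseries) : Transseries := zPow (-1) * eulerDeriv f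

/-- The formal derivative `d/dℓ`, with `z = exp (-1 / ℓ)`: `d/dℓ = z ℓ ^ (-2) d/dz`. -/
noncomputable def derivEll (f : Transseries) : Transseries := ellPow (-2) * eulerDeriv f

/-- `S = ∑ n, t n` as a formal sum of transseries: the family is summable (the union of the supports is
well-ordered and every monomial occurs in finitely many terms) and its sum is `S`. -/
def IsFormalSum (t : ℕ → Transseries) (S : Transseries) : Prop :=
  ∃ s : HahnSeries.SummableFamily LogExponent ℝ ℕ, (∀ n, s n = t n) ∧ s.hsum = S

/-- `h = Ψ ∘ f`, for `f = z + ⋯` tangent to the identity, by the formal Taylor expansion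
`Ψ (f) = ∑ n, Ψ⁽ⁿ⁾ (z) (f (z) - z) ^ n / n!`. -/
def IsComp (Ψ f h : Transseries) : Prop :=
  IsFormalSum (fun n => ((n ! : ℝ)⁻¹) • (derivZ^[n] Ψ * (f - zPow 1) ^ n)) h

/-- A formal Fatou coordinate: `Ψ ∘ f - Ψ = 1`. -/
def IsFormalFatouCoordinate (f Ψ : Transseries) : Prop :=
  ∃ h, IsComp Ψ f h ∧ h - Ψ = 1

/-- A set of real exponents is finitely generated: up to a shift `c`, which lets the exponents start
with a negative one, its elements are combinations with coefficients in `ℕ` of finitely many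
positive numbers. -/
def FinitelyGeneratedExponents (E : Set ℝ) : Prop :=
  ∃ (c : ℝ) (G : Finset ℝ), (∀ g ∈ G, 0 < g) ∧
    ∀ e ∈ E, ∃ s ∈ AddSubmonoid.closure (G : Set ℝ), e = c + s

/-- The class of transseries in `z, ℓ₁, …, ℓ_k` with real coefficients, whose exponents of `z` are
real, possibly negative, and finitely generated, and whose exponents of `ℓ₁, …, ℓ_k` are integers. -/
def InLk (k : ℕ) (f : Transseries) : Prop :=
  (∀ g ∈ f.support, ∀ j, k ≤ j → ellExp g j = 0) ∧
    FinitelyGeneratedExponents (zExp '' f.support)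

/-- The union over `k` of these classes. -/
def InL (f : Transseries) : Prop := ∃ k, InLk k f

/-- Transseries in `ℓ` and `ℓ₂` only. -/
def InLell (f : Transseries) : Prop :=
  ∀ g ∈ f.support, zExp g = 0 ∧ ∀ j, 2 ≤ j → ellExp g j = 0

/-- Formal Laurent series in `ℓ`. -/
def IsLaurent (f : Transseries) : Prop :=
  ∀ g ∈ f.support, zExp g = 0 ∧ ∀ j, 1 ≤ j → ellExp g j = 0

/-- The coefficient of `ℓ ^ p`. -/
noncomputable def ellCoeff (f : Transseries) (p : ℤ) : ℝ := f.coeff (expo 0 (Finsupp.single 0 p))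

end Transseries

open Transseries

/-- `F` is a germ analytic on the `ℓ`-cusp of the petals of direction `d` and opening `θ`, and admits
there the Laurent series `Fhat` as its log-Gevrey asymptotic expansion of order `m`: with
`Fhat = ∑_{k ≥ N} a_k ℓ ^ k`, the germ `ℓ ^ (-N) F` has the log-Gevrey expansion
`∑_{k ≥ 0} a_{N + k} ℓ ^ k`. As usual for germs the radius of a proper subsector, of opening
`θ' < θ`, may be shrunk. -/
structure HasLogGevreyExpansion (m d θ : ℝ) (F : ℂ → ℂ) (Fhat : Transseries) : Prop where
  isLaurent : IsLaurent Fhat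
  order_pos : 0 < m
  analytic : ∃ r : ℝ → ℝ, (∀ t, 0 < r t) ∧ DifferentiableOn ℂ F (ellCusp (logPetal d θ r))
  bound : ∃ N : ℤ, (∀ k < N, ellCoeff Fhat k = 0) ∧
    ∀ θ' ∈ Set.Ioo 0 θ, ∃ M > 0, ∃ K > 0,
      ∀ ℓ ∈ ellCusp (logSector d θ' M), ∀ n : ℕ, 2 ≤ n →
        ‖ℓ ^ (-N) * F ℓ - ∑ k ∈ Finset.range n, (ellCoeff Fhat (N + k) : ℂ) * ℓ ^ k‖ ≤
          K * (m ^ n)⁻¹ * Real.log n ^ n * Real.exp (-(n / Real.log n)) * ‖ℓ‖ ^ n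

/-- Integral summability of length `0` on the `ℓ`-cusp of the petals of direction `d`, opening `θ`. -/
def IntegrallySummableZero (d θ : ℝ) (Fhat : Transseries) : Prop :=
  ∃ m > Real.pi / θ, ∃ F : ℂ → ℂ, HasLogGevreyExpansion m d θ F Fhat

/-- `Fhat`, a transseries in `ℓ, ℓ₂` with at most one double-logarithmic term, satisfies
`d/dℓ (exp (-β / ℓ) ℓ ^ p Fhat) = exp (-β / ℓ) ℓ ^ (2 p - 2) Rhat` for some `Rhat` integrally summable
of length `0`. -/
def SolvesIntegrationEquation (d θ : ℝ) (Fhat : Transseries) (β : ℝ) (p : ℤ) : Prop :=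
  InLell Fhat ∧ {g ∈ Fhat.support | ellExp g 1 ≠ 0}.Subsingleton ∧
    ∃ Rhat, IntegrallySummableZero d θ Rhat ∧
      derivEll (zPow β * ellPow p * Fhat) = zPow β * ellPow (2 * p - 2) * Rhat

/-- Integral summability of length `1` with exponent of integration `(β, p)`. -/
def IntegrallySummableOne (d θ : ℝ) (Fhat : Transseries) (β : ℝ) (p : ℤ) : Prop :=
  ¬ IntegrallySummableZero d θ Fhat ∧ SolvesIntegrationEquation d θ Fhat β p

/-- `f` is a parabolic generalized Dulac germ on the standard quadratic domain with parameters `C, R`,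
with first exponents `α, m`, first coefficient `-a`, and generalized Dulac expansion
`z + ∑ i, z ^ (e i) Rhat i`. The petals enter as germs at `0`, through their directions and their
opening. -/
structure IsParabolicGeneralizedDulacGerm (C R : ℝ) (f : ℂ → ℂ) (α a : ℝ) (m : ℤ)
    (e : ℕ → ℝ) (Rhat : ℕ → Transseries) : Prop where
  C_pos : 0 < C
  R_pos : 0 < R
  one_lt : 1 < α
  a_ne : a ≠ 0
  analytic : DifferentiableOn ℂ f (standardQuadraticDomain C R)
  /-- `f` maps the half-line `arg z = 0` of the domain, that is `ζ` real, to the half-line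
  `arg z = 0` (as germs: for `a < 0` the image of a given domain need not lie in the same one). -/
  real_axis : ∀ x : ℝ, (x : ℂ) ∈ standardQuadraticDomain C R → ∃ y : ℝ, f x = zpowC 1 y
  uniform : ∃ c > 0, ∀ ζ ∈ standardQuadraticDomain C R,
    ‖f ζ - zpowC 1 ζ + (a : ℂ) * zpowC α ζ * ζ⁻¹ ^ m‖ ≤ c * ‖zpowC α ζ * ζ⁻¹ ^ (m + 1)‖
  e_zero : e 0 = α
  e_strictMono : StrictMono e
  e_tendsto : Tendsto e atTop atTop
  e_fg : FinitelyGeneratedExponents (Set.range e)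
  expansion : ∀ k : ℤ, ∃ F : ℕ → ℂ → ℂ,
    (∀ i, ∃ μ > (α - 1) / 2,
      HasLogGevreyExpansion μ (petalDirection α k) (petalOpening α) (F i) (Rhat i)) ∧
    ∀ n : ℕ, ∃ δ > 0, ∀ θ' ∈ Set.Ioo 0 (petalOpening α),
      (fun ζ => f ζ - zpowC 1 ζ - ∑ i ∈ Finset.range (n + 1), zpowC (e i) ζ * F i ζ⁻¹)
        =o[sectorFilter (petalDirection α k) θ'] fun ζ => zpowC (e n + δ) ζ

/-! Put `X = fhat - z` and `u = Ψ'`. Expanded by Taylor, Abel's equation reads `∑_{n ≥ 0} u⁽ⁿ⁾ X ^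
(n + 1) / (n + 1)! = 1`, that is, `u = X⁻¹ - ∑_{n ≥ 1} u⁽ⁿ⁾ X ^ n / (n + 1)!`. A derivative lowers
the exponents of `z` by `1` and a factor `X` raises them by at least `α`, so the right-hand side
contracts the `z`-adic filtration `ZGe`, with gain `α - 1`. The fixed point is constructed in
`exists_deriv_fatouCoordinate`, and `isFormalFatouCoordinate_of_derivZ_eq` shows that a primitive of
it solves Abel's equation.

The fixed point is obtained from the blocks of `fhat` by sums, products, derivations, `z`-adic
limits and one inversion. Its blocks are therefore integrally summable of length `0` on every petal
as soon as this class of Laurent series is closed under sum, product, derivation and inverse.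
Closure is proved by direct estimates on the log-Gevrey weights. Products, derivatives and inverses
lower the order, but by an arbitrarily small amount, and the condition that the order exceed `π / θ`
is open. `InBlocks` records the resulting structure. The inversion of `X` (`InBlocks.inv`) needs a
nonzero leading block; this is `Rhat_zero_ne_zero`, the point where the analytic estimate with `a ≠
0` enters.

Integrating a block `z ^ (β - 1) S` of `u` amounts to solving `β T + ℓ² dT/dℓ = S`, which is the
integration equation with exponent `(β, 0)`. For `β ≠ 0` a triangular recursion gives a Laurent
series. For `β = 0` one integrates termwise, and only the term in `ℓ` creates a multiple of `ℓ₂⁻¹ =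
-log ℓ`. Hence the depth `2` and the at most one term with `ℓ₂` (`exists_eulerDeriv_eq`,
`AlmostLaurent`).

For uniqueness, the difference `Δ` of two solutions satisfies `Δ ∘ fhat = Δ`. If `Δ' ≠ 0`, the
leading term of `Δ' X` cannot be cancelled by the higher Taylor terms; so `Δ' = 0`, and in finite
depth the kernel of the derivation consists of the constants (`eq_C_of_eulerDeriv_eq_zero`). -/

namespace Transseries

/-! ### Exponents and the `z`-adic filtration. -/

@[simp] lemma zExp_expo (b : ℝ) (n : ℕ →₀ ℤ) : zExp (expo b n) = b := rfl

@[simp] lemma ellExp_expo (b : ℝ) (n : ℕ →₀ ℤ) (j : ℕ) : ellExp (expo b n) j = n j := rfl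

@[simp] lemma zExp_zero : zExp 0 = 0 := rfl

@[simp] lemma ellExp_zero (j : ℕ) : ellExp 0 j = 0 := rfl

lemma zExp_add (g h : LogExponent) : zExp (g + h) = zExp g + zExp h := rfl

lemma ellExp_add (g h : LogExponent) (j : ℕ) : ellExp (g + h) j = ellExp g j + ellExp h j := rfl

lemma zExp_sub (g h : LogExponent) : zExp (g - h) = zExp g - zExp h := rfl

lemma ellExp_sub (g h : LogExponent) (j : ℕ) : ellExp (g - h) j = ellExp g j - ellExp h j := rfl

lemma expo_add (b c : ℝ) (n k : ℕ →₀ ℤ) : expo (b + c) (n + k) = expo b n + expo c k := rfl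

lemma zExp_mono {g h : LogExponent} (hgh : g ≤ h) : zExp g ≤ zExp h :=
  Prod.Lex.monotone_fst _ _ hgh

lemma logExponent_ext {g h : LogExponent} (h1 : zExp g = zExp h)
    (h2 : ∀ j, ellExp g j = ellExp h j) : g = h := by
  have : (ofLex (ofLex g).2 : ℕ →₀ ℤ) = ofLex (ofLex h).2 := Finsupp.ext h2
  exact Prod.ext h1 this

/-- Every exponent of `z` in the support of `f` is at least `c`. -/
def ZGe (c : ℝ) (f : Transseries) : Prop := ∀ g, f.coeff g ≠ 0 → c ≤ zExp g

lemma ZGe.coeff_eq_zero {c : ℝ} {f : Transseries} (h : ZGe c f) {g : LogExponent}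
    (hg : zExp g < c) : f.coeff g = 0 := by
  by_contra h0
  exact absurd (h g h0) (not_le.2 hg)

lemma ZGe.mono {c d : ℝ} {f : Transseries} (h : ZGe c f) (hd : d ≤ c) : ZGe d f :=
  fun g hg => hd.trans (h g hg)

lemma zGe_zero (c : ℝ) : ZGe c 0 := fun _ hg => absurd rfl hg

lemma ZGe.add {c : ℝ} {f h : Transseries} (hf : ZGe c f) (hh : ZGe c h) : ZGe c (f + h) := by
  intro g hg
  by_contra hlt
  push Not at hlt
  exact hg (by simp [hf.coeff_eq_zero hlt, hh.coeff_eq_zero hlt])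

lemma ZGe.neg {c : ℝ} {f : Transseries} (hf : ZGe c f) : ZGe c (-f) := by
  intro g hg
  exact hf g (by simpa using hg)

lemma ZGe.sub {c : ℝ} {f h : Transseries} (hf : ZGe c f) (hh : ZGe c h) : ZGe c (f - h) := by
  rw [sub_eq_add_neg]
  exact hf.add hh.neg

lemma ZGe.smul {c : ℝ} {f : Transseries} (hf : ZGe c f) (r : ℝ) : ZGe c (r • f) := by
  intro g hg
  exact hf g (right_ne_zero_of_mul (a := r) (by simpa using hg))

lemma ZGe.sum {ι : Type*} {c : ℝ} {s : Finset ι} {f : ι → Transseries}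
    (hf : ∀ i ∈ s, ZGe c (f i)) : ZGe c (∑ i ∈ s, f i) := by
  classical
  induction s using Finset.induction_on with
  | empty => simpa using zGe_zero c
  | insert a s ha ih =>
    rw [Finset.sum_insert ha]
    exact (hf a (by simp)).add (ih fun i hi => hf i (by simp [hi]))

lemma ZGe.mul {c d : ℝ} {f h : Transseries} (hf : ZGe c f) (hh : ZGe d h) :
    ZGe (c + d) (f * h) := by
  intro g hg
  obtain ⟨a, ha, b, hb, rfl⟩ := HahnSeries.support_mul_subset (HahnSeries.mem_support _ _ |>.2 hg)
  rw [zExp_add]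
  exact add_le_add (hf a ha) (hh b hb)

lemma smul_eq_C_mul (r : ℝ) (f : Transseries) : r • f = HahnSeries.C r * f := by
  ext g
  rw [HahnSeries.coeff_smul, HahnSeries.C_apply, HahnSeries.coeff_single_zero_mul, smul_eq_mul]

lemma zGe_single (g : LogExponent) (r : ℝ) : ZGe (zExp g) (HahnSeries.single g r) := by
  intro h hh
  rw [HahnSeries.support_single_subset (HahnSeries.mem_support _ _ |>.2 hh)]

lemma zGe_one : ZGe 0 (1 : Transseries) := zGe_single 0 1

lemma zGe_zPow (b : ℝ) : ZGe b (zPow b) := zGe_single _ _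

lemma zGe_ellProd (j : ℕ) : ZGe 0 (ellProd j) := zGe_single _ _

lemma ZGe.pow {c : ℝ} {f : Transseries} (hf : ZGe c f) (n : ℕ) : ZGe (n * c) (f ^ n) := by
  induction n with
  | zero => simpa using zGe_one
  | succ n ih =>
    rw [pow_succ]
    convert ih.mul hf using 1
    push_cast
    ring

lemma zGe_order (f : Transseries) : ZGe (zExp f.order) f := fun _ hg =>
  zExp_mono (HahnSeries.order_le_of_coeff_ne_zero hg)

lemma ZGe.le_zExp_order {c : ℝ} {f : Transseries} (hf : ZGe c f) (h0 : f ≠ 0) :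
    c ≤ zExp f.order :=
  hf _ (mt HahnSeries.coeff_order_eq_zero.1 h0)

/-- The filtration is separated. This turns identities between infinite sums into estimates modulo
every power of `z`. -/
lemma eq_zero_of_forall_zGe {f : Transseries} (h : ∀ B, ZGe B f) : f = 0 := by
  ext g
  exact (h (zExp g + 1)).coeff_eq_zero (by linarith)

lemma eq_of_forall_zGe_sub {f h : Transseries} (H : ∀ B, ZGe B (f - h)) : f = h :=
  sub_eq_zero.1 (eq_zero_of_forall_zGe H)

/-! ### Diagonal operators, depth and the formal derivations. -/

@[simp] lemma coeff_scale (w : LogExponent → ℝ) (f : Transseries) (g : LogExponent) :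
    (scale w f).coeff g = w g * f.coeff g := rfl

lemma scale_add (w : LogExponent → ℝ) (f h : Transseries) :
    scale w (f + h) = scale w f + scale w h := by
  ext g
  simp [mul_add]

lemma ZGe.scale {c : ℝ} {f : Transseries} (hf : ZGe c f) (w : LogExponent → ℝ) :
    ZGe c (scale w f) := fun g hg => hf g (right_ne_zero_of_mul hg)

lemma scale_eq_zero {w : LogExponent → ℝ} {f : Transseries}
    (h : ∀ g, f.coeff g ≠ 0 → w g = 0) : scale w f = 0 := by
  ext g
  by_cases hg : f.coeff g = 0
  · simp [hg]
  · simp [h g hg]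

/-- A weight additive in the exponent acts as a derivation. The Leibniz rule is needed only against
a monomial. -/
lemma scale_single_mul {w : LogExponent → ℝ} (hw : ∀ g h, w (g + h) = w g + w h)
    (g : LogExponent) (r : ℝ) (f : Transseries) :
    scale w (HahnSeries.single g r * f) =
      HahnSeries.single g r * (w g • f + scale w f) := by
  ext h
  have : w h = w g + w (h - g) := by rw [← hw]; congr 1; abel
  simp only [coeff_scale, HahnSeries.coeff_single_mul, HahnSeries.coeff_add,
    HahnSeries.coeff_smul, smul_eq_mul, this]
  ring

/-- No iterated logarithm `ℓ_{j+1}` with `j ≥ k` occurs in `f`. -/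
def Depth (k : ℕ) (f : Transseries) : Prop := ∀ g, f.coeff g ≠ 0 → ∀ j, k ≤ j → ellExp g j = 0

lemma Depth.mono {k l : ℕ} {f : Transseries} (h : Depth k f) (hkl : k ≤ l) : Depth l f :=
  fun g hg j hj => h g hg j (hkl.trans hj)

lemma depth_zero (k : ℕ) : Depth k 0 := fun _ hg => absurd rfl hg

lemma Depth.add {k : ℕ} {f h : Transseries} (hf : Depth k f) (hh : Depth k h) :
    Depth k (f + h) := by
  intro g hg
  by_cases h0 : f.coeff g = 0
  · exact hh g (by simpa [h0] using hg)
  · exact hf g h0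

lemma Depth.neg {k : ℕ} {f : Transseries} (hf : Depth k f) : Depth k (-f) := by
  intro g hg
  exact hf g (by simpa using hg)

lemma Depth.sub {k : ℕ} {f h : Transseries} (hf : Depth k f) (hh : Depth k h) :
    Depth k (f - h) := by
  rw [sub_eq_add_neg]
  exact hf.add hh.neg

lemma Depth.sum {ι : Type*} {k : ℕ} {s : Finset ι} {f : ι → Transseries}
    (hf : ∀ i ∈ s, Depth k (f i)) : Depth k (∑ i ∈ s, f i) := by
  classical
  induction s using Finset.induction_on with
  | empty => simpa using depth_zero k
  | insert a s ha ih =>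
    rw [Finset.sum_insert ha]
    exact (hf a (by simp)).add (ih fun i hi => hf i (by simp [hi]))

lemma Depth.mul {k : ℕ} {f h : Transseries} (hf : Depth k f) (hh : Depth k h) :
    Depth k (f * h) := by
  intro g hg j hj
  obtain ⟨a, ha, b, hb, rfl⟩ := HahnSeries.support_mul_subset (HahnSeries.mem_support _ _ |>.2 hg)
  simp [ellExp_add, hf a ha j hj, hh b hb j hj]

lemma Depth.scale {k : ℕ} {f : Transseries} (hf : Depth k f) (w : LogExponent → ℝ) :
    Depth k (scale w f) := fun g hg => hf g (right_ne_zero_of_mul hg)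

lemma depth_single {k : ℕ} {g : LogExponent} (hg : ∀ j, k ≤ j → ellExp g j = 0) (r : ℝ) :
    Depth k (HahnSeries.single g r) := by
  intro h hh
  rwa [HahnSeries.support_single_subset (HahnSeries.mem_support _ _ |>.2 hh)]

lemma depth_zPow (k : ℕ) (b : ℝ) : Depth k (zPow b) := depth_single (by simp) _

lemma ellExp_sum_single (b : ℝ) (m j : ℕ) :
    ellExp (expo b (∑ i ∈ Finset.range m, Finsupp.single i 1)) j = if j < m then 1 else 0 := by
  simp [ellExp_expo, Finsupp.finsetSum_apply, Finsupp.single_apply]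

lemma depth_ellProd {k j : ℕ} (hj : j < k) : Depth k (ellProd j) :=
  depth_single (fun i hi => by
    rw [ellExp_sum_single, if_neg (by omega)]) _

lemma Depth.scale_ellExp {k j : ℕ} {f : Transseries} (hf : Depth k f) (hj : k ≤ j) :
    Transseries.scale (fun g => (ellExp g j : ℝ)) f = 0 :=
  scale_eq_zero fun g hg => by simp [hf g hg j hj]

/-- In bounded depth the `finsum` is a genuine finite sum. Additivity of `eulerDeriv` rests on this,
which explains the `Depth` hypotheses that follow. -/
lemma Depth.eulerDeriv_eq {k : ℕ} {f : Transseries} (hf : Depth k f) :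
    eulerDeriv f = Transseries.scale zExp f + ∑ j ∈ Finset.range k,
      ellProd j * Transseries.scale (fun g => (ellExp g j : ℝ)) f := by
  unfold eulerDeriv
  congr 1
  refine finsum_eq_sum_of_support_subset _ fun j hj => ?_
  by_contra h
  simp only [Finset.coe_range, Set.mem_Iio, not_lt] at h
  exact hj (by simp [hf.scale_ellExp h])

lemma ZGe.eulerDeriv {c : ℝ} {f : Transseries} (hf : ZGe c f) : ZGe c (eulerDeriv f) := by
  refine (hf.scale _).add ?_
  by_cases h : (Function.support fun j : ℕ =>
      ellProd j * Transseries.scale (fun g => (ellExp g j : ℝ)) f).Finite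
  · rw [finsum_eq_sum _ h]
    exact ZGe.sum fun j _ => by simpa using (zGe_ellProd j).mul (hf.scale _)
  -- With infinitely many nonzero terms the `finsum` takes its default value `0`, so the bound needs
  -- no depth hypothesis.
  · rw [finsum_of_infinite_support h]
    exact zGe_zero c

lemma Depth.eulerDeriv {k : ℕ} {f : Transseries} (hf : Depth k f) : Depth k (eulerDeriv f) := by
  rw [hf.eulerDeriv_eq]
  exact (hf.scale _).add (Depth.sum fun j hj =>
    (depth_ellProd (Finset.mem_range.1 hj)).mul (hf.scale _))

lemma eulerDeriv_add {k : ℕ} {f h : Transseries} (hf : Depth k f) (hh : Depth k h) :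
    eulerDeriv (f + h) = eulerDeriv f + eulerDeriv h := by
  rw [hf.eulerDeriv_eq, hh.eulerDeriv_eq, (hf.add hh).eulerDeriv_eq]
  simp only [scale_add, mul_add, Finset.sum_add_distrib]
  abel

lemma eulerDeriv_sub {k : ℕ} {f h : Transseries} (hf : Depth k f) (hh : Depth k h) :
    eulerDeriv (f - h) = eulerDeriv f - eulerDeriv h := by
  have := eulerDeriv_add (hf.sub hh) hh
  rw [sub_add_cancel] at this
  rw [this, add_sub_cancel_right]

lemma eulerDeriv_zero : eulerDeriv 0 = 0 := by
  have := eulerDeriv_add (depth_zero 0) (depth_zero 0)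
  simpa using this

lemma eulerDeriv_sum {ι : Type*} {k : ℕ} {s : Finset ι} {f : ι → Transseries}
    (hf : ∀ i ∈ s, Depth k (f i)) : eulerDeriv (∑ i ∈ s, f i) = ∑ i ∈ s, eulerDeriv (f i) := by
  classical
  induction s using Finset.induction_on with
  | empty => simpa using eulerDeriv_zero
  | insert a s ha ih =>
    rw [Finset.sum_insert ha, Finset.sum_insert ha, eulerDeriv_add (k := k) (hf a (by simp))
      (Depth.sum fun i hi => hf i (by simp [hi])), ih fun i hi => hf i (by simp [hi])]

lemma eulerDeriv_zPow_mul {k : ℕ} {f : Transseries} (hf : Depth k f) (b : ℝ) :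
    eulerDeriv (zPow b * f) = zPow b * (b • f + eulerDeriv f) := by
  rw [hf.eulerDeriv_eq, ((depth_zPow k b).mul hf).eulerDeriv_eq]
  unfold zPow
  rw [scale_single_mul zExp_add, mul_add, mul_add, mul_add, Finset.mul_sum, zExp_expo, add_assoc]
  congr 2
  refine Finset.sum_congr rfl fun j _ => ?_
  rw [scale_single_mul (fun g h => by simp [ellExp_add])]
  simp only [ellExp_expo, Finsupp.coe_zero, Pi.zero_apply, Int.cast_zero, smul_eq_C_mul, map_zero, zero_mul,
    zero_add]
  ring

lemma zPow_add (b c : ℝ) : zPow (b + c) = zPow b * zPow c := by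
  simp [zPow, HahnSeries.single_mul_single, ← expo_add]

@[simp] lemma zPow_zero : zPow 0 = 1 := rfl

lemma ellPow_add (b c : ℤ) : ellPow (b + c) = ellPow b * ellPow c := by
  simp [ellPow, HahnSeries.single_mul_single, ← expo_add]

@[simp] lemma ellPow_zero : ellPow 0 = 1 := by
  simp only [ellPow, Finsupp.single_zero]
  rfl

lemma zPow_ne_zero (b : ℝ) : zPow b ≠ 0 := by
  simp [zPow]

lemma derivZ_zPow_mul {k : ℕ} {f : Transseries} (hf : Depth k f) (b : ℝ) :
    derivZ (zPow b * f) = zPow (b - 1) * (b • f + eulerDeriv f) := by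
  rw [derivZ, eulerDeriv_zPow_mul hf, ← mul_assoc, ← zPow_add]
  congr 2
  ring

lemma ZGe.derivZ {c : ℝ} {f : Transseries} (hf : ZGe c f) : ZGe (c - 1) (derivZ f) := by
  have := (zGe_zPow (-1)).mul hf.eulerDeriv
  rwa [neg_add_eq_sub] at this

lemma Depth.derivZ {k : ℕ} {f : Transseries} (hf : Depth k f) : Depth k (derivZ f) :=
  (depth_zPow k _).mul hf.eulerDeriv

lemma derivZ_add {k : ℕ} {f h : Transseries} (hf : Depth k f) (hh : Depth k h) :
    derivZ (f + h) = derivZ f + derivZ h := by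
  rw [derivZ, eulerDeriv_add hf hh, mul_add]
  rfl

lemma derivZ_sub {k : ℕ} {f h : Transseries} (hf : Depth k f) (hh : Depth k h) :
    derivZ (f - h) = derivZ f - derivZ h := by
  rw [derivZ, eulerDeriv_sub hf hh, mul_sub]
  rfl

lemma ZGe.derivZ_iterate {c : ℝ} {f : Transseries} (hf : ZGe c f) (n : ℕ) :
    ZGe (c - n) (Transseries.derivZ^[n] f) := by
  induction n with
  | zero => simpa using hf
  | succ n ih =>
    rw [Function.iterate_succ_apply']
    convert ih.derivZ using 1
    push_cast
    ring

lemma Depth.derivZ_iterate {k : ℕ} {f : Transseries} (hf : Depth k f) (n : ℕ) :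
    Depth k (Transseries.derivZ^[n] f) := by
  induction n with
  | zero => simpa using hf
  | succ n ih =>
    rw [Function.iterate_succ_apply']
    exact ih.derivZ

lemma derivZ_iterate_sub {k : ℕ} {f h : Transseries} (hf : Depth k f) (hh : Depth k h) (n : ℕ) :
    derivZ^[n] (f - h) = derivZ^[n] f - derivZ^[n] h := by
  induction n with
  | zero => rfl
  | succ n ih =>
    rw [Function.iterate_succ_apply', Function.iterate_succ_apply', Function.iterate_succ_apply',
      ih, derivZ_sub (hf.derivZ_iterate n) (hh.derivZ_iterate n)]

/-! ### The kernel of the derivation. -/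

lemma eulerDeriv_C (c : ℝ) : eulerDeriv (HahnSeries.C c) = 0 := by
  have h : ∀ g, (HahnSeries.C c : Transseries).coeff g ≠ 0 → g = 0 := fun g hg =>
    HahnSeries.support_single_subset (a := (0 : LogExponent)) (HahnSeries.mem_support _ _ |>.2 hg)
  have hd : Depth 0 (HahnSeries.C c) := fun g hg j _ => by rw [h g hg]; simp
  rw [hd.eulerDeriv_eq]
  simpa using scale_eq_zero fun g hg => by rw [h g hg]; simp

lemma depth_C (k : ℕ) (c : ℝ) : Depth k (HahnSeries.C c) := depth_single (by simp) c

/-- The leading monomial `g₀` has no power of `z`, and `ℓ_{j+1}` is the first logarithm in it. The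
leading term of the derivative is then `ℓ₁ ⋯ ℓ_{j+1}` times `g₀`, with factor `ellExp g₀ j`. The
summands `i < j` contribute nothing there because their weight vanishes, the summands `i > j`
because they would need a monomial preceding `g₀`. -/
lemma coeff_eulerDeriv_of_lt {k : ℕ} {f : Transseries} (hf : Depth k f) {g₀ : LogExponent}
    (hmin : ∀ g, f.coeff g ≠ 0 → g₀ ≤ g) (hz : zExp g₀ = 0) {j : ℕ} (hj : ellExp g₀ j ≠ 0)
    (hj' : ∀ i < j, ellExp g₀ i = 0) (h0 : f.coeff g₀ ≠ 0) :
    (eulerDeriv f).coeff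
      (g₀ + expo 0 (∑ i ∈ Finset.range (j + 1), Finsupp.single i 1)) ≠ 0 := by
  have hjk : j < k := by
    by_contra h
    exact hj (hf g₀ h0 j (not_lt.1 h))
  have hterm : ∀ i, (ellProd i * scale (fun g => (ellExp g i : ℝ)) f).coeff
      (g₀ + expo 0 (∑ i ∈ Finset.range (j + 1), Finsupp.single i 1)) =
        if i = j then (ellExp g₀ j : ℝ) * f.coeff g₀ else 0 := by
    intro i
    rw [ellProd, HahnSeries.coeff_single_mul, one_mul, coeff_scale]
    set g := g₀ + expo 0 (∑ i ∈ Finset.range (j + 1), Finsupp.single i 1) -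
      expo 0 (∑ i' ∈ Finset.range (i + 1), Finsupp.single i' 1) with hg
    have hge : ∀ l, ellExp g l = ellExp g₀ l + (if l < j + 1 then 1 else 0) -
        (if l < i + 1 then 1 else 0) := fun l => by
      rw [hg, ellExp_sub, ellExp_add, ellExp_sum_single, ellExp_sum_single]
    split_ifs with hij
    · subst hij
      have : g = g₀ := by rw [hg, add_sub_cancel_right]
      rw [this]
    · rcases lt_or_gt_of_ne hij with hij | hij
      · rw [hge i, hj' i hij, if_pos (by omega), if_pos (by omega)]
        simp
      -- The exponents agree up to index `j`, and at index `j + 1` that of `g` is one less.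
      · have hlt : g < g₀ := by
          have h1 : zExp g = zExp g₀ := by simp [hg, zExp_sub, zExp_add]
          refine Prod.Lex.toLex_lt_toLex.2 (Or.inr ⟨h1, Finsupp.Lex.lt_iff.2 ⟨j + 1, ?_, ?_⟩⟩)
          · intro l hl
            have := hge l
            rw [if_pos (by omega), if_pos (by omega)] at this
            exact this.trans (add_sub_cancel_right _ _)
          · have := hge (j + 1)
            rw [if_neg (by omega), if_pos (by omega)] at this
            exact (by omega : ellExp g (j + 1) < ellExp g₀ (j + 1))
        have : f.coeff g = 0 := by
          by_contra h
          exact absurd (hmin g h) (not_le.2 hlt)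
        simp [this]
  rw [hf.eulerDeriv_eq, HahnSeries.coeff_add, coeff_scale, HahnSeries.coeff_sum]
  simp only [hterm, Finset.sum_ite_eq', Finset.mem_range, if_pos hjk, zExp_add, hz, zExp_expo]
  simp [hj, h0]

/-- Remove the constant term. If something remains, its leading monomial is not `1`, and
differentiating that monomial gives a term that nothing else can cancel. -/
lemma eq_C_of_eulerDeriv_eq_zero {k : ℕ} {f : Transseries} (hf : Depth k f)
    (h : eulerDeriv f = 0) : f = HahnSeries.C (f.coeff 0) := by
  by_contra hne
  set u := f - HahnSeries.C (f.coeff 0) with hu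
  have hu0 : u ≠ 0 := sub_ne_zero.2 hne
  have hud : Depth k u := hf.sub (depth_C k _)
  have hue : eulerDeriv u = 0 := by
    rw [hu, eulerDeriv_sub hf (depth_C k _), h, eulerDeriv_C, sub_zero]
  have hmin : ∀ g, u.coeff g ≠ 0 → u.order ≤ g := fun g =>
    HahnSeries.order_le_of_coeff_ne_zero
  have h0 : u.coeff u.order ≠ 0 := mt HahnSeries.coeff_order_eq_zero.1 hu0
  have hg0 : u.order ≠ 0 := by
    intro h
    rw [h] at h0
    apply h0
    rw [hu, HahnSeries.coeff_sub]
    simp [HahnSeries.C_apply]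
  by_cases hz : zExp u.order = 0
  · have hex : ∃ j, ellExp u.order j ≠ 0 := by
      by_contra hall
      push Not at hall
      exact hg0 (logExponent_ext hz (by simpa using hall))
    classical
    refine coeff_eulerDeriv_of_lt hud hmin hz (Nat.find_spec hex) (fun i hi => ?_) h0 ?_
    · simpa using Nat.find_min hex hi
    · rw [hue]; rfl
  -- Here `z` occurs in the leading monomial, which survives with its `z`-exponent as factor: the
  -- logarithmic summands only produce strictly larger exponents.
  · have : (eulerDeriv u).coeff u.order ≠ 0 := by
      rw [hud.eulerDeriv_eq, HahnSeries.coeff_add, coeff_scale, HahnSeries.coeff_sum,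
        Finset.sum_eq_zero, add_zero]
      · exact mul_ne_zero hz h0
      · intro j _
        rw [ellProd, HahnSeries.coeff_single_mul, one_mul, coeff_scale]
        have hlt : u.order - expo 0 (∑ i ∈ Finset.range (j + 1), Finsupp.single i 1)
            < u.order := by
          refine sub_lt_self _ ?_
          refine Prod.Lex.toLex_lt_toLex.2 (Or.inr ⟨rfl, Finsupp.Lex.lt_iff.2 ⟨0, by simp, ?_⟩⟩)
          have := ellExp_sum_single 0 (j + 1) 0
          rw [if_pos (by omega)] at this
          exact (by omega : (0 : ℤ) < ellExp (expo 0 (∑ i ∈ Finset.range (j + 1),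
            Finsupp.single i 1)) 0)
        have : u.coeff (u.order - expo 0 (∑ i ∈ Finset.range (j + 1), Finsupp.single i 1)) = 0 := by
          by_contra h
          exact absurd (hmin _ h) (not_le.2 hlt)
        simp [this]
    rw [hue] at this
    exact this rfl

/-! ### Formal sums, `z`-adic completeness, and uniqueness of the Fatou coordinate. -/

lemma IsFormalSum.coeff {t : ℕ → Transseries} {S : Transseries} (h : IsFormalSum t S)
    (g : LogExponent) : S.coeff g = ∑ᶠ n, (t n).coeff g := by
  obtain ⟨s, hs, rfl⟩ := h
  rw [HahnSeries.SummableFamily.coeff_hsum]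
  simp only [hs]

lemma IsFormalSum.zGe_sub {t : ℕ → Transseries} {S : Transseries} (h : IsFormalSum t S)
    {N : ℕ} {B : ℝ} (ht : ∀ n, N ≤ n → ZGe B (t n)) :
    ZGe B (S - ∑ n ∈ Finset.range N, t n) := by
  intro g hg
  by_contra hlt
  push Not at hlt
  apply hg
  rw [HahnSeries.coeff_sub, h.coeff, HahnSeries.coeff_sum, sub_eq_zero]
  refine finsum_eq_sum_of_support_subset _ fun n hn => ?_
  by_contra hnN
  exact hn ((ht n (by simpa using hnN)).coeff_eq_zero hlt)

/-- Given a sequence, either some later term is at least the first one, or all later terms lie below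
it. In the second case their `z`-exponents are bounded, and the hypothesis applies to the shifted
sequence. -/
lemma isPWO_of_forall_zExp_le {s : Set LogExponent}
    (h : ∀ B : ℝ, {g ∈ s | zExp g ≤ B}.IsPWO) : s.IsPWO := by
  intro f
  by_cases h1 : ∃ n, 0 < n ∧ (f 0 : LogExponent) ≤ f n
  · obtain ⟨n, hn, hle⟩ := h1
    exact ⟨0, n, hn, hle⟩
  · push Not at h1
    obtain ⟨m, n, hmn, hle⟩ := h (zExp (f 0)) (fun n => ⟨f (n + 1), (f (n + 1)).2,
      zExp_mono (h1 (n + 1) n.succ_pos).le⟩)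
    exact ⟨m + 1, n + 1, by omega, hle⟩

/-- Completeness: below a given `z`-exponent only finitely many terms contribute, which gives both
the well-ordered support and the pointwise finiteness. -/
lemma exists_isFormalSum {t : ℕ → Transseries} {c : ℕ → ℝ} (hc : Tendsto c atTop atTop)
    (ht : ∀ n, ZGe (c n) (t n)) : ∃ S, IsFormalSum t S := by
  have hfin : ∀ B, ∃ N, ∀ n, N ≤ n → B < c n := fun B => by
    simpa using (hc.eventually_gt_atTop B).exists_forall_of_atTop
  refine ⟨_, ⟨⟨t, ?_, ?_⟩, fun n => rfl, rfl⟩⟩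
  · refine isPWO_of_forall_zExp_le fun B => ?_
    obtain ⟨N, hN⟩ := hfin B
    refine (Finset.isPWO_bUnion (Finset.range N) (f := fun n => (t n).support) |>.2
      fun n _ => (t n).isPWO_support).mono ?_
    rintro g ⟨hg, hgB⟩
    obtain ⟨n, hn⟩ := Set.mem_iUnion.1 hg
    simp only [Set.mem_iUnion]
    refine ⟨n, Finset.mem_range.2 ?_, hn⟩
    by_contra hnN
    exact absurd (ht n g hn) (not_le.2 (hgB.trans_lt (hN n (not_lt.1 hnN))))
  · intro g
    obtain ⟨N, hN⟩ := hfin (zExp g)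
    refine (Finset.range N).finite_toSet.subset fun n hn => ?_
    by_contra hnN
    exact absurd (ht n g hn) (not_le.2 (hN n (by simpa using hnN)))

/-- Summability is automatic from the growth of the `z`-exponents; only the value of the sum has to
be identified, modulo each power of `z`. -/
lemma isFormalSum_of_zGe_sub {t : ℕ → Transseries} {S : Transseries} {c : ℕ → ℝ}
    (hc : Tendsto c atTop atTop) (ht : ∀ n, ZGe (c n) (t n))
    (hS : ∀ B, ∃ N₀, ∀ N, N₀ ≤ N → ZGe B (S - ∑ n ∈ Finset.range N, t n)) : IsFormalSum t S := by
  obtain ⟨S', hS'⟩ := exists_isFormalSum hc ht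
  have : S' = S := by
    refine eq_of_forall_zGe_sub fun B => ?_
    obtain ⟨N₀, h1⟩ := hS B
    obtain ⟨N₁, h2⟩ := (hc.eventually_ge_atTop B).exists_forall_of_atTop
    have := (hS'.zGe_sub (N := max N₀ N₁) (B := B) fun n hn =>
      (ht n).mono (h2 n ((le_max_right _ _).trans hn))).sub (h1 _ (le_max_left N₀ N₁))
    simpa using this
  rwa [this] at hS'

lemma IsFormalSum.sub {t u : ℕ → Transseries} {S U : Transseries} (h : IsFormalSum t S)
    (h' : IsFormalSum u U) : IsFormalSum (fun n => t n - u n) (S - U) := by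
  obtain ⟨s, hs, rfl⟩ := h
  obtain ⟨s', hs', rfl⟩ := h'
  exact ⟨s - s', fun n => by rw [HahnSeries.SummableFamily.sub_apply, hs, hs'],
    HahnSeries.SummableFamily.hsum_sub⟩

/-- If `f - z` has all its exponents of `z` above `1`, two formal Fatou coordinates of `f` of finite
depth differ by a constant. -/
theorem fatouCoordinate_unique {f Ψ Φ : Transseries} {k : ℕ} (hΨ : Depth k Ψ) (hΦ : Depth k Φ)
    (hf0 : f - zPow 1 ≠ 0) (hf : 1 < zExp (f - zPow 1).order)
    (h1 : IsFormalFatouCoordinate f Ψ) (h2 : IsFormalFatouCoordinate f Φ) :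
    ∃ c : ℝ, Φ = Ψ + HahnSeries.C c := by
  obtain ⟨u, hu, hu'⟩ := h1
  obtain ⟨v, hv, hv'⟩ := h2
  set X := f - zPow 1
  set Δ := Φ - Ψ with hΔ
  have hΔd : Depth k Δ := hΦ.sub hΨ
  have huv : v - u = Δ := by
    rw [sub_eq_iff_eq_add] at hu' hv'
    rw [hu', hv', hΔ]
    abel
  have hsum : IsFormalSum (fun n => ((n ! : ℝ)⁻¹) • (derivZ^[n] Δ * X ^ n)) Δ := by
    have := hv.sub hu
    rw [huv] at this
    convert this using 2 with n
    rw [smul_eq_C_mul, smul_eq_C_mul, smul_eq_C_mul, hΔ, derivZ_iterate_sub hΦ hΨ]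
    ring
  -- In `Δ ∘ f = Δ` the term `n = 0` cancels. The term `n = 1` is `Δ' X`, and each term `n ≥ 2` has
  -- `z`-exponents larger than its leading one by at least `(n - 1) (zExp X.order - 1) > 0`. So the
  -- leading coefficient of `Δ' X` would have to vanish.
  have hδ : derivZ Δ = 0 := by
    by_contra hδ
    have hprod : derivZ Δ * X ≠ 0 := mul_ne_zero hδ hf0
    have h0 := mt HahnSeries.coeff_order_eq_zero.1 hprod
    have hord := HahnSeries.order_mul hδ hf0
    have hc := hsum.coeff (derivZ Δ * X).order
    rw [finsum_eq_sum_of_support_subset (s := Finset.range 2)] at hc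
    · rw [Finset.sum_range_succ, Finset.sum_range_one] at hc
      simp only [smul_eq_C_mul] at hc
      simp only [Nat.factorial_zero, Nat.cast_one, inv_one, map_one, Function.iterate_zero, id_eq,
        pow_zero, mul_one, one_mul, Nat.factorial_one, Function.iterate_one, pow_one,
        left_eq_add] at hc
      exact h0 hc
    · intro n hn
      by_contra hn2
      simp only [Finset.coe_range, Set.mem_Iio, not_lt] at hn2
      refine hn (ZGe.coeff_eq_zero (c := zExp (derivZ Δ).order - (n - 1 : ℕ) +
        n * zExp X.order) ?_ ?_)
      · refine ZGe.smul (ZGe.mul ?_ ((zGe_order X).pow n)) _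
        have := (zGe_order (derivZ Δ)).derivZ_iterate (n - 1)
        rwa [← Function.iterate_succ_apply, show (n - 1).succ = n by omega] at this
      · rw [hord, zExp_add, Nat.cast_sub (by omega)]
        have : (2 : ℝ) ≤ n := by exact_mod_cast hn2
        push_cast
        nlinarith
  have hE : eulerDeriv Δ = 0 := by
    rw [derivZ] at hδ
    exact (mul_eq_zero.1 hδ).resolve_left (zPow_ne_zero _)
  refine ⟨Δ.coeff 0, ?_⟩
  rw [← eq_C_of_eulerDeriv_eq_zero hΔd hE, hΔ]
  abel

/-- A constant changes only the zeroth Taylor term, since its derivative vanishes. -/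
theorem IsFormalFatouCoordinate.add_C {f Ψ : Transseries} {k : ℕ} (hΨ : Depth k Ψ)
    (h : IsFormalFatouCoordinate f Ψ) (c : ℝ) :
    IsFormalFatouCoordinate f (Ψ + HahnSeries.C c) := by
  obtain ⟨u, ⟨s, hs, hsu⟩, hu⟩ := h
  refine ⟨u + HahnSeries.C c, ⟨s + HahnSeries.SummableFamily.single 0 (HahnSeries.C c), ?_, ?_⟩, ?_⟩
  · intro n
    rw [HahnSeries.SummableFamily.add_apply, hs]
    simp only [smul_eq_C_mul]
    rcases Nat.eq_zero_or_pos n with rfl | hn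
    · simp
    · obtain ⟨n, rfl⟩ : ∃ k, n = k + 1 := ⟨n - 1, by omega⟩
      have h0 : derivZ (Ψ + HahnSeries.C c) = derivZ Ψ := by
        rw [derivZ_add hΨ (depth_C k c)]
        rw [derivZ.eq_def (HahnSeries.C c), eulerDeriv_C, mul_zero, add_zero]
      rw [Function.iterate_succ_apply, Function.iterate_succ_apply, h0]
      simp
  · rw [HahnSeries.SummableFamily.hsum_add, hsu, HahnSeries.SummableFamily.hsum_single]
  · rw [← hu]
    abel

end Transseries

/-! ### Finitely generated sets of exponents. -/

section Exponents

variable {G : Finset ℝ}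

lemma nonneg_of_mem_closure (hG : ∀ g ∈ G, 0 < g) {s : ℝ}
    (hs : s ∈ AddSubmonoid.closure (G : Set ℝ)) : 0 ≤ s := by
  induction hs using AddSubmonoid.closure_induction with
  | mem x hx => exact (hG x hx).le
  | zero => exact le_rfl
  | add x y _ _ hx hy => exact add_nonneg hx hy

/-- In a sum bounded by `B`, a generator `a` has multiplicity at most `B / a`. -/
lemma finite_closure_le (hG : ∀ g ∈ G, 0 < g) (B : ℝ) :
    {s ∈ AddSubmonoid.closure (G : Set ℝ) | s ≤ B}.Finite := by
  have hfin : (Set.univ.pi fun a : G => Set.Iic ⌊B / a⌋₊).Finite :=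
    Set.Finite.pi fun _ => Set.finite_Iic _
  refine (hfin.image fun n : G → ℕ => ∑ a : G, n a • (a : ℝ)).subset ?_
  rintro s ⟨hs, hsB⟩
  obtain ⟨f, -, rfl⟩ := AddSubmonoid.mem_closure_finset.1 hs
  refine ⟨fun a => f a, fun a _ => ?_, ?_⟩
  · have ha := hG a a.2
    refine Nat.le_floor ((le_div_iff₀ ha).2 (le_trans ?_ hsB))
    rw [← nsmul_eq_mul]
    exact Finset.single_le_sum (f := fun b => f b • b)
      (fun b hb => nsmul_nonneg (hG b hb).le _) a.2
  · exact Finset.sum_coe_sort G fun a => f a • a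

/-- Add the generators one at a time: the first partial sum to reach `s₀` overshoots it by at most
one generator. -/
lemma exists_split_of_mem_closure {M : ℝ} (hM : ∀ g ∈ G, g ≤ M)
    {s₀ s : ℝ} (hs₀ : 0 ≤ s₀) (hM0 : 0 ≤ M) (hs : s ∈ AddSubmonoid.closure (G : Set ℝ))
    (hle : s₀ ≤ s) :
    ∃ t ∈ AddSubmonoid.closure (G : Set ℝ), ∃ u ∈ AddSubmonoid.closure (G : Set ℝ),
      s = t + u ∧ s₀ ≤ t ∧ t ≤ s₀ + M := by
  induction hs using AddSubmonoid.closure_induction_left with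
  | zero => exact ⟨0, zero_mem _, 0, zero_mem _, by simp, hle, by positivity⟩
  | add_left x hx y hy ih =>
    rcases le_or_gt s₀ y with h | h
    · obtain ⟨t, ht, u, hu, rfl, h1, h2⟩ := ih h
      exact ⟨t, ht, x + u, add_mem (AddSubmonoid.subset_closure hx) hu, by ring, h1, h2⟩
    · exact ⟨x + y, add_mem (AddSubmonoid.subset_closure hx) hy, 0, zero_mem _, by simp, hle, by
        linarith [hM x hx]⟩

/-- Split `s = t + u` with `s₀ ≤ t ≤ s₀ + M`. There are finitely many such `t`, so it suffices to
adjoin the positive differences `t - s₀` to the generators. -/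
lemma exists_closure_sub (hG : ∀ g ∈ G, 0 < g) {s₀ : ℝ} (hs₀ : 0 ≤ s₀) :
    ∃ G' : Finset ℝ, (∀ g ∈ G', 0 < g) ∧ ∀ s ∈ AddSubmonoid.closure (G : Set ℝ), s₀ ≤ s →
      s - s₀ ∈ AddSubmonoid.closure (G' : Set ℝ) := by
  classical
  set M := ∑ g ∈ G, g with hM
  have hM0 : 0 ≤ M := Finset.sum_nonneg fun g hg => (hG g hg).le
  have hGM : ∀ g ∈ G, g ≤ M := fun g hg =>
    Finset.single_le_sum (f := fun g => g) (fun b hb => (hG b hb).le) hg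
  set F := (finite_closure_le hG (s₀ + M)).toFinset with hF
  refine ⟨G ∪ (F.image fun t => t - s₀).filter fun t => 0 < t, ?_, ?_⟩
  · intro g hg
    rcases Finset.mem_union.1 hg with hg | hg
    · exact hG g hg
    · exact (Finset.mem_filter.1 hg).2
  · intro s hs hle
    obtain ⟨t, ht, u, hu, rfl, h1, h2⟩ := exists_split_of_mem_closure hGM hs₀ hM0 hs hle
    rw [add_sub_right_comm]
    refine add_mem ?_ (AddSubmonoid.closure_mono (by simp) hu)
    rcases h1.eq_or_lt with h | h
    · rw [h, sub_self]
      exact zero_mem _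
    · refine AddSubmonoid.subset_closure ?_
      simp only [Finset.coe_union, Finset.coe_filter, Set.mem_union, Set.mem_ofPred_eq]
      exact Or.inr ⟨Finset.mem_image_of_mem _ (by simp [hF, ht, h2]), sub_pos.2 h⟩

/-- The differences with the least exponent, for a finitely generated set of exponents. -/
lemma exists_closure_sub_of_finitelyGenerated {e : ℕ → ℝ} (he : Monotone e)
    (hfg : FinitelyGeneratedExponents (Set.range e)) :
    ∃ G : Finset ℝ, (∀ g ∈ G, 0 < g) ∧ ∀ i, e i - e 0 ∈ AddSubmonoid.closure (G : Set ℝ) := by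
  obtain ⟨c, G, hG, h⟩ := hfg
  obtain ⟨s₀, hs₀, h0⟩ := h (e 0) ⟨0, rfl⟩
  obtain ⟨G', hG', h'⟩ := exists_closure_sub hG (nonneg_of_mem_closure hG hs₀)
  refine ⟨G', hG', fun i => ?_⟩
  obtain ⟨s, hs, hi⟩ := h (e i) ⟨i, rfl⟩
  have := h' s hs (by linarith [he (Nat.zero_le i)])
  rwa [h0, hi, add_sub_add_left_eq_sub]

/-- The monoid is locally finite, has least element `0`, and is unbounded because it contains the
multiples of `δ`; hence it is order-isomorphic to `ℕ`. -/
lemma exists_enumeration (hG : ∀ g ∈ G, 0 < g) {δ : ℝ} (hδ : δ ∈ G) (c : ℝ) :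
    ∃ β : ℕ → ℝ, StrictMono β ∧ β 0 = c ∧ Tendsto β atTop atTop ∧
      ∀ b, b ∈ Set.range β ↔ b - c ∈ AddSubmonoid.closure (G : Set ℝ) := by
  classical
  let S := AddSubmonoid.closure (G : Set ℝ)
  have hδS : δ ∈ S := AddSubmonoid.subset_closure hδ
  have hpos := hG δ hδ
  let : LocallyFiniteOrder S := LocallyFiniteOrder.ofFiniteIcc fun a b =>
    Set.Finite.of_finite_image (f := Subtype.val)
      ((finite_closure_le hG b).subset (by
        rintro _ ⟨x, hx, rfl⟩
        exact ⟨x.2, hx.2⟩)) Subtype.val_injective.injOn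
  let : OrderBot S := { bot := 0, bot_le := fun s => nonneg_of_mem_closure hG s.2 }
  have : NoMaxOrder S := ⟨fun s => ⟨s + ⟨δ, hδS⟩, by
    rw [← Subtype.coe_lt_coe]; push_cast; linarith⟩⟩
  let : SuccOrder S := LinearLocallyFiniteOrder.succOrder S
  let : PredOrder S := LinearLocallyFiniteOrder.predOrder S
  let E : S ≃o ℕ := orderIsoNatOfLinearSuccPredArch
  have hmono : StrictMono fun n => c + (E.symm n : ℝ) := fun a b hab => by
    have : E.symm a < E.symm b := E.symm.strictMono hab
    rw [← Subtype.coe_lt_coe] at this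
    simpa using this
  have hrange : ∀ b, b ∈ Set.range (fun n => c + (E.symm n : ℝ)) ↔ b - c ∈ S := by
    intro b
    constructor
    · rintro ⟨n, rfl⟩
      simp
    · intro hb
      exact ⟨E ⟨b - c, hb⟩, by simp⟩
  refine ⟨_, hmono, ?_, ?_, hrange⟩
  · have : E.symm 0 = (⊥ : S) := E.symm.map_bot
    change c + (E.symm 0 : ℝ) = c
    rw [this]
    exact add_zero c
  · refine tendsto_atTop_atTop_of_monotone hmono.monotone fun B => ?_
    obtain ⟨k, hk⟩ := Archimedean.arch (B - c) hpos
    obtain ⟨n, hn⟩ := (hrange (c + k • δ)).2 (by rw [add_sub_cancel_left]; exact nsmul_mem hδS k)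
    exact ⟨n, le_of_le_of_eq (by linarith) hn.symm⟩

end Exponents

/-! ### Calculus of the log-Gevrey weights. -/

section GevreyWeights

/-- The base of the log-Gevrey weights: `log n * exp (-1 / log n)` for `n ≥ 2`. -/
noncomputable def gevreyBase (n : ℕ) : ℝ :=
  Real.log (max n 2 : ℕ) * Real.exp (-(Real.log (max n 2 : ℕ))⁻¹)

/-- The log-Gevrey weights of order `m`. -/
noncomputable def gevreyWeight (m : ℝ) (n : ℕ) : ℝ := (gevreyBase n / m) ^ n

lemma log_max_pos (n : ℕ) : 0 < Real.log (max n 2 : ℕ) :=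
  Real.log_pos (by exact_mod_cast (lt_max_of_lt_right one_lt_two : 1 < max n 2))

lemma gevreyBase_pos (n : ℕ) : 0 < gevreyBase n := mul_pos (log_max_pos n) (Real.exp_pos _)

lemma gevreyBase_mono : Monotone gevreyBase := by
  intro a b hab
  have h : Real.log (max a 2 : ℕ) ≤ Real.log (max b 2 : ℕ) := by
    refine Real.log_le_log (by positivity) ?_
    exact_mod_cast max_le_max_right 2 hab
  unfold gevreyBase
  refine mul_le_mul h (Real.exp_le_exp.2 (neg_le_neg ?_)) (Real.exp_pos _).le (log_max_pos b).le
  exact inv_anti₀ (log_max_pos a) h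

lemma gevreyBase_le (n : ℕ) : gevreyBase n ≤ n + 2 := by
  have h1 : Real.log (max n 2 : ℕ) ≤ n + 2 := by
    have h := Real.log_le_sub_one_of_pos (x := (max n 2 : ℕ)) (by positivity)
    have h2 : ((max n 2 : ℕ) : ℝ) ≤ n + 2 := by exact_mod_cast (by omega : max n 2 ≤ n + 2)
    linarith
  have h2 : Real.exp (-(Real.log (max n 2 : ℕ))⁻¹) ≤ 1 :=
    Real.exp_le_one_iff.2 (neg_nonpos.2 (inv_nonneg.2 (log_max_pos n).le))
  calc gevreyBase n ≤ Real.log (max n 2 : ℕ) * 1 :=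
        mul_le_mul_of_nonneg_left h2 (log_max_pos n).le
    _ ≤ _ := by rwa [mul_one]

lemma tendsto_log_max : Tendsto (fun n : ℕ => Real.log (max n 2 : ℕ)) atTop atTop :=
  Real.tendsto_log_atTop.comp (tendsto_natCast_atTop_atTop.comp
    (tendsto_atTop_mono (fun n => le_max_left n 2) tendsto_id))

lemma tendsto_exp_neg_inv_log_max :
    Tendsto (fun n : ℕ => Real.exp (-(Real.log (max n 2 : ℕ))⁻¹)) atTop (𝓝 1) := by
  have := (Real.continuous_exp.tendsto _).comp (tendsto_inv_atTop_zero.comp tendsto_log_max).neg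
  simpa [Function.comp_def] using this

lemma tendsto_gevreyBase : Tendsto gevreyBase atTop atTop :=
  tendsto_log_max.atTop_mul_pos one_pos tendsto_exp_neg_inv_log_max

lemma tendsto_gevreyBase_ratio :
    Tendsto (fun n => gevreyBase (n + 1) / gevreyBase n) atTop (𝓝 1) := by
  have h1 : Tendsto (fun n : ℕ => Real.log (max (n + 1) 2 : ℕ) / Real.log (max n 2 : ℕ)) atTop
      (𝓝 1) := by
    have h2 : Tendsto (fun n : ℕ => 1 + (Real.log (max n 2 : ℕ))⁻¹) atTop (𝓝 1) := by
      simpa using (tendsto_inv_atTop_zero.comp tendsto_log_max).const_add 1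
    refine tendsto_of_tendsto_of_tendsto_of_le_of_le tendsto_const_nhds h2 (fun n => ?_)
      (fun n => ?_)
    · refine (one_le_div (log_max_pos n)).2 (Real.log_le_log (by positivity) ?_)
      exact_mod_cast (by omega : max n 2 ≤ max (n + 1) 2)
    · have hp := log_max_pos n
      change _ ≤ _
      rw [div_le_iff₀ hp, add_mul, inv_mul_cancel₀ hp.ne', one_mul]
      have h3 : Real.log (max (n + 1) 2 : ℕ) ≤ Real.log ((max n 2 : ℕ) * Real.exp 1) := by
        refine Real.log_le_log (by positivity) ?_
        have h4 : ((max (n + 1) 2 : ℕ) : ℝ) ≤ (max n 2 : ℕ) * 2 := by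
          exact_mod_cast (by omega : max (n + 1) 2 ≤ max n 2 * 2)
        refine h4.trans (mul_le_mul_of_nonneg_left ?_ (by positivity))
        linarith [Real.add_one_le_exp 1]
      rwa [Real.log_mul (by positivity) (Real.exp_pos _).ne', Real.log_exp] at h3
  have h2 : Tendsto (fun n : ℕ => Real.exp (-(Real.log (max (n + 1) 2 : ℕ))⁻¹) /
      Real.exp (-(Real.log (max n 2 : ℕ))⁻¹)) atTop (𝓝 1) := by
    have := ((tendsto_add_atTop_iff_nat 1).2 tendsto_exp_neg_inv_log_max).div
      tendsto_exp_neg_inv_log_max one_ne_zero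
    rwa [div_one] at this
  simpa [gevreyBase, mul_div_mul_comm] using h1.mul h2

lemma gevreyWeight_pos {m : ℝ} (hm : 0 < m) (n : ℕ) : 0 < gevreyWeight m n :=
  pow_pos (div_pos (gevreyBase_pos n) hm) n

@[simp] lemma gevreyWeight_zero (m : ℝ) : gevreyWeight m 0 = 1 := pow_zero _

lemma gevreyWeight_anti {m m' : ℝ} (hm' : 0 < m') (h : m' ≤ m) (n : ℕ) :
    gevreyWeight m n ≤ gevreyWeight m' n :=
  pow_le_pow_left₀ (div_pos (gevreyBase_pos n) (hm'.trans_le h)).le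
    (div_le_div_of_nonneg_left (gevreyBase_pos n).le hm' h) n

lemma gevreyWeight_eq {m m' : ℝ} (hm : m ≠ 0) (hm' : m' ≠ 0) (n : ℕ) :
    gevreyWeight m n = (m' / m) ^ n * gevreyWeight m' n := by
  rw [gevreyWeight, gevreyWeight, ← mul_pow]
  congr 1
  field_simp

/-- Since the base increases with `n`, both factors may be compared with powers of the base at `n`.
Convolutions of remainders are controlled by this. -/
lemma gevreyWeight_mul_le {m : ℝ} (hm : 0 < m) {k n : ℕ} (hk : k ≤ n) :
    gevreyWeight m k * gevreyWeight m (n - k) ≤ gevreyWeight m n := by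
  have hb : ∀ j, 0 ≤ gevreyBase j / m := fun j => (div_pos (gevreyBase_pos j) hm).le
  have hmono : ∀ j ≤ n, gevreyBase j / m ≤ gevreyBase n / m := fun j hj =>
    div_le_div_of_nonneg_right (gevreyBase_mono hj) hm.le
  calc gevreyWeight m k * gevreyWeight m (n - k)
      ≤ (gevreyBase n / m) ^ k * (gevreyBase n / m) ^ (n - k) :=
        mul_le_mul (pow_le_pow_left₀ (hb k) (hmono k hk) k)
          (pow_le_pow_left₀ (hb _) (hmono _ (Nat.sub_le n k)) _) (pow_nonneg (hb _) _)
          (pow_nonneg (hb _) _)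
    _ = gevreyWeight m n := by rw [← pow_add, Nat.add_sub_cancel' hk, gevreyWeight]

lemma exists_le_mul_of_eventually {a b : ℕ → ℝ} (hb : ∀ n, 0 < b n)
    (h : ∀ᶠ n in atTop, a n ≤ b n) : ∃ C > 0, ∀ n, a n ≤ C * b n := by
  obtain ⟨N, hN⟩ := h.exists_forall_of_atTop
  have hs : 0 ≤ ∑ i ∈ Finset.range N, |a i| / b i :=
    Finset.sum_nonneg fun i _ => div_nonneg (abs_nonneg _) (hb i).le
  refine ⟨1 + ∑ i ∈ Finset.range N, |a i| / b i, by positivity, fun n => ?_⟩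
  rcases lt_or_ge n N with hn | hn
  · have h1 : |a n| / b n ≤ ∑ i ∈ Finset.range N, |a i| / b i :=
      Finset.single_le_sum (f := fun i => |a i| / b i)
        (fun i _ => div_nonneg (abs_nonneg _) (hb i).le) (Finset.mem_range.2 hn)
    rw [← div_le_iff₀ (hb n)]
    have h2 := div_le_div_of_nonneg_right (le_abs_self (a n)) (hb n).le
    linarith
  · nlinarith [hN n hn, hb n]

/-- Lowering the order gains the geometric factor `(m' / m) ^ n`, which absorbs any polynomial
factor. -/
lemma exists_mul_gevreyWeight_le {m m' : ℝ} (hm' : 0 < m') (h : m' < m) :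
    ∃ C > 0, ∀ n : ℕ, (n + 1) * gevreyWeight m n ≤ C * gevreyWeight m' n := by
  refine exists_le_mul_of_eventually (gevreyWeight_pos hm') ?_
  have hm := hm'.trans h
  have h1 : Tendsto (fun n : ℕ => ((n : ℝ) + 1) * (m' / m) ^ n) atTop (𝓝 0) := by
    have hr : |m' / m| < 1 := by
      rw [abs_of_pos (by positivity)]
      exact (div_lt_one hm).2 h
    have := (tendsto_pow_const_mul_const_pow_of_abs_lt_one 1 hr).add
      (tendsto_pow_atTop_nhds_zero_of_abs_lt_one hr)
    simpa [add_mul] using this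
  filter_upwards [h1.eventually_le_const one_pos] with n hn
  rw [gevreyWeight_eq hm.ne' hm'.ne', ← mul_assoc]
  exact mul_le_of_le_one_left (gevreyWeight_pos hm' n).le hn

/-- Consecutive bases have ratio tending to `1`, so a slightly smaller order `m₁` absorbs the shift
in the `n`-th power. The one remaining base factor grows at most linearly and is absorbed by passing
from `m₁` to `m'`. -/
lemma exists_gevreyWeight_succ_le {m m' : ℝ} (hm' : 0 < m') (h : m' < m) :
    ∃ C > 0, ∀ n : ℕ, gevreyWeight m (n + 1) ≤ C * gevreyWeight m' n := by
  obtain ⟨m₁, h1, h2⟩ := exists_between h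
  have hm1 := hm'.trans h1
  have hm := hm'.trans h
  obtain ⟨C, hC, hCn⟩ := exists_mul_gevreyWeight_le hm' h1
  have hev : ∀ᶠ n in atTop, gevreyWeight m (n + 1) ≤ 3 / m * C * gevreyWeight m' n := by
    filter_upwards [tendsto_gevreyBase_ratio.eventually_le_const ((one_lt_div hm1).2 h2)] with n hn
    rw [div_le_iff₀ (gevreyBase_pos n)] at hn
    have h3 : gevreyBase (n + 1) / m ≤ gevreyBase n / m₁ := by
      rw [div_le_div_iff₀ hm hm1]
      calc gevreyBase (n + 1) * m₁ ≤ m / m₁ * gevreyBase n * m₁ :=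
            mul_le_mul_of_nonneg_right hn hm1.le
        _ = _ := by field_simp
    have h4 : gevreyBase (n + 1) / m ≤ 3 / m * (n + 1) := by
      rw [div_mul_eq_mul_div]
      refine div_le_div_of_nonneg_right ?_ hm.le
      have := gevreyBase_le (n + 1)
      push_cast at this
      have h0 : (0 : ℝ) ≤ n := n.cast_nonneg
      linarith
    calc gevreyWeight m (n + 1) = (gevreyBase (n + 1) / m) ^ n * (gevreyBase (n + 1) / m) :=
          pow_succ _ _
      _ ≤ gevreyWeight m₁ n * (3 / m * (n + 1)) :=
          mul_le_mul (pow_le_pow_left₀ (div_pos (gevreyBase_pos _) hm).le h3 n) h4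
            (div_pos (gevreyBase_pos _) hm).le (gevreyWeight_pos hm1 n).le
      _ = 3 / m * ((n + 1) * gevreyWeight m₁ n) := by ring
      _ ≤ 3 / m * (C * gevreyWeight m' n) :=
          mul_le_mul_of_nonneg_left (hCn n) (by positivity)
      _ = _ := by ring
  obtain ⟨C', hC', h'⟩ := exists_le_mul_of_eventually
    (fun n => mul_pos (mul_pos (div_pos three_pos hm) hC) (gevreyWeight_pos hm' n)) hev
  exact ⟨C' * (3 / m * C), by positivity, fun n => (h' n).trans_eq (by ring)⟩

/-- The coefficients of the inverse of a power series with log-Gevrey coefficients. -/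
lemma exists_inverse_coeff_le {m m' K L : ℝ} (hm' : 0 < m') (h : m' < m) (hK : 0 ≤ K)
    (hL : 0 ≤ L) {a b : ℕ → ℝ} (ha : ∀ n, |a n| ≤ K * gevreyWeight m n)
    (hb : ∀ n, 1 ≤ n → |b n| ≤ L * ∑ k ∈ Finset.range n, |a (k + 1)| * |b (n - (k + 1))|) :
    ∃ A > 0, ∀ n, |b n| ≤ A * gevreyWeight m' n := by
  have hm := hm'.trans h
  have hsum : Summable fun k : ℕ => (m' / m) ^ (k + 1) * gevreyBase (k + 1) := by
    have hr : ‖m' / m‖ < 1 := by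
      rw [Real.norm_of_nonneg (by positivity)]
      exact (div_lt_one hm).2 h
    have h1 : Summable fun k : ℕ => ((k : ℝ) + 3) * (m' / m) ^ k := by
      simpa [add_mul] using (summable_pow_mul_geometric_of_norm_lt_one 1 hr).add
        ((summable_geometric_of_norm_lt_one hr).mul_left 3)
    refine Summable.of_nonneg_of_le
      (fun k => mul_nonneg (by positivity) (gevreyBase_pos _).le) (fun k => ?_) h1
    rw [mul_comm]
    refine mul_le_mul ?_ ?_ (by positivity) (by positivity)
    · have := gevreyBase_le (k + 1)
      push_cast at this
      linarith
    · exact pow_le_pow_of_le_one (by positivity) ((div_le_one hm).2 h.le) (Nat.le_succ k)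
  set T := ∑' k : ℕ, (m' / m) ^ (k + 1) * gevreyBase (k + 1)
  -- Beyond `N` the base exceeds the constant `L * K * T` produced by one step of the recursion, so
  -- the induction closes with the same `A`; the terms up to `N` determine `A`.
  obtain ⟨N, hN⟩ := (tendsto_gevreyBase.eventually_ge_atTop (L * K * T)).exists_forall_of_atTop
  have hw := gevreyWeight_pos hm'
  set A := 1 + ∑ i ∈ Finset.range (N + 1), |b i| / gevreyWeight m' i with hA
  have hs : 0 ≤ ∑ i ∈ Finset.range (N + 1), |b i| / gevreyWeight m' i :=
    Finset.sum_nonneg fun i _ => div_nonneg (abs_nonneg _) (hw i).le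
  have hApos : 0 < A := by positivity
  refine ⟨A, hApos, fun n => ?_⟩
  induction n using Nat.strong_induction_on with
  | _ n ih =>
    rcases lt_or_ge n (N + 1) with hn | hn
    · have h1 : |b n| / gevreyWeight m' n ≤ ∑ i ∈ Finset.range (N + 1), |b i| / gevreyWeight m' i :=
        Finset.single_le_sum (f := fun i => |b i| / gevreyWeight m' i)
          (fun i _ => div_nonneg (abs_nonneg _) (hw i).le) (Finset.mem_range.2 hn)
      rw [← div_le_iff₀ (hw n)]
      linarith
    · have hn1 : 1 ≤ n := by omega
      -- Writing the weight at `k + 1` with the base at `n` leaves `(gevreyBase (k + 1) / gevreyBase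
      -- n) ^ (k + 1)`. One power of this ratio is kept: the convolution thereby gains `1 /
      -- gevreyBase n` over the weight at `n`.
      have hterm : ∀ k ∈ Finset.range n, |a (k + 1)| * |b (n - (k + 1))| ≤
          K * A * gevreyWeight m' n / gevreyBase n * ((m' / m) ^ (k + 1) * gevreyBase (k + 1)) := by
        intro k hk
        have hk := Finset.mem_range.1 hk
        have hμ : ∀ j, 0 < gevreyBase j / m' := fun j => div_pos (gevreyBase_pos j) hm'
        have h1 : gevreyWeight m' (k + 1) ≤
            (gevreyBase n / m') ^ (k + 1) * (gevreyBase (k + 1) / gevreyBase n) := by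
          have hr : gevreyBase (k + 1) / gevreyBase n ≤ 1 :=
            (div_le_one (gevreyBase_pos n)).2 (gevreyBase_mono (by omega))
          have hr0 : 0 ≤ gevreyBase (k + 1) / gevreyBase n :=
            (div_pos (gevreyBase_pos _) (gevreyBase_pos n)).le
          have e1 : gevreyWeight m' (k + 1) = (gevreyBase n / m') ^ (k + 1) *
              (gevreyBase (k + 1) / gevreyBase n) ^ (k + 1) := by
            have := (gevreyBase_pos n).ne'
            rw [gevreyWeight, ← mul_pow]
            congr 1
            field_simp
          rw [e1]
          exact mul_le_mul_of_nonneg_left (pow_le_of_le_one hr0 hr (Nat.succ_ne_zero k))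
            (pow_nonneg (hμ n).le _)
        have h2 : gevreyWeight m' (n - (k + 1)) ≤ (gevreyBase n / m') ^ (n - (k + 1)) :=
          pow_le_pow_left₀ (hμ _).le
            (div_le_div_of_nonneg_right (gevreyBase_mono (Nat.sub_le _ _)) hm'.le) _
        calc |a (k + 1)| * |b (n - (k + 1))|
            ≤ (K * gevreyWeight m (k + 1)) * (A * gevreyWeight m' (n - (k + 1))) :=
              mul_le_mul (ha _) (ih _ (by omega)) (abs_nonneg _)
                (mul_nonneg hK (gevreyWeight_pos hm _).le)
          _ = K * A * (m' / m) ^ (k + 1) *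
                (gevreyWeight m' (k + 1) * gevreyWeight m' (n - (k + 1))) := by
              rw [gevreyWeight_eq hm.ne' hm'.ne']
              ring
          _ ≤ K * A * (m' / m) ^ (k + 1) *
                (((gevreyBase n / m') ^ (k + 1) * (gevreyBase (k + 1) / gevreyBase n)) *
                  (gevreyBase n / m') ^ (n - (k + 1))) := by
              refine mul_le_mul_of_nonneg_left ?_ (by positivity)
              refine mul_le_mul h1 h2 (hw _).le ?_
              exact mul_nonneg (pow_nonneg (hμ n).le _)
                (div_pos (gevreyBase_pos _) (gevreyBase_pos n)).le
          _ = _ := by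
              have e2 : gevreyWeight m' n =
                  (gevreyBase n / m') ^ (k + 1) * (gevreyBase n / m') ^ (n - (k + 1)) := by
                rw [← pow_add, Nat.add_sub_cancel' (by omega), gevreyWeight]
              rw [e2]
              ring
      have hbase := gevreyBase_pos n
      calc |b n| ≤ L * ∑ k ∈ Finset.range n, |a (k + 1)| * |b (n - (k + 1))| := hb n hn1
        _ ≤ L * (K * A * gevreyWeight m' n / gevreyBase n * T) := by
            refine mul_le_mul_of_nonneg_left ((Finset.sum_le_sum hterm).trans ?_) hL
            rw [← Finset.mul_sum]
            refine mul_le_mul_of_nonneg_left ?_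
              (div_nonneg (mul_nonneg (by positivity) (hw n).le) hbase.le)
            exact hsum.sum_le_tsum _ fun k _ => mul_nonneg (by positivity) (gevreyBase_pos _).le
        _ = A * gevreyWeight m' n * (L * K * T / gevreyBase n) := by ring
        _ ≤ A * gevreyWeight m' n * 1 := by
            refine mul_le_mul_of_nonneg_left ?_ (mul_pos hApos (hw n)).le
            exact (div_le_one hbase).2 (hN n (by omega))
        _ = _ := mul_one _

end GevreyWeights

/-! ### Log-Gevrey estimates for sums, products and inverses of germs. -/

section LogGevreyGerms

variable {d θ : ℝ} {P Q : PowerSeries ℝ} {G H : ℂ → ℂ} {m m' : ℝ}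

/-- The value at `x` of the sum of the first `n` terms of a power series. -/
noncomputable def partialSum (P : PowerSeries ℝ) (n : ℕ) (x : ℂ) : ℂ :=
  ∑ k ∈ Finset.range n, ((PowerSeries.coeff k P : ℝ) : ℂ) * x ^ k

@[simp] lemma partialSum_zero (P : PowerSeries ℝ) (x : ℂ) : partialSum P 0 x = 0 := by
  simp [partialSum]

lemma partialSum_succ (P : PowerSeries ℝ) (n : ℕ) (x : ℂ) :
    partialSum P (n + 1) x = partialSum P n x + ((PowerSeries.coeff n P : ℝ) : ℂ) * x ^ n :=
  Finset.sum_range_succ _ _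

lemma partialSum_add (P Q : PowerSeries ℝ) (n : ℕ) (x : ℂ) :
    partialSum (P + Q) n x = partialSum P n x + partialSum Q n x := by
  simp [partialSum, add_mul, Finset.sum_add_distrib]

lemma partialSum_mul (P Q : PowerSeries ℝ) (n : ℕ) (x : ℂ) :
    partialSum (P * Q) n x =
      ∑ k ∈ Finset.range n, ((PowerSeries.coeff k P : ℝ) : ℂ) * x ^ k * partialSum Q (n - k) x := by
  induction n with
  | zero => simp
  | succ n ih =>
    rw [partialSum_succ, ih, Finset.sum_range_succ, PowerSeries.coeff_mul,
      Finset.Nat.sum_antidiagonal_eq_sum_range_succ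
        (f := fun i j => PowerSeries.coeff i P * PowerSeries.coeff j Q), Finset.sum_range_succ]
    have : ∀ k ∈ Finset.range n, ((PowerSeries.coeff k P : ℝ) : ℂ) * x ^ k * partialSum Q (n + 1 - k) x =
        ((PowerSeries.coeff k P : ℝ) : ℂ) * x ^ k * partialSum Q (n - k) x +
          ((PowerSeries.coeff k P : ℝ) : ℂ) * ((PowerSeries.coeff (n - k) Q : ℝ) : ℂ) * x ^ n := by
      intro k hk
      have hk := Finset.mem_range.1 hk
      rw [Nat.succ_sub hk.le, Nat.succ_eq_add_one, partialSum_succ, mul_add]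
      congr 1
      rw [← Nat.add_sub_cancel' hk.le, pow_add, Nat.add_sub_cancel' hk.le]
      ring
    rw [Finset.sum_congr rfl this, Finset.sum_add_distrib]
    simp only [Nat.sub_self, Nat.add_sub_cancel_left]
    rw [partialSum_succ, partialSum_zero]
    push_cast
    rw [add_mul, Finset.sum_mul]
    ring

lemma partialSum_one {n : ℕ} (hn : 1 ≤ n) (x : ℂ) : partialSum 1 n x = 1 := by
  obtain ⟨n, rfl⟩ := Nat.exists_eq_add_of_le' hn
  rw [partialSum, Finset.sum_range_succ']
  simp [PowerSeries.coeff_one]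

lemma partialSum_X_mul (P : PowerSeries ℝ) (n : ℕ) (x : ℂ) :
    partialSum (PowerSeries.X * P) (n + 1) x = x * partialSum P n x := by
  rw [partialSum, Finset.sum_range_succ', partialSum, Finset.mul_sum]
  simp only [PowerSeries.coeff_succ_X_mul, PowerSeries.coeff_zero_X_mul]
  simp only [Complex.ofReal_zero, zero_mul, add_zero]
  exact Finset.sum_congr rfl fun k _ => by ring

lemma logSector_mono {θ' θ'' M M' : ℝ} (hθ : θ' ≤ θ'') (hM : M' ≤ M) :
    logSector d θ' M ⊆ logSector d θ'' M' := fun ζ hζ =>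
  ⟨hζ.1.trans_le (by linarith), hM.trans_lt hζ.2⟩

lemma isOpen_logSector (d θ M : ℝ) : IsOpen (logSector d θ M) :=
  IsOpen.inter (isOpen_lt (f := fun ζ : ℂ => |ζ.im + d|) (by fun_prop) continuous_const)
    (isOpen_lt continuous_const Complex.continuous_re)

lemma lt_norm_of_mem_logSector {M : ℝ} {ζ : ℂ} (hζ : ζ ∈ logSector d θ M) : M < ‖ζ‖ :=
  hζ.2.trans_le (Complex.re_le_norm ζ)

lemma norm_inv_le_of_mem_logSector {M : ℝ} (hM : 0 < M) {ζ : ℂ} (hζ : ζ ∈ logSector d θ M) :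
    ‖ζ⁻¹‖ ≤ M⁻¹ := by
  rw [norm_inv]
  exact inv_anti₀ hM (lt_norm_of_mem_logSector hζ).le

lemma ne_zero_of_mem_logSector {M : ℝ} (hM : 0 < M) {ζ : ℂ} (hζ : ζ ∈ logSector d θ M) :
    ζ ≠ 0 :=
  norm_pos_iff.1 (hM.trans (lt_norm_of_mem_logSector hζ))

/-- Log-Gevrey estimates of order `m`, in the logarithmic chart. -/
structure LogGevreyOn (m : ℝ) (G : ℂ → ℂ) (P : PowerSeries ℝ) (K : ℝ) (U : Set ℂ) : Prop where
  pos : 0 < K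
  differentiableOn : DifferentiableOn ℂ G U
  bound : ∀ ζ ∈ U, ∀ n, ‖G ζ - partialSum P n ζ⁻¹‖ ≤ K * gevreyWeight m n * ‖ζ⁻¹‖ ^ n

lemma LogGevreyOn.mono {K : ℝ} {U V : Set ℂ} (h : LogGevreyOn m G P K U) (hVU : V ⊆ U)
    (hm' : 0 < m') (hm : m' ≤ m) : LogGevreyOn m' G P K V where
  pos := h.pos
  differentiableOn := h.differentiableOn.mono hVU
  bound ζ hζ n := (h.bound ζ (hVU hζ) n).trans (mul_le_mul_of_nonneg_right
    (mul_le_mul_of_nonneg_left (gevreyWeight_anti hm' hm n) h.pos.le) (by positivity))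

lemma LogGevreyOn.norm_le {K : ℝ} {U : Set ℂ} (h : LogGevreyOn m G P K U) {ζ : ℂ} (hζ : ζ ∈ U) :
    ‖G ζ‖ ≤ K := by
  simpa using h.bound ζ hζ 0

lemma exists_seq_logSector (d M : ℝ) {θ : ℝ} (hθ : 0 < θ) :
    ∃ z : ℕ → ℂ, (∀ n, z n ∈ logSector d θ M) ∧ Tendsto (fun n => ‖(z n)⁻¹‖) atTop (𝓝 0) := by
  refine ⟨fun n => ⟨|M| + 1 + n, -d⟩, fun n => ⟨?_, ?_⟩, ?_⟩
  · simpa using hθ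
  · have := le_abs_self M
    have h0 : (0 : ℝ) ≤ n := n.cast_nonneg
    change M < |M| + 1 + n
    linarith
  · refine squeeze_zero (fun n => norm_nonneg _) (fun n => ?_) tendsto_one_div_add_atTop_nhds_zero_nat
    rw [norm_inv, one_div]
    refine inv_anti₀ (by positivity) (le_trans ?_ (Complex.re_le_norm _))
    change (n : ℝ) + 1 ≤ |M| + 1 + n
    linarith [abs_nonneg M]

/-- The monomial of degree `n` is the difference of two consecutive remainders. Divide by `|ℓ| ^ n`
and let `ℓ → 0` along the bisecting direction. -/
lemma LogGevreyOn.coeff_le {K M : ℝ} (h : LogGevreyOn m G P K (logSector d θ M))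
    (hθ : 0 < θ) (hM : 0 < M) (n : ℕ) : |PowerSeries.coeff n P| ≤ K * gevreyWeight m n := by
  obtain ⟨z, hz, hz0⟩ := exists_seq_logSector d M hθ
  have hlim : Tendsto (fun j => K * gevreyWeight m n + K * gevreyWeight m (n + 1) * ‖(z j)⁻¹‖)
      atTop (𝓝 (K * gevreyWeight m n)) := by
    simpa using (hz0.const_mul (K * gevreyWeight m (n + 1))).const_add (K * gevreyWeight m n)
  refine ge_of_tendsto' hlim fun j => ?_
  have hpos : 0 < ‖(z j)⁻¹‖ := by
    rw [norm_pos_iff]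
    exact inv_ne_zero (ne_zero_of_mem_logSector hM (hz j))
  have h1 := h.bound _ (hz j) n
  have h2 := h.bound _ (hz j) (n + 1)
  have h3 : ‖((PowerSeries.coeff n P : ℝ) : ℂ) * (z j)⁻¹ ^ n‖ ≤
      K * gevreyWeight m n * ‖(z j)⁻¹‖ ^ n + K * gevreyWeight m (n + 1) * ‖(z j)⁻¹‖ ^ (n + 1) := by
    have : ((PowerSeries.coeff n P : ℝ) : ℂ) * (z j)⁻¹ ^ n = (G (z j) - partialSum P n (z j)⁻¹) -
        (G (z j) - partialSum P (n + 1) (z j)⁻¹) := by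
      rw [partialSum_succ]
      ring
    rw [this]
    exact (norm_sub_le _ _).trans (add_le_add h1 h2)
  rw [norm_mul, norm_pow, Complex.norm_real, Real.norm_eq_abs] at h3
  refine le_of_mul_le_mul_right (h3.trans_eq ?_) (pow_pos hpos n)
  ring

lemma LogGevreyOn.add {K L : ℝ} {U : Set ℂ} (h : LogGevreyOn m G P K U)
    (h' : LogGevreyOn m H Q L U) : LogGevreyOn m (G + H) (P + Q) (K + L) U where
  pos := add_pos h.pos h'.pos
  differentiableOn := h.differentiableOn.add h'.differentiableOn
  bound ζ hζ n := by
    rw [partialSum_add, Pi.add_apply, add_sub_add_comm, add_mul, add_mul]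
    exact (norm_add_le _ _).trans (add_le_add (h.bound ζ hζ n) (h'.bound ζ hζ n))

/-- The remainder is `∑ p_k x ^ k (H - Q_{n-k}) + (G - P_n) H`, where subscripts of series denote
partial sums. Each of these `n + 1` terms is at most `K L` times the weight at `n` times `|x| ^ n`;
the count `n + 1` costs the drop from `m` to `m'`. -/
lemma LogGevreyOn.mul {K L M C : ℝ} (hm : 0 < m)
    (h : LogGevreyOn m G P K (logSector d θ M)) (h' : LogGevreyOn m H Q L (logSector d θ M))
    (hθ : 0 < θ) (hM : 0 < M) (hC : 0 < C)
    (hCw : ∀ n : ℕ, (n + 1) * gevreyWeight m n ≤ C * gevreyWeight m' n) :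
    LogGevreyOn m' (G * H) (P * Q) (K * L * C) (logSector d θ M) where
  pos := mul_pos (mul_pos h.pos h'.pos) hC
  differentiableOn := h.differentiableOn.mul h'.differentiableOn
  bound ζ hζ n := by
    have hK := h.pos
    have hL := h'.pos
    have hw := gevreyWeight_pos hm
    set x := ζ⁻¹
    have e : (G * H) ζ - partialSum (P * Q) n x = ∑ k ∈ Finset.range n,
        ((PowerSeries.coeff k P : ℝ) : ℂ) * x ^ k * (H ζ - partialSum Q (n - k) x) +
          (G ζ - partialSum P n x) * H ζ := by
      simp only [mul_sub, Finset.sum_sub_distrib]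
      rw [partialSum_mul, ← Finset.sum_mul, Pi.mul_apply, partialSum]
      ring
    have hterm : ∀ k ∈ Finset.range n,
        ‖((PowerSeries.coeff k P : ℝ) : ℂ) * x ^ k * (H ζ - partialSum Q (n - k) x)‖ ≤
          K * L * gevreyWeight m n * ‖x‖ ^ n := by
      intro k hk
      have hk := (Finset.mem_range.1 hk).le
      rw [norm_mul, norm_mul, norm_pow, Complex.norm_real, Real.norm_eq_abs]
      calc |PowerSeries.coeff k P| * ‖x‖ ^ k * ‖H ζ - partialSum Q (n - k) x‖
          ≤ (K * gevreyWeight m k) * ‖x‖ ^ k * (L * gevreyWeight m (n - k) * ‖x‖ ^ (n - k)) := by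
            refine mul_le_mul (mul_le_mul_of_nonneg_right (h.coeff_le hθ hM k) (by positivity))
              (h'.bound ζ hζ _) (norm_nonneg _) ?_
            exact mul_nonneg (mul_pos hK (hw k)).le (by positivity)
        _ = K * L * (gevreyWeight m k * gevreyWeight m (n - k)) * ‖x‖ ^ n := by
            rw [← Nat.add_sub_cancel' hk, pow_add, Nat.add_sub_cancel' hk]
            ring
        _ ≤ _ := mul_le_mul_of_nonneg_right (mul_le_mul_of_nonneg_left
            (gevreyWeight_mul_le hm hk) (by positivity)) (by positivity)
    calc ‖(G * H) ζ - partialSum (P * Q) n x‖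
        ≤ ∑ k ∈ Finset.range n, K * L * gevreyWeight m n * ‖x‖ ^ n +
            K * gevreyWeight m n * ‖x‖ ^ n * L := by
          rw [e]
          refine (norm_add_le _ _).trans (add_le_add ((norm_sum_le _ _).trans
            (Finset.sum_le_sum hterm)) ?_)
          rw [norm_mul]
          refine mul_le_mul (h.bound ζ hζ n) (h'.norm_le hζ) (norm_nonneg _) ?_
          exact mul_nonneg (mul_pos hK (hw n)).le (by positivity)
      _ = K * L * ((n + 1) * gevreyWeight m n) * ‖x‖ ^ n := by
          rw [Finset.sum_const, Finset.card_range, nsmul_eq_mul]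
          ring
      _ ≤ K * L * (C * gevreyWeight m' n) * ‖x‖ ^ n :=
          mul_le_mul_of_nonneg_right (mul_le_mul_of_nonneg_left (hCw n) (by positivity))
            (by positivity)
      _ = _ := by ring

lemma LogGevreyOn.div_X {K M C : ℝ} (h : LogGevreyOn m G (PowerSeries.X * P) K (logSector d θ M))
    (hM : 0 < M) (hC : 0 < C) (hCw : ∀ n : ℕ, gevreyWeight m (n + 1) ≤ C * gevreyWeight m' n) :
    LogGevreyOn m' (fun ζ => ζ * G ζ) P (K * C) (logSector d θ M) where
  pos := mul_pos h.pos hC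
  differentiableOn := differentiableOn_id.mul h.differentiableOn
  bound ζ hζ n := by
    have h0 := ne_zero_of_mem_logSector hM hζ
    have hK := h.pos
    have e : ζ * G ζ - partialSum P n ζ⁻¹ =
        ζ * (G ζ - partialSum (PowerSeries.X * P) (n + 1) ζ⁻¹) := by
      rw [partialSum_X_mul, mul_sub, ← mul_assoc, mul_inv_cancel₀ h0, one_mul]
    rw [e, norm_mul]
    calc ‖ζ‖ * ‖G ζ - partialSum (PowerSeries.X * P) (n + 1) ζ⁻¹‖
        ≤ ‖ζ‖ * (K * gevreyWeight m (n + 1) * ‖ζ⁻¹‖ ^ (n + 1)) :=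
          mul_le_mul_of_nonneg_left (h.bound ζ hζ _) (norm_nonneg _)
      _ = K * gevreyWeight m (n + 1) * ‖ζ⁻¹‖ ^ n := by
          rw [pow_succ, norm_inv]
          field_simp
      _ ≤ K * (C * gevreyWeight m' n) * ‖ζ⁻¹‖ ^ n := by gcongr; exact hCw n
      _ = _ := by ring

/-- With `B = P⁻¹`, the remainder is `G⁻¹ (1 - G B_n)`, and `P⁻¹ P = 1` gives `1 - G B_n = -∑ b_k x
^ k (G - P_{n-k})`, which is estimated as for products. -/
lemma LogGevreyOn.inv {K M A C c : ℝ} (hm : 0 < m) (hm' : 0 < m')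
    (h : LogGevreyOn m G P K (logSector d θ M)) (hA : 0 < A)
    (hC : 0 < C) (hc : 0 < c) (hP : PowerSeries.constantCoeff P ≠ 0)
    (hinv : ∀ n, |PowerSeries.coeff n P⁻¹| ≤ A * gevreyWeight m n)
    (hG : ∀ ζ ∈ logSector d θ M, c ≤ ‖G ζ‖)
    (hCw : ∀ n : ℕ, (n + 1) * gevreyWeight m n ≤ C * gevreyWeight m' n) :
    LogGevreyOn m' G⁻¹ P⁻¹ (c⁻¹ * (1 + A * K * C)) (logSector d θ M) where
  pos := by have := h.pos; positivity
  differentiableOn := h.differentiableOn.inv fun ζ hζ =>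
    norm_pos_iff.1 (hc.trans_le (hG ζ hζ))
  bound ζ hζ n := by
    have hK := h.pos
    have hw := gevreyWeight_pos hm
    have hw' := gevreyWeight_pos hm' n
    set x := ζ⁻¹
    have hG0 : G ζ ≠ 0 := norm_pos_iff.1 (hc.trans_le (hG ζ hζ))
    have hGi : ‖(G ζ)⁻¹‖ ≤ c⁻¹ := by
      rw [norm_inv]
      exact inv_anti₀ hc (hG ζ hζ)
    have key : ‖1 - G ζ * partialSum P⁻¹ n x‖ ≤
        (1 + A * K * C) * gevreyWeight m' n * ‖x‖ ^ n := by
      -- The partial sums of the series `1` equal `1` only from `n = 1` on.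
      rcases Nat.eq_zero_or_pos n with rfl | hn
      · simp only [partialSum_zero, mul_zero, sub_zero, norm_one, gevreyWeight_zero, pow_zero,
          mul_one]
        have : 0 < A * K * C := by positivity
        linarith
      have e : 1 - G ζ * partialSum P⁻¹ n x = -∑ k ∈ Finset.range n,
          ((PowerSeries.coeff k P⁻¹ : ℝ) : ℂ) * x ^ k * (G ζ - partialSum P (n - k) x) := by
        simp only [mul_sub, Finset.sum_sub_distrib]
        rw [← partialSum_mul, PowerSeries.inv_mul_cancel P hP, partialSum_one hn, ← Finset.sum_mul,
          partialSum]
        ring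
      have hterm : ∀ k ∈ Finset.range n,
          ‖((PowerSeries.coeff k P⁻¹ : ℝ) : ℂ) * x ^ k * (G ζ - partialSum P (n - k) x)‖ ≤
            A * K * gevreyWeight m n * ‖x‖ ^ n := by
        intro k hk
        have hk := (Finset.mem_range.1 hk).le
        rw [norm_mul, norm_mul, norm_pow, Complex.norm_real, Real.norm_eq_abs]
        calc |PowerSeries.coeff k P⁻¹| * ‖x‖ ^ k * ‖G ζ - partialSum P (n - k) x‖
            ≤ (A * gevreyWeight m k) * ‖x‖ ^ k * (K * gevreyWeight m (n - k) * ‖x‖ ^ (n - k)) := by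
              refine mul_le_mul (mul_le_mul_of_nonneg_right (hinv k) (by positivity))
                (h.bound ζ hζ _) (norm_nonneg _) ?_
              exact mul_nonneg (mul_pos hA (hw k)).le (by positivity)
          _ = A * K * (gevreyWeight m k * gevreyWeight m (n - k)) * ‖x‖ ^ n := by
              rw [← Nat.add_sub_cancel' hk, pow_add, Nat.add_sub_cancel' hk]
              ring
          _ ≤ _ := mul_le_mul_of_nonneg_right (mul_le_mul_of_nonneg_left
              (gevreyWeight_mul_le hm hk) (by positivity)) (by positivity)
      rw [e, norm_neg]
      calc _ ≤ ∑ k ∈ Finset.range n, A * K * gevreyWeight m n * ‖x‖ ^ n :=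
            (norm_sum_le _ _).trans (Finset.sum_le_sum hterm)
        _ = A * K * (n * gevreyWeight m n) * ‖x‖ ^ n := by
            rw [Finset.sum_const, Finset.card_range, nsmul_eq_mul]
            ring
        _ ≤ A * K * (C * gevreyWeight m' n) * ‖x‖ ^ n :=
            mul_le_mul_of_nonneg_right (mul_le_mul_of_nonneg_left (by linarith [hCw n, hw n])
              (by positivity)) (by positivity)
        _ ≤ _ := by
            have : 0 ≤ gevreyWeight m' n * ‖x‖ ^ n := by positivity
            nlinarith
    have e : G⁻¹ ζ - partialSum P⁻¹ n x = (G ζ)⁻¹ * (1 - G ζ * partialSum P⁻¹ n x) := by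
      rw [Pi.inv_apply, mul_sub, mul_one, ← mul_assoc, inv_mul_cancel₀ hG0, one_mul]
    rw [e, norm_mul]
    calc _ ≤ c⁻¹ * ((1 + A * K * C) * gevreyWeight m' n * ‖x‖ ^ n) :=
          mul_le_mul hGi key (norm_nonneg _) (inv_nonneg.2 hc.le)
      _ = _ := by ring

end LogGevreyGerms

/-! ### The derivative, and stability of summable power series. -/

section LogSummable

variable {d θ : ℝ} {P Q : PowerSeries ℝ} {G H : ℂ → ℂ} {m m' : ℝ}

/-- The derivation `ℓ² d/dℓ` on power series in `ℓ`. -/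
noncomputable def ellDeriv (P : PowerSeries ℝ) : PowerSeries ℝ :=
  PowerSeries.X * (PowerSeries.X * PowerSeries.derivative ℝ P)

lemma coeff_zero_ellDeriv (P : PowerSeries ℝ) : PowerSeries.coeff 0 (ellDeriv P) = 0 :=
  PowerSeries.coeff_zero_X_mul _

lemma coeff_succ_ellDeriv (P : PowerSeries ℝ) (n : ℕ) :
    PowerSeries.coeff (n + 1) (ellDeriv P) = n * PowerSeries.coeff n P := by
  rw [ellDeriv, PowerSeries.coeff_succ_X_mul]
  rcases n with _ | n
  · simp
  · rw [PowerSeries.coeff_succ_X_mul, PowerSeries.coeff_derivative]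
    push_cast
    ring

/-- In the chart `ℓ = 1 / ζ` one has `d/dζ = -ℓ² d/dℓ`; this raises degrees by one, whence `n + 1`.
-/
lemma hasDerivAt_partialSum_inv (P : PowerSeries ℝ) (n : ℕ) {ζ : ℂ} (hζ : ζ ≠ 0) :
    HasDerivAt (fun ζ => partialSum P n ζ⁻¹) (-partialSum (ellDeriv P) (n + 1) ζ⁻¹) ζ := by
  induction n with
  | zero =>
    simp only [partialSum_zero, zero_add, partialSum_succ, coeff_zero_ellDeriv]
    simpa using hasDerivAt_const ζ (0 : ℂ)
  | succ n ih =>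
    simp only [partialSum_succ P n]
    rw [partialSum_succ _ (n + 1), coeff_succ_ellDeriv, neg_add]
    refine ih.add ?_
    refine (((hasDerivAt_inv hζ).pow n).const_mul
      ((PowerSeries.coeff n P : ℝ) : ℂ)).congr_deriv ?_
    rcases n with _ | n
    · simp
    · push_cast
      rw [← inv_pow]
      ring

lemma closedBall_subset_logSector {θ' θ'' M ρ : ℝ} (hρ : ρ < (θ'' - θ') / 2) {ζ : ℂ}
    (hζ : ζ ∈ logSector d θ' (M + ρ)) : Metric.closedBall ζ ρ ⊆ logSector d θ'' M := by
  intro z hz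
  have hz : ‖z - ζ‖ ≤ ρ := by simpa [dist_eq_norm] using hz
  have h1 : |(z - ζ).im| ≤ ρ := (Complex.abs_im_le_norm _).trans hz
  have h2 : |(z - ζ).re| ≤ ρ := (Complex.abs_re_le_norm _).trans hz
  obtain ⟨h3, h4⟩ := hζ
  simp only [Complex.sub_im, Complex.sub_re] at h1 h2
  rw [abs_le] at h1 h2
  rw [abs_lt] at h3
  exact ⟨abs_lt.2 ⟨by linarith, by linarith⟩, by linarith⟩

/-- In the logarithmic chart sectors are half-strips, so a disc of fixed radius around a point of
the smaller one stays in the larger one. Cauchy's inequality on this disc bounds the derivative of a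
remainder. There `|1 / z|` exceeds `|1 / ζ|` by a factor at most `q = m / m'`, and `q ^ n` is
exactly the ratio of the weights of orders `m'` and `m`. -/
lemma LogGevreyOn.neg_deriv {K M θ' θ'' : ℝ} (hm' : 0 < m') (hmm : m' < m) (hθ' : 0 < θ')
    (hθ : θ' < θ'') (hM : 0 < M) (h : LogGevreyOn m G P K (logSector d θ'' M)) :
    ∃ M' > 0, ∃ K', LogGevreyOn m' (fun ζ => -deriv G ζ) (ellDeriv P) K' (logSector d θ' M') := by
  have hm := hm'.trans hmm
  have hK := h.pos
  set q := m / m' with hq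
  have hq1 : 1 < q := (one_lt_div hm').2 hmm
  set ρ := (θ'' - θ') / 4 with hρ
  have hρ0 : 0 < ρ := by rw [hρ]; linarith
  obtain ⟨C, hC, hCw⟩ := exists_mul_gevreyWeight_le hm' hmm
  -- The first `ρ` keeps the disc in the larger half-strip; the last term makes `‖ζ‖ ≤ q * (‖ζ‖ -
  -- ρ)`.
  set M' := M + ρ + ρ * q / (q - 1) with hM'
  have hq0 : 0 < q - 1 := by linarith
  have hx0 : 0 < ρ * q / (q - 1) := by positivity
  have hsub : ∀ ζ ∈ logSector d θ' M', Metric.closedBall ζ ρ ⊆ logSector d θ'' M :=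
    fun ζ hζ => closedBall_subset_logSector (by rw [hρ]; linarith)
      (logSector_mono le_rfl (by linarith) hζ)
  have hmem : ∀ ζ ∈ logSector d θ' M', ζ ∈ logSector d θ'' M := fun ζ hζ =>
    hsub ζ hζ (Metric.mem_closedBall_self hρ0.le)
  have hdiff : ∀ ζ ∈ logSector d θ'' M, DifferentiableAt ℂ G ζ := fun ζ hζ =>
    h.differentiableOn.differentiableAt ((isOpen_logSector d θ'' M).mem_nhds hζ)
  -- the estimate of the next remainder, by Cauchy's inequality
  have hcauchy : ∀ ζ ∈ logSector d θ' M', ∀ n, ‖-deriv G ζ - partialSum (ellDeriv P) (n + 1) ζ⁻¹‖ ≤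
      K / ρ * gevreyWeight m' n * ‖ζ⁻¹‖ ^ n := by
    intro ζ hζ n
    have hζ0 := ne_zero_of_mem_logSector hM (hmem ζ hζ)
    have hnorm : ∀ z ∈ Metric.closedBall ζ ρ, ‖z⁻¹‖ ≤ q * ‖ζ⁻¹‖ := by
      intro z hz
      have hz' : ‖z - ζ‖ ≤ ρ := by simpa [dist_eq_norm] using hz
      have hz0 := norm_pos_iff.2 (ne_zero_of_mem_logSector hM (hsub ζ hζ hz))
      have h1 : ‖ζ‖ ≤ ‖z‖ + ρ := by
        have := norm_sub_norm_le ζ z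
        rw [norm_sub_rev] at this
        linarith
      have h2 : ρ * q / (q - 1) ≤ ‖ζ‖ := by
        have := lt_norm_of_mem_logSector hζ
        linarith
      rw [div_le_iff₀ hq0] at h2
      rw [norm_inv, norm_inv, ← div_eq_mul_inv, inv_eq_one_div,
        div_le_div_iff₀ hz0 (norm_pos_iff.2 hζ0)]
      nlinarith
    have hd : ∀ z ∈ logSector d θ'' M, HasDerivAt (fun ζ => G ζ - partialSum P n ζ⁻¹)
        (deriv G z + partialSum (ellDeriv P) (n + 1) z⁻¹) z := by
      intro z hz
      rw [← sub_neg_eq_add]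
      exact (hdiff z hz).hasDerivAt.sub
        (hasDerivAt_partialSum_inv P n (ne_zero_of_mem_logSector hM hz))
    have hb : ∀ z ∈ Metric.sphere ζ ρ, ‖G z - partialSum P n z⁻¹‖ ≤
        K * gevreyWeight m n * (q * ‖ζ⁻¹‖) ^ n := fun z hz =>
      (h.bound z (hsub ζ hζ (Metric.sphere_subset_closedBall hz)) n).trans
        (mul_le_mul_of_nonneg_left (pow_le_pow_left₀ (norm_nonneg _)
          (hnorm z (Metric.sphere_subset_closedBall hz)) n)
          (mul_pos hK (gevreyWeight_pos hm n)).le)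
    have hdc : DiffContOnCl ℂ (fun ζ => G ζ - partialSum P n ζ⁻¹) (Metric.ball ζ ρ) := by
      refine DifferentiableOn.diffContOnCl ?_
      rw [closure_ball ζ hρ0.ne']
      exact fun z hz => (hd z (hsub ζ hζ hz)).differentiableAt.differentiableWithinAt
    have := Complex.norm_deriv_le_of_forall_mem_sphere_norm_le hρ0 hdc hb
    rw [(hd ζ (hmem ζ hζ)).deriv] at this
    rw [← neg_add', norm_neg]
    refine this.trans_eq ?_
    rw [gevreyWeight_eq hm.ne' hm'.ne', mul_pow, hq, div_pow, div_pow]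
    field_simp
  have hcoeff : ∀ n, |PowerSeries.coeff n (ellDeriv P)| ≤
      K * C * (m' / gevreyBase 0) * gevreyWeight m' n := by
    intro n
    have hpos : 0 ≤ K * C * (m' / gevreyBase 0) :=
      mul_nonneg (by positivity) (div_pos hm' (gevreyBase_pos 0)).le
    rcases n with _ | n
    · rw [coeff_zero_ellDeriv, abs_zero]
      exact mul_nonneg hpos (gevreyWeight_pos hm' 0).le
    · have h1 := h.coeff_le (hθ'.trans hθ) hM n
      have hw := gevreyWeight_pos hm n
      have h2 : gevreyWeight m' n ≤ m' / gevreyBase 0 * gevreyWeight m' (n + 1) := by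
        have hb0 := gevreyBase_pos 0
        have h3 : gevreyWeight m' (n + 1) ≥ gevreyBase 0 / m' * gevreyWeight m' n := by
          have hb : ∀ j, 0 ≤ gevreyBase j / m' := fun j => (div_pos (gevreyBase_pos j) hm').le
          rw [gevreyWeight, pow_succ', gevreyWeight]
          refine mul_le_mul ?_ (pow_le_pow_left₀ (hb n) ?_ n) (pow_nonneg (hb n) n) (hb _)
          · exact div_le_div_of_nonneg_right (gevreyBase_mono (Nat.zero_le _)) hm'.le
          · exact div_le_div_of_nonneg_right (gevreyBase_mono (Nat.le_succ _)) hm'.le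
        calc gevreyWeight m' n
            = m' / gevreyBase 0 * (gevreyBase 0 / m' * gevreyWeight m' n) := by field_simp
          _ ≤ _ := mul_le_mul_of_nonneg_left h3 (div_pos hm' hb0).le
      rw [coeff_succ_ellDeriv, abs_mul, Nat.abs_cast]
      calc (n : ℝ) * |PowerSeries.coeff n P| ≤ n * (K * gevreyWeight m n) :=
            mul_le_mul_of_nonneg_left h1 n.cast_nonneg
        _ ≤ K * ((n + 1) * gevreyWeight m n) := by nlinarith
        _ ≤ K * (C * (m' / gevreyBase 0 * gevreyWeight m' (n + 1))) :=
            mul_le_mul_of_nonneg_left ((hCw n).trans (mul_le_mul_of_nonneg_left h2 hC.le)) hK.le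
        _ = _ := by ring
  have hKρ : 0 < K / ρ := by positivity
  have hL : 0 < K * C * (m' / gevreyBase 0) :=
    mul_pos (by positivity) (div_pos hm' (gevreyBase_pos 0))
  refine ⟨M', by positivity, K / ρ + K * C * (m' / gevreyBase 0), ⟨by positivity, ?_, ?_⟩⟩
  · exact ((h.differentiableOn.deriv (isOpen_logSector d θ'' M)).mono hmem).neg
  · intro ζ hζ n
    -- Cauchy's inequality for the remainder of index `n` of `G` controls the remainder of index `n
    -- + 1` of the derivative, so one coefficient is put back.
    have e : -deriv G ζ - partialSum (ellDeriv P) n ζ⁻¹ =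
        (-deriv G ζ - partialSum (ellDeriv P) (n + 1) ζ⁻¹) +
          ((PowerSeries.coeff n (ellDeriv P) : ℝ) : ℂ) * ζ⁻¹ ^ n := by
      rw [partialSum_succ]
      ring
    rw [e, add_mul, add_mul]
    refine (norm_add_le _ _).trans (add_le_add (hcauchy ζ hζ n) ?_)
    rw [norm_mul, norm_pow, Complex.norm_real, Real.norm_eq_abs]
    exact mul_le_mul_of_nonneg_right (hcoeff n) (by positivity)

/-- The power series `P` in `ℓ` is integrally summable of length `0` on the `ℓ`-cusp of the petals of
direction `d`, opening `θ`; expressed in the logarithmic chart. -/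
def LogSummable (d θ : ℝ) (P : PowerSeries ℝ) : Prop :=
  ∃ m > Real.pi / θ, ∃ G : ℂ → ℂ, ∀ θ' ∈ Set.Ioo 0 θ, ∃ M > 0, ∃ K,
    LogGevreyOn m G P K (logSector d θ' M)

lemma logSummable_of_polynomial (hθ : 0 < θ) {N : ℕ}
    (h : ∀ k, N ≤ k → PowerSeries.coeff k P = 0) : LogSummable d θ P := by
  have hm : 0 < Real.pi / θ + 1 := by positivity
  have hw := gevreyWeight_pos hm
  have hstab : ∀ n, N ≤ n → ∀ x, partialSum P n x = partialSum P N x := by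
    intro n hn x
    induction n, hn using Nat.le_induction with
    | base => rfl
    | succ n hn ih => rw [partialSum_succ, ih, h n hn, Complex.ofReal_zero, zero_mul, add_zero]
  -- A polynomial has every order; `π / θ + 1` is one admissible choice. Only the remainders with `n
  -- < N` are nonzero.
  refine ⟨Real.pi / θ + 1, lt_add_one _, fun ζ => partialSum P N ζ⁻¹, fun θ' _ =>
    ⟨1, one_pos, ?_⟩⟩
  set S := ∑ n ∈ Finset.range N, (∑ k ∈ Finset.range N, |PowerSeries.coeff k P|) /
    gevreyWeight (Real.pi / θ + 1) n with hS
  have hS0 : ∀ n, 0 ≤ (∑ k ∈ Finset.range N, |PowerSeries.coeff k P|) /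
      gevreyWeight (Real.pi / θ + 1) n := fun n =>
    div_nonneg (Finset.sum_nonneg fun _ _ => abs_nonneg _) (hw n).le
  have hSpos : 0 ≤ S := Finset.sum_nonneg fun n _ => hS0 n
  refine ⟨1 + S, by positivity, ?_, ?_⟩
  · exact fun ζ hζ => (hasDerivAt_partialSum_inv P N
      (ne_zero_of_mem_logSector one_pos hζ)).differentiableAt.differentiableWithinAt
  · intro ζ hζ n
    rcases le_or_gt N n with hn | hn
    · rw [hstab n hn, sub_self, norm_zero]
      exact mul_nonneg (mul_pos (by positivity) (hw n)).le (by positivity)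
    · have hx : ‖ζ⁻¹‖ ≤ 1 := by simpa using norm_inv_le_of_mem_logSector one_pos hζ
      have e : partialSum P N ζ⁻¹ - partialSum P n ζ⁻¹ = ∑ k ∈ Finset.Ico n N,
          ((PowerSeries.coeff k P : ℝ) : ℂ) * ζ⁻¹ ^ k := by
        rw [Finset.sum_Ico_eq_sub _ hn.le]
        rfl
      rw [e]
      have h1 : ‖∑ k ∈ Finset.Ico n N, ((PowerSeries.coeff k P : ℝ) : ℂ) * ζ⁻¹ ^ k‖ ≤
          (∑ k ∈ Finset.range N, |PowerSeries.coeff k P|) * ‖ζ⁻¹‖ ^ n := by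
        refine (norm_sum_le _ _).trans ?_
        rw [Finset.sum_mul]
        refine (Finset.sum_le_sum fun k hk => ?_).trans (Finset.sum_le_sum_of_subset_of_nonneg
          (f := fun k => |PowerSeries.coeff k P| * ‖ζ⁻¹‖ ^ n)
          (fun k hk => Finset.mem_range.2 (Finset.mem_Ico.1 hk).2)
          fun k _ _ => by positivity)
        rw [norm_mul, norm_pow, Complex.norm_real, Real.norm_eq_abs]
        exact mul_le_mul_of_nonneg_left (pow_le_pow_of_le_one (norm_nonneg _) hx
          (Finset.mem_Ico.1 hk).1) (abs_nonneg _)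
      refine h1.trans (mul_le_mul_of_nonneg_right ?_ (by positivity))
      rw [← div_le_iff₀ (hw n)]
      have := Finset.single_le_sum (fun n _ => hS0 n) (Finset.mem_range.2 hn)
      rw [← hS] at this
      linarith

lemma LogSummable.exists_common (hθ : 0 < θ) (hP : LogSummable d θ P) (hQ : LogSummable d θ Q) :
    ∃ m > Real.pi / θ, ∃ G H : ℂ → ℂ, ∀ θ' ∈ Set.Ioo 0 θ, ∃ M > 0, ∃ K L,
      LogGevreyOn m G P K (logSector d θ' M) ∧ LogGevreyOn m H Q L (logSector d θ' M) := by
  obtain ⟨m, hm, G, hG⟩ := hP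
  obtain ⟨m', hm', H, hH⟩ := hQ
  have hpos : 0 < min m m' := (by positivity : 0 < Real.pi / θ).trans (lt_min hm hm')
  refine ⟨min m m', lt_min hm hm', G, H, fun θ' hθ' => ?_⟩
  obtain ⟨M, hM, K, hK⟩ := hG θ' hθ'
  obtain ⟨M', hM', L, hL⟩ := hH θ' hθ'
  exact ⟨max M M', lt_max_of_lt_left hM, K, L,
    hK.mono (logSector_mono le_rfl (le_max_left _ _)) hpos (min_le_left _ _),
    hL.mono (logSector_mono le_rfl (le_max_right _ _)) hpos (min_le_right _ _)⟩

lemma LogSummable.add (hθ : 0 < θ) (hP : LogSummable d θ P) (hQ : LogSummable d θ Q) :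
    LogSummable d θ (P + Q) := by
  obtain ⟨m, hm, G, H, h⟩ := hP.exists_common hθ hQ
  refine ⟨m, hm, G + H, fun θ' hθ' => ?_⟩
  obtain ⟨M, hM, K, L, hK, hL⟩ := h θ' hθ'
  exact ⟨M, hM, K + L, hK.add hL⟩

lemma LogSummable.mul (hθ : 0 < θ) (hP : LogSummable d θ P) (hQ : LogSummable d θ Q) :
    LogSummable d θ (P * Q) := by
  obtain ⟨m, hm, G, H, h⟩ := hP.exists_common hθ hQ
  obtain ⟨m', hm', hmm⟩ := exists_between hm
  have hpos : 0 < m' := (by positivity : 0 < Real.pi / θ).trans hm'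
  obtain ⟨C, hC, hCw⟩ := exists_mul_gevreyWeight_le hpos hmm
  refine ⟨m', hm', G * H, fun θ' hθ' => ?_⟩
  obtain ⟨M, hM, K, L, hK, hL⟩ := h θ' hθ'
  exact ⟨M, hM, K * L * C, hK.mul (hpos.trans hmm) hL hθ'.1 hM hC hCw⟩

lemma LogSummable.div_X (hθ : 0 < θ) (hP : LogSummable d θ (PowerSeries.X * P)) :
    LogSummable d θ P := by
  obtain ⟨m, hm, G, h⟩ := hP
  obtain ⟨m', hm', hmm⟩ := exists_between hm
  have hpos : 0 < m' := (by positivity : 0 < Real.pi / θ).trans hm'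
  obtain ⟨C, hC, hCw⟩ := exists_gevreyWeight_succ_le hpos hmm
  refine ⟨m', hm', fun ζ => ζ * G ζ, fun θ' hθ' => ?_⟩
  obtain ⟨M, hM, K, hK⟩ := h θ' hθ'
  exact ⟨M, hM, K * C, hK.div_X hM hC hCw⟩

lemma LogSummable.div_X_pow (hθ : 0 < θ) {n : ℕ} (hP : LogSummable d θ (PowerSeries.X ^ n * P)) :
    LogSummable d θ P := by
  induction n with
  | zero => simpa using hP
  | succ n ih =>
    rw [pow_succ', mul_assoc] at hP
    exact ih (hP.div_X hθ)

lemma LogSummable.ellDeriv (hθ : 0 < θ) (hP : LogSummable d θ P) :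
    LogSummable d θ (ellDeriv P) := by
  obtain ⟨m, hm, G, h⟩ := hP
  obtain ⟨m', hm', hmm⟩ := exists_between hm
  have hpos : 0 < m' := (by positivity : 0 < Real.pi / θ).trans hm'
  refine ⟨m', hm', fun ζ => -deriv G ζ, fun θ' hθ' => ?_⟩
  obtain ⟨θ'', h1, h2⟩ := exists_between hθ'.2
  obtain ⟨M, hM, K, hK⟩ := h θ'' ⟨hθ'.1.trans h1, h2⟩
  exact hK.neg_deriv hpos hmm hθ'.1 h1 hM

lemma coeff_inv_recursion (hP : PowerSeries.constantCoeff P ≠ 0) {n : ℕ} (hn : 1 ≤ n) :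
    |PowerSeries.coeff n P⁻¹| ≤ |PowerSeries.constantCoeff P|⁻¹ * ∑ k ∈ Finset.range n,
      |PowerSeries.coeff (k + 1) P| * |PowerSeries.coeff (n - (k + 1)) P⁻¹| := by
  have h := congrArg (PowerSeries.coeff n) (PowerSeries.mul_inv_cancel P hP)
  rw [PowerSeries.coeff_mul, Finset.Nat.sum_antidiagonal_eq_sum_range_succ
    (f := fun i j => PowerSeries.coeff i P * PowerSeries.coeff j P⁻¹), Finset.sum_range_succ',
    PowerSeries.coeff_one, if_neg (by omega), add_comm, add_eq_zero_iff_eq_neg, Nat.sub_zero,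
    PowerSeries.coeff_zero_eq_constantCoeff_apply] at h
  rw [← div_eq_inv_mul, le_div_iff₀ (abs_pos.2 hP), mul_comm, ← abs_mul, h, abs_neg]
  refine (Finset.abs_sum_le_sum_abs _ _).trans_eq (Finset.sum_congr rfl fun k _ => abs_mul _ _)

/-- Two losses of order: from `m` to `m₁` for the coefficients of the inverse series, from `m₁` to
`m₂` for the inverse germ. -/
lemma LogSummable.inv (hθ : 0 < θ) (hP : LogSummable d θ P)
    (h0 : PowerSeries.constantCoeff P ≠ 0) : LogSummable d θ P⁻¹ := by
  obtain ⟨m, hm, G, h⟩ := hP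
  obtain ⟨m₁, hm₁, hmm₁⟩ := exists_between hm
  obtain ⟨m₂, hm₂, hmm₂⟩ := exists_between hm₁
  have hpos₂ : 0 < m₂ := (by positivity : 0 < Real.pi / θ).trans hm₂
  have hpos₁ := hpos₂.trans hmm₂
  obtain ⟨C, hC, hCw⟩ := exists_mul_gevreyWeight_le hpos₂ hmm₂
  -- The coefficients do not depend on the subsector, so one subsector, of opening `θ / 2`, is
  -- enough to bound them.
  obtain ⟨A, hA, hAb⟩ : ∃ A > 0, ∀ n, |PowerSeries.coeff n P⁻¹| ≤ A * gevreyWeight m₁ n := by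
    obtain ⟨M, hM, K, hK⟩ := h (θ / 2) ⟨by positivity, by linarith⟩
    exact exists_inverse_coeff_le hpos₁ hmm₁ hK.pos.le
      (inv_nonneg.2 (abs_nonneg (PowerSeries.constantCoeff P)))
      (hK.coeff_le (by positivity) hM) (fun n hn => coeff_inv_recursion h0 hn)
  refine ⟨m₂, hm₂, G⁻¹, fun θ' hθ' => ?_⟩
  obtain ⟨M, hM, K, hK⟩ := h θ' hθ'
  have hKpos := hK.pos
  have hapos := abs_pos.2 h0
  set a := |PowerSeries.constantCoeff P|
  have hw := gevreyWeight_pos (hpos₁.trans hmm₁) 1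
  -- The radius is shrunk until the first remainder is at most `a / 2`, so that `‖G‖ ≥ a / 2`.
  set M' := max M (2 * K * gevreyWeight m 1 / a) with hM'
  have hM'0 : 0 < M' := lt_max_of_lt_left hM
  have hK' := hK.mono (logSector_mono (d := d) (le_refl θ') (le_max_left M
    (2 * K * gevreyWeight m 1 / a))) hpos₁ hmm₁.le
  refine ⟨M', hM'0, _, hK'.inv hpos₁ hpos₂ hA hC (half_pos hapos) h0 hAb ?_ hCw⟩
  intro ζ hζ
  have h1 := hK.bound ζ (logSector_mono le_rfl (le_max_left _ _) hζ) 1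
  have h2 : ‖ζ⁻¹‖ ≤ a / (2 * K * gevreyWeight m 1) := by
    refine (norm_inv_le_of_mem_logSector hM'0 hζ).trans ?_
    rw [← inv_div]
    exact inv_anti₀ (by positivity) (le_max_right _ _)
  have h3 : K * gevreyWeight m 1 * ‖ζ⁻¹‖ ^ 1 ≤ a / 2 := by
    rw [pow_one]
    calc K * gevreyWeight m 1 * ‖ζ⁻¹‖ ≤ K * gevreyWeight m 1 * (a / (2 * K * gevreyWeight m 1)) :=
          mul_le_mul_of_nonneg_left h2 (by positivity)
      _ = a / 2 := by field_simp
  have h4 : partialSum P 1 ζ⁻¹ = ((PowerSeries.constantCoeff P : ℝ) : ℂ) := by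
    simp [partialSum]
  rw [h4] at h1
  have h5 := norm_sub_norm_le ((PowerSeries.constantCoeff P : ℝ) : ℂ) (G ζ)
  rw [norm_sub_rev, Complex.norm_real, Real.norm_eq_abs] at h5
  linarith

end LogSummable

/-! ### Laurent series in `ℓ` as transseries. -/

namespace Transseries

/-- The exponent of `ℓ ^ k`. -/
noncomputable def ellExpoHom : ℕ →+ LogExponent where
  toFun k := expo 0 (Finsupp.single 0 (k : ℤ))
  map_zero' := by
    simp only [Nat.cast_zero, Finsupp.single_zero]
    rfl
  map_add' k l := by
    rw [← expo_add, ← Finsupp.single_add, add_zero, Nat.cast_add]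

lemma ellExp_ell (p : ℤ) (j : ℕ) :
    ellExp (expo 0 (Finsupp.single 0 p)) j = if j = 0 then p else 0 := by
  rw [ellExp_expo, Finsupp.single_apply]
  exact if_congr eq_comm rfl rfl

lemma ellExpoHom_strictMono : StrictMono ellExpoHom := by
  intro k l hkl
  refine Prod.Lex.toLex_lt_toLex.2 (Or.inr ⟨rfl, Finsupp.Lex.lt_iff.2 ⟨0, by simp, ?_⟩⟩)
  change (Finsupp.single 0 (k : ℤ) : ℕ →₀ ℤ) 0 < (Finsupp.single 0 (l : ℤ) : ℕ →₀ ℤ) 0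
  simpa using hkl

/-- A power series in `ℓ`, as a transseries. -/
noncomputable def ofPowerSeries : PowerSeries ℝ →+* Transseries :=
  (HahnSeries.embDomainRingHom ellExpoHom ellExpoHom_strictMono.injective
    fun _ _ => ellExpoHom_strictMono.le_iff_le).comp
    (HahnSeries.toPowerSeries (R := ℝ)).symm.toRingHom

lemma ofPowerSeries_eq (P : PowerSeries ℝ) : ofPowerSeries P =
    HahnSeries.embDomain ⟨⟨ellExpoHom, ellExpoHom_strictMono.injective⟩,
      ellExpoHom_strictMono.le_iff_le⟩ (HahnSeries.toPowerSeries.symm P) := rfl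

lemma coeff_ofPowerSeries (P : PowerSeries ℝ) (k : ℕ) :
    (ofPowerSeries P).coeff (expo 0 (Finsupp.single 0 (k : ℤ))) = PowerSeries.coeff k P := by
  have := HahnSeries.embDomain_coeff (f := ⟨⟨ellExpoHom, ellExpoHom_strictMono.injective⟩,
    ellExpoHom_strictMono.le_iff_le⟩) (x := HahnSeries.toPowerSeries.symm P) (a := k)
  rw [ofPowerSeries_eq]
  refine this.trans ?_
  rw [HahnSeries.coeff_toPowerSeries_symm]

lemma exists_of_coeff_ofPowerSeries_ne_zero {P : PowerSeries ℝ} {g : LogExponent}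
    (h : (ofPowerSeries P).coeff g ≠ 0) : ∃ k : ℕ, g = expo 0 (Finsupp.single 0 (k : ℤ)) := by
  by_contra hg
  push Not at hg
  apply h
  rw [ofPowerSeries_eq]
  refine HahnSeries.embDomain_of_notMem_range ?_
  rintro ⟨k, hk⟩
  exact hg k hk.symm

lemma coeff_ellPow_mul (N : ℤ) (f : Transseries) (g : LogExponent) :
    (ellPow N * f).coeff g = f.coeff (g - expo 0 (Finsupp.single 0 N)) := by
  rw [ellPow, HahnSeries.coeff_single_mul, one_mul]

lemma coeff_ellPow_mul_ofPowerSeries (N : ℤ) (P : PowerSeries ℝ) (k : ℕ) :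
    (ellPow N * ofPowerSeries P).coeff (expo 0 (Finsupp.single 0 (N + k))) =
      PowerSeries.coeff k P := by
  rw [coeff_ellPow_mul, ← coeff_ofPowerSeries]
  congr 1
  rw [Finsupp.single_add, ← zero_add (0 : ℝ), expo_add, zero_add, add_sub_cancel_left]

lemma exists_of_coeff_ellPow_mul_ofPowerSeries_ne_zero {N : ℤ} {P : PowerSeries ℝ}
    {g : LogExponent} (h : (ellPow N * ofPowerSeries P).coeff g ≠ 0) :
    ∃ k : ℕ, g = expo 0 (Finsupp.single 0 (N + k)) := by
  rw [coeff_ellPow_mul] at h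
  obtain ⟨k, hk⟩ := exists_of_coeff_ofPowerSeries_ne_zero h
  refine ⟨k, ?_⟩
  rw [sub_eq_iff_eq_add'] at hk
  rw [hk, ← expo_add, Finsupp.single_add, zero_add]

lemma IsLaurent.depth {f : Transseries} (h : IsLaurent f) : Depth 1 f := fun g hg => (h g hg).2

lemma IsLaurent.zExp_eq {f : Transseries} (h : IsLaurent f) {g : LogExponent}
    (hg : f.coeff g ≠ 0) : zExp g = 0 := (h g hg).1

lemma IsLaurent.exists_eq {f : Transseries} (h : IsLaurent f) {g : LogExponent}
    (hg : f.coeff g ≠ 0) : ∃ p : ℤ, g = expo 0 (Finsupp.single 0 p) := by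
  refine ⟨ellExp g 0, logExponent_ext (h g hg).1 fun j => ?_⟩
  rw [ellExp_ell]
  split_ifs with hj
  · rw [hj]
  · exact (h g hg).2 j (by omega)

lemma isLaurent_ellPow_mul_ofPowerSeries (N : ℤ) (P : PowerSeries ℝ) :
    IsLaurent (ellPow N * ofPowerSeries P) := by
  intro g hg
  obtain ⟨k, rfl⟩ := exists_of_coeff_ellPow_mul_ofPowerSeries_ne_zero hg
  exact ⟨rfl, fun j hj => by rw [ellExp_ell, if_neg (by omega)]⟩

lemma ofPowerSeries_X : ofPowerSeries PowerSeries.X = ellPow 1 := by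
  ext g
  by_cases hg : (ofPowerSeries PowerSeries.X).coeff g = 0
  · rw [hg, ellPow]
    by_cases h : g = expo 0 (Finsupp.single 0 1)
    · have := coeff_ofPowerSeries PowerSeries.X 1
      rw [h, show (1 : ℤ) = ((1 : ℕ) : ℤ) by rfl, this] at hg
      simp at hg
    · rw [HahnSeries.coeff_single_of_ne h]
  · obtain ⟨k, rfl⟩ := exists_of_coeff_ofPowerSeries_ne_zero hg
    rw [coeff_ofPowerSeries, ellPow, PowerSeries.coeff_X]
    split_ifs with hk
    · subst hk
      exact (HahnSeries.coeff_single_same _ _).symm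
    · rw [HahnSeries.coeff_single_of_ne]
      intro h
      have := congrArg (fun g => ellExp g 0) h
      simp only [ellExp_ell, if_true] at this
      omega

lemma ofPowerSeries_X_pow (n : ℕ) : ofPowerSeries (PowerSeries.X ^ n) = ellPow n := by
  rw [map_pow, ofPowerSeries_X]
  induction n with
  | zero => simp
  | succ n ih => rw [pow_succ, ih, ← ellPow_add, Nat.cast_succ]

lemma ofPowerSeries_C (r : ℝ) : ofPowerSeries (PowerSeries.C r) = HahnSeries.C r := by
  ext g
  by_cases hg : (ofPowerSeries (PowerSeries.C r)).coeff g = 0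
  · rw [hg, HahnSeries.C_apply]
    by_cases h : g = 0
    · have := coeff_ofPowerSeries (PowerSeries.C r) 0
      rw [Nat.cast_zero, Finsupp.single_zero] at this
      rw [h] at hg ⊢
      rw [HahnSeries.coeff_single_same]
      simpa using hg.symm.trans this
    · rw [HahnSeries.coeff_single_of_ne h]
  · obtain ⟨k, rfl⟩ := exists_of_coeff_ofPowerSeries_ne_zero hg
    rw [coeff_ofPowerSeries] at hg ⊢
    rw [PowerSeries.coeff_C] at hg ⊢
    split_ifs at hg ⊢ with hk
    · subst hk
      rw [Nat.cast_zero, Finsupp.single_zero]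
      exact (HahnSeries.coeff_single_same (0 : LogExponent) r).symm
    · exact absurd rfl hg

lemma ellProd_zero : ellProd 0 = ellPow 1 := by
  simp [ellProd, ellPow]

lemma IsLaurent.eulerDeriv_eq {f : Transseries} (h : IsLaurent f) :
    eulerDeriv f = ellPow 1 * scale (fun g => (ellExp g 0 : ℝ)) f := by
  rw [h.depth.eulerDeriv_eq, scale_eq_zero fun g hg => h.zExp_eq hg, zero_add,
    Finset.sum_range_one, ellProd_zero]

lemma eulerDeriv_ofPowerSeries (P : PowerSeries ℝ) :
    eulerDeriv (ofPowerSeries P) = ofPowerSeries (ellDeriv P) := by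
  have hL : IsLaurent (ofPowerSeries P) := by
    simpa using isLaurent_ellPow_mul_ofPowerSeries 0 P
  have : ofPowerSeries (ellDeriv P) =
      ellPow 1 * ofPowerSeries (PowerSeries.X * PowerSeries.derivative ℝ P) := by
    rw [ellDeriv, map_mul, ofPowerSeries_X]
  rw [hL.eulerDeriv_eq, this]
  congr 1
  have hc : ∀ k : ℕ, PowerSeries.coeff k (PowerSeries.X * PowerSeries.derivative ℝ P) =
      k * PowerSeries.coeff k P := by
    intro k
    rw [← coeff_succ_ellDeriv, ellDeriv, PowerSeries.coeff_succ_X_mul]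
  ext g
  rw [coeff_scale]
  by_cases hg : ∃ k : ℕ, g = expo 0 (Finsupp.single 0 (k : ℤ))
  · obtain ⟨k, rfl⟩ := hg
    rw [coeff_ofPowerSeries, coeff_ofPowerSeries, hc, ellExp_ell, if_pos rfl, Int.cast_natCast]
  · have h0 : ∀ Q : PowerSeries ℝ, (ofPowerSeries Q).coeff g = 0 := fun Q => by
      by_contra h
      exact hg (exists_of_coeff_ofPowerSeries_ne_zero h)
    rw [h0, h0, mul_zero]

lemma IsLaurent.ellPow_mul {f : Transseries} (h : IsLaurent f) (N : ℤ) :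
    IsLaurent (ellPow N * f) := by
  intro g hg
  rw [HahnSeries.mem_support, coeff_ellPow_mul] at hg
  obtain ⟨p, hp⟩ := h.exists_eq hg
  rw [sub_eq_iff_eq_add', ← expo_add, ← Finsupp.single_add] at hp
  rw [hp]
  exact ⟨by simp, fun j hj => by
    rw [zero_add, ellExp_ell, if_neg (by omega)]⟩

lemma IsLaurent.eulerDeriv_ellPow_mul {f : Transseries} (h : IsLaurent f) (N : ℤ) :
    eulerDeriv (ellPow N * f) =
      ellPow N * (HahnSeries.C (N : ℝ) * (ellPow 1 * f) + eulerDeriv f) := by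
  rw [h.eulerDeriv_eq, (h.ellPow_mul N).eulerDeriv_eq, ellPow.eq_def N, scale_single_mul
    (fun g h => by simp [ellExp_add]), smul_eq_C_mul, ellExp_ell, if_pos rfl]
  ring

lemma eulerDeriv_ellPow_mul_ofPowerSeries (N : ℤ) (P : PowerSeries ℝ) :
    eulerDeriv (ellPow N * ofPowerSeries P) =
      ellPow N * ofPowerSeries (PowerSeries.C (N : ℝ) * (PowerSeries.X * P) + ellDeriv P) := by
  have hL : IsLaurent (ofPowerSeries P) := by
    simpa using isLaurent_ellPow_mul_ofPowerSeries 0 P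
  rw [hL.eulerDeriv_ellPow_mul, eulerDeriv_ofPowerSeries, map_add, map_mul, map_mul,
    ofPowerSeries_X, ofPowerSeries_C]

lemma IsLaurent.eq_ellPow_mul_ofPowerSeries {f : Transseries} (h : IsLaurent f) {N : ℤ}
    (hN : ∀ k < N, ellCoeff f k = 0) :
    f = ellPow N * ofPowerSeries (PowerSeries.mk fun k => ellCoeff f (N + k)) := by
  ext g
  by_cases hg : ∃ p : ℤ, g = expo 0 (Finsupp.single 0 p)
  · obtain ⟨p, rfl⟩ := hg
    rcases lt_or_ge p N with hp | hp
    · rw [show f.coeff _ = 0 from hN p hp]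
      by_contra hne
      obtain ⟨k, hk⟩ := exists_of_coeff_ellPow_mul_ofPowerSeries_ne_zero (Ne.symm hne)
      have := congrArg (fun g => ellExp g 0) hk
      simp only [ellExp_ell, if_true] at this
      omega
    · obtain ⟨k, rfl⟩ := Int.le.dest hp
      rw [coeff_ellPow_mul_ofPowerSeries, PowerSeries.coeff_mk]
      rfl
  · have h1 : f.coeff g = 0 := by
      by_contra hne
      exact hg (h.exists_eq hne)
    have h2 : (ellPow N * ofPowerSeries (PowerSeries.mk fun k => ellCoeff f (N + k))).coeff g
        = 0 := by
      by_contra hne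
      obtain ⟨k, hk⟩ := exists_of_coeff_ellPow_mul_ofPowerSeries_ne_zero hne
      exact hg ⟨_, hk⟩
    rw [h1, h2]

end Transseries

/-! ### Integral summability of length zero: a class closed under field operations and derivation.
-/

section IntegrallySummable

variable {d θ : ℝ} {S S' : Transseries}

lemma gevreyWeight_eq_of_two_le {m : ℝ} {n : ℕ} (hn : 2 ≤ n) :
    (m ^ n)⁻¹ * Real.log n ^ n * Real.exp (-(n / Real.log n)) = gevreyWeight m n := by
  rw [gevreyWeight, gevreyBase, max_eq_left hn, div_pow, mul_pow, ← Real.exp_nat_mul]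
  rw [mul_neg, ← div_eq_mul_inv]
  ring

lemma logSector_subset_logPetal {θ' : ℝ} (r : ℝ → ℝ) (hθ' : θ' ∈ Set.Ioo 0 θ) :
    logSector d θ' (r θ') ⊆ logPetal d θ r :=
  Set.subset_biUnion_of_mem (u := fun θ' => logSector d θ' (r θ')) hθ'

/-- The definition bounds remainders only for `n ≥ 2`. Those for `n = 1` and `n = 0` follow from `n
= 2` by putting back the coefficients `a₁` and `a₀`. -/
lemma HasLogGevreyExpansion.exists_logGevreyOn {m : ℝ} {F : ℂ → ℂ} {Fhat : Transseries}
    (h : HasLogGevreyExpansion m d θ F Fhat) : ∃ (N : ℤ) (P : PowerSeries ℝ),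
      Fhat = ellPow N * ofPowerSeries P ∧ ∀ θ' ∈ Set.Ioo 0 θ, ∃ M > 0, ∃ K,
        LogGevreyOn m (fun ζ => ζ⁻¹ ^ (-N) * F ζ⁻¹) P K (logSector d θ' M) := by
  obtain ⟨r, hr, hF⟩ := h.analytic
  obtain ⟨N, hN, hb⟩ := h.bound
  have hm := h.order_pos
  refine ⟨N, _, h.isLaurent.eq_ellPow_mul_ofPowerSeries hN, fun θ' hθ' => ?_⟩
  obtain ⟨M, hM, K, hK, hbd⟩ := hb θ' hθ'
  set P : PowerSeries ℝ := PowerSeries.mk fun k => ellCoeff Fhat (N + k) with hP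
  set G : ℂ → ℂ := fun ζ => ζ⁻¹ ^ (-N) * F ζ⁻¹
  -- The `1` forces `‖ζ⁻¹‖ ≤ 1`, which is used to compare the powers for `n ≤ 2`.
  set M' := max (max M (r θ')) 1
  have hM' : 0 < M' := lt_max_of_lt_right one_pos
  have hw := gevreyWeight_pos hm
  have hbound2 : ∀ ζ ∈ logSector d θ' M', ∀ n, 2 ≤ n →
      ‖G ζ - partialSum P n ζ⁻¹‖ ≤ K * gevreyWeight m n * ‖ζ⁻¹‖ ^ n := by
    intro ζ hζ n hn
    have := hbd ζ⁻¹ ⟨ζ, logSector_mono le_rfl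
      ((le_max_left _ _).trans (le_max_left _ _)) hζ, rfl⟩ n hn
    rw [← gevreyWeight_eq_of_two_le hn]
    simp only [partialSum, hP, PowerSeries.coeff_mk]
    refine this.trans_eq ?_
    ring
  set a₀ := |PowerSeries.coeff 0 P|
  set a₁ := |PowerSeries.coeff 1 P|
  -- The three summands serve the cases `n ≥ 2`, `n = 1` and `n = 0`.
  set L := K + (K * gevreyWeight m 2 + a₁) / gevreyWeight m 1 + (K * gevreyWeight m 2 + a₀ + a₁)
  have h1 := hw 1
  have h2 := hw 2
  have ha₀ : 0 ≤ a₀ := abs_nonneg _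
  have ha₁ : 0 ≤ a₁ := abs_nonneg _
  have hd1 : 0 ≤ (K * gevreyWeight m 2 + a₁) / gevreyWeight m 1 := by positivity
  have hd2 : 0 ≤ K * gevreyWeight m 2 + a₀ + a₁ := by positivity
  have hL : 0 < L := by positivity
  refine ⟨M', hM', L, hL, ?_, ?_⟩
  · have hsub : logSector d θ' M' ⊆ logPetal d θ r :=
      (logSector_mono le_rfl ((le_max_right _ _).trans (le_max_left _ _))).trans
        (logSector_subset_logPetal r hθ')
    have hinv : DifferentiableOn ℂ (fun ζ : ℂ => ζ⁻¹) (logSector d θ' M') :=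
      differentiableOn_inv.mono fun ζ hζ => ne_zero_of_mem_logSector hM' hζ
    refine DifferentiableOn.mul ?_ (hF.comp hinv fun ζ hζ => ⟨ζ, hsub hζ, rfl⟩)
    exact hinv.zpow (Or.inl fun ζ hζ => inv_ne_zero (ne_zero_of_mem_logSector hM' hζ))
  · intro ζ hζ n
    have hx : ‖ζ⁻¹‖ ≤ 1 := (norm_inv_le_of_mem_logSector hM' hζ).trans
      (inv_le_one_of_one_le₀ (le_max_right _ _))
    have hx0 := norm_nonneg ζ⁻¹
    have hb2 := hbound2 ζ hζ 2 le_rfl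
    have hx2 : ‖ζ⁻¹‖ ^ 2 ≤ ‖ζ⁻¹‖ := by nlinarith
    have hb1 : ‖G ζ - partialSum P 1 ζ⁻¹‖ ≤ (K * gevreyWeight m 2 + a₁) * ‖ζ⁻¹‖ := by
      have e : G ζ - partialSum P 1 ζ⁻¹ = (G ζ - partialSum P 2 ζ⁻¹) +
          ((PowerSeries.coeff 1 P : ℝ) : ℂ) * ζ⁻¹ ^ 1 := by
        rw [partialSum_succ P 1]
        ring
      rw [e]
      refine (norm_add_le _ _).trans ?_
      rw [norm_mul, norm_pow, Complex.norm_real, Real.norm_eq_abs, pow_one, add_mul]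
      refine add_le_add (hb2.trans ?_) le_rfl
      exact mul_le_mul_of_nonneg_left hx2 (by positivity)
    match n with
    | 0 =>
      have e : G ζ - partialSum P 0 ζ⁻¹ = (G ζ - partialSum P 1 ζ⁻¹) +
          ((PowerSeries.coeff 0 P : ℝ) : ℂ) * ζ⁻¹ ^ 0 := by
        rw [partialSum_succ P 0]
        ring
      rw [e, gevreyWeight_zero]
      refine (norm_add_le _ _).trans ?_
      rw [norm_mul, norm_pow, Complex.norm_real, Real.norm_eq_abs, pow_zero, mul_one, mul_one,
        mul_one]
      calc _ ≤ (K * gevreyWeight m 2 + a₁) * 1 + a₀ :=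
            add_le_add (hb1.trans (mul_le_mul_of_nonneg_left hx (by positivity))) le_rfl
        _ ≤ L := by linarith
    | 1 =>
      refine hb1.trans ?_
      rw [pow_one]
      refine mul_le_mul_of_nonneg_right ?_ hx0
      rw [← div_le_iff₀ h1]
      linarith
    | n + 2 =>
      refine (hbound2 ζ hζ (n + 2) (by omega)).trans ?_
      refine mul_le_mul_of_nonneg_right ?_ (by positivity)
      exact mul_le_mul_of_nonneg_right (by linarith) (hw _).le

/-- Factoring out `ℓ ^ N` and passing to the logarithmic chart reduce all closure properties to
`LogSummable` power series. -/
lemma integrallySummableZero_iff (hθ : 0 < θ) : IntegrallySummableZero d θ S ↔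
    ∃ (N : ℤ) (P : PowerSeries ℝ), S = ellPow N * ofPowerSeries P ∧ LogSummable d θ P := by
  constructor
  · rintro ⟨m, hm, F, hF⟩
    obtain ⟨N, P, hS, h⟩ := hF.exists_logGevreyOn
    exact ⟨N, P, hS, m, hm, _, h⟩
  · rintro ⟨N, P, rfl, m, hm, G, hG⟩
    have hmpos : 0 < m := (by positivity : 0 < Real.pi / θ).trans hm
    choose! r hr K hK using hG
    classical
    -- The chosen radii mean something only for openings in `(0, θ)`; elsewhere any positive value
    -- will do.
    set r' : ℝ → ℝ := fun t => if t ∈ Set.Ioo 0 θ then r t else 1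
    have hr' : ∀ t, 0 < r' t := fun t => by
      by_cases ht : t ∈ Set.Ioo 0 θ
      · simpa only [r', if_pos ht] using hr t ht
      · simp only [r', if_neg ht, one_pos]
    have hrr : ∀ t ∈ Set.Ioo 0 θ, r' t = r t := fun t ht => if_pos ht
    have hne : ∀ ζ ∈ logPetal d θ r', ζ ≠ 0 := fun ζ hζ => by
      simp only [logPetal, Set.mem_iUnion] at hζ
      obtain ⟨t, ht, hζ⟩ := hζ
      exact ne_zero_of_mem_logSector (hr' t) hζ
    have hGd : DifferentiableOn ℂ G (logPetal d θ r') := fun ζ hζ => by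
      simp only [logPetal, Set.mem_iUnion] at hζ
      obtain ⟨t, ht, hζ⟩ := hζ
      rw [hrr t ht] at hζ
      exact ((hK t ht).differentiableOn.differentiableAt
        ((isOpen_logSector d t _).mem_nhds hζ)).differentiableWithinAt
    refine ⟨m, hm, fun x => x ^ N * G x⁻¹, isLaurent_ellPow_mul_ofPowerSeries N P, hmpos,
      ⟨r', hr', ?_⟩, N, ?_, ?_⟩
    · have hne' : ∀ x ∈ ellCusp (logPetal d θ r'), x ≠ 0 := by
        rintro _ ⟨ζ, hζ, rfl⟩
        exact inv_ne_zero (hne ζ hζ)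
      refine DifferentiableOn.mul (differentiableOn_id.zpow (Or.inl hne')) ?_
      refine hGd.comp (differentiableOn_inv.mono hne') ?_
      rintro _ ⟨ζ, hζ, rfl⟩
      simpa using hζ
    · intro k hk
      by_contra hne
      obtain ⟨j, hj⟩ := exists_of_coeff_ellPow_mul_ofPowerSeries_ne_zero hne
      have := congrArg (fun g => ellExp g 0) hj
      simp only [ellExp_ell, if_true] at this
      omega
    · intro θ' hθ'
      refine ⟨r θ', hr θ' hθ', K θ', (hK θ' hθ').pos, ?_⟩
      rintro _ ⟨ζ, hζ, rfl⟩ n hn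
      have h0 := ne_zero_of_mem_logSector (hr θ' hθ') hζ
      have := (hK θ' hθ').bound ζ hζ n
      rw [← gevreyWeight_eq_of_two_le hn] at this
      simp only [inv_inv]
      rw [← mul_assoc, ← zpow_add₀ (inv_ne_zero h0), neg_add_cancel, zpow_zero, one_mul]
      have hc : ∀ k : ℕ, ellCoeff (ellPow N * ofPowerSeries P) (N + k) = PowerSeries.coeff k P :=
        fun k => coeff_ellPow_mul_ofPowerSeries N P k
      simp only [hc]
      refine this.trans_eq ?_
      ring

lemma IntegrallySummableZero.isLaurent (h : IntegrallySummableZero d θ S) : IsLaurent S := by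
  obtain ⟨m, -, F, hF⟩ := h
  exact hF.isLaurent

lemma LogSummable.X_pow_mul (hθ : 0 < θ) {P : PowerSeries ℝ} (hP : LogSummable d θ P) (n : ℕ) :
    LogSummable d θ (PowerSeries.X ^ n * P) :=
  LogSummable.mul hθ (logSummable_of_polynomial (N := n + 1) hθ fun k hk => by
    rw [PowerSeries.coeff_X_pow, if_neg (by omega)]) hP

lemma logSummable_C (hθ : 0 < θ) (r : ℝ) : LogSummable d θ (PowerSeries.C r) :=
  logSummable_of_polynomial (N := 1) hθ fun k hk => by
    rw [PowerSeries.coeff_C, if_neg (by omega)]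

lemma IntegrallySummableZero.add (hθ : 0 < θ) (h : IntegrallySummableZero d θ S)
    (h' : IntegrallySummableZero d θ S') : IntegrallySummableZero d θ (S + S') := by
  rw [integrallySummableZero_iff hθ] at *
  obtain ⟨N, P, rfl, hP⟩ := h
  obtain ⟨N', Q, rfl, hQ⟩ := h'
  obtain ⟨L, a, b, rfl, rfl⟩ : ∃ (L : ℤ) (a b : ℕ), N = L + a ∧ N' = L + b :=
    ⟨min N N', (N - min N N').toNat, (N' - min N N').toNat, by omega, by omega⟩
  refine ⟨L, PowerSeries.X ^ a * P + PowerSeries.X ^ b * Q, ?_,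
    (hP.X_pow_mul hθ a).add hθ (hQ.X_pow_mul hθ b)⟩
  rw [map_add, map_mul, map_mul, ofPowerSeries_X_pow, ofPowerSeries_X_pow, ellPow_add, ellPow_add]
  ring

lemma IntegrallySummableZero.mul (hθ : 0 < θ) (h : IntegrallySummableZero d θ S)
    (h' : IntegrallySummableZero d θ S') : IntegrallySummableZero d θ (S * S') := by
  rw [integrallySummableZero_iff hθ] at *
  obtain ⟨N, P, rfl, hP⟩ := h
  obtain ⟨N', Q, rfl, hQ⟩ := h'
  refine ⟨N + N', P * Q, ?_, hP.mul hθ hQ⟩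
  rw [map_mul, ellPow_add]
  ring

lemma integrallySummableZero_C (hθ : 0 < θ) (r : ℝ) :
    IntegrallySummableZero d θ (HahnSeries.C r) := by
  rw [integrallySummableZero_iff hθ]
  exact ⟨0, PowerSeries.C r, by rw [ellPow_zero, one_mul, ofPowerSeries_C], logSummable_C hθ r⟩

lemma IntegrallySummableZero.eulerDeriv (hθ : 0 < θ) (h : IntegrallySummableZero d θ S) :
    IntegrallySummableZero d θ (eulerDeriv S) := by
  rw [integrallySummableZero_iff hθ] at *
  obtain ⟨N, P, rfl, hP⟩ := h
  refine ⟨N, _, eulerDeriv_ellPow_mul_ofPowerSeries N P, ?_⟩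
  refine LogSummable.add hθ ((logSummable_C hθ _).mul hθ ?_) (hP.ellDeriv hθ)
  simpa using hP.X_pow_mul hθ 1

/-- Write `P = X ^ n Q` with `Q(0) ≠ 0`. Dividing by `X ^ n` preserves summability with a smaller
admissible order, and `Q` is then invertible as a power series. For `S = 0` the convention `0⁻¹ = 0`
applies. -/
lemma IntegrallySummableZero.inv (hθ : 0 < θ) (h : IntegrallySummableZero d θ S) :
    IntegrallySummableZero d θ S⁻¹ := by
  rcases eq_or_ne S 0 with rfl | hS
  · simpa using integrallySummableZero_C (d := d) hθ 0
  rw [integrallySummableZero_iff hθ] at *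
  obtain ⟨N, P, rfl, hP⟩ := h
  have hP0 : P ≠ 0 := by
    rintro rfl
    simp at hS
  obtain ⟨n, Q, hPQ, hQ⟩ : ∃ (n : ℕ) (Q : PowerSeries ℝ), P = PowerSeries.X ^ n * Q ∧
      PowerSeries.constantCoeff Q ≠ 0 := by
    refine ⟨P.order.toNat, PowerSeries.divXPowOrder P,
      (PowerSeries.X_pow_order_mul_divXPowOrder).symm, ?_⟩
    rw [PowerSeries.constantCoeff_divXPowOrder]
    exact PowerSeries.coeff_order hP0
  subst hPQ
  refine ⟨-(N + n), Q⁻¹, ?_, (hP.div_X_pow hθ).inv hθ hQ⟩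
  refine inv_eq_of_mul_eq_one_right ?_
  have h1 : ofPowerSeries Q * ofPowerSeries Q⁻¹ = 1 := by
    rw [← map_mul, PowerSeries.mul_inv_cancel Q hQ, map_one]
  have h2 : ellPow N * ellPow n * ellPow (-(N + n)) = 1 := by
    rw [← ellPow_add, ← ellPow_add, add_neg_cancel, ellPow_zero]
  rw [map_mul, ofPowerSeries_X_pow]
  calc _ = (ellPow N * ellPow n * ellPow (-(N + n))) * (ofPowerSeries Q * ofPowerSeries Q⁻¹) := by
        ring
    _ = 1 := by rw [h1, h2, one_mul]

end IntegrallySummable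

lemma Transseries.neg_mul_eq (a b : Transseries) : -a * b = -(a * b) := by
  refine eq_neg_of_add_eq_zero_left ?_
  rw [← add_mul, neg_add_cancel, zero_mul]

lemma Transseries.mul_neg_eq (a b : Transseries) : a * -b = -(a * b) := by
  refine eq_neg_of_add_eq_zero_left ?_
  rw [← mul_add, neg_add_cancel, mul_zero]

/-! ### Summability on all petals simultaneously. -/

lemma petalOpening_pos {α : ℝ} (hα : 1 < α) : 0 < petalOpening α :=
  div_pos (by positivity) (sub_pos.2 hα)

/-- Integral summability of length `0` on the `ℓ`-cusps of all petals. -/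
def PetalSummable (α : ℝ) (S : Transseries) : Prop :=
  ∀ k : ℤ, IntegrallySummableZero (petalDirection α k) (petalOpening α) S

section PetalSummable

variable {α : ℝ} {S S' : Transseries}

lemma PetalSummable.isLaurent (h : PetalSummable α S) : IsLaurent S := (h 0).isLaurent

lemma PetalSummable.add (hα : 1 < α) (h : PetalSummable α S) (h' : PetalSummable α S') :
    PetalSummable α (S + S') := fun k => (h k).add (petalOpening_pos hα) (h' k)

lemma PetalSummable.mul (hα : 1 < α) (h : PetalSummable α S) (h' : PetalSummable α S') :
    PetalSummable α (S * S') := fun k => (h k).mul (petalOpening_pos hα) (h' k)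

lemma petalSummable_C (hα : 1 < α) (r : ℝ) : PetalSummable α (HahnSeries.C r) := fun _ =>
  integrallySummableZero_C (petalOpening_pos hα) r

lemma petalSummable_zero (hα : 1 < α) : PetalSummable α 0 := by
  simpa using petalSummable_C hα 0

lemma PetalSummable.neg (hα : 1 < α) (h : PetalSummable α S) : PetalSummable α (-S) := by
  have e : HahnSeries.C (-1) * S = -S := by
    rw [map_neg, map_one]
    rw [neg_mul_eq, one_mul]
  rw [← e]
  exact (petalSummable_C hα (-1)).mul hα h

lemma PetalSummable.eulerDeriv (hα : 1 < α) (h : PetalSummable α S) :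
    PetalSummable α (eulerDeriv S) := fun k => (h k).eulerDeriv (petalOpening_pos hα)

lemma PetalSummable.inv (hα : 1 < α) (h : PetalSummable α S) : PetalSummable α S⁻¹ := fun k =>
  (h k).inv (petalOpening_pos hα)

end PetalSummable

/-! ### The algebra of transseries with summable blocks. -/

namespace Transseries

lemma coeff_zPow_mul (b : ℝ) (f : Transseries) (g : LogExponent) :
    (zPow b * f).coeff g = f.coeff (g - expo b 0) := by
  rw [zPow, HahnSeries.coeff_single_mul, one_mul]

lemma zExp_eq_of_coeff_zPow_mul {b : ℝ} {f : Transseries}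
    (hf : ∀ g, f.coeff g ≠ 0 → zExp g = 0) {g : LogExponent} (h : (zPow b * f).coeff g ≠ 0) :
    zExp g = b := by
  rw [coeff_zPow_mul] at h
  have := hf _ h
  rwa [zExp_sub, zExp_expo, sub_eq_zero] at this

lemma zGe_zPow_mul {b : ℝ} {f : Transseries} (hf : ∀ g, f.coeff g ≠ 0 → zExp g = 0) :
    ZGe b (zPow b * f) := fun _ hg => (zExp_eq_of_coeff_zPow_mul hf hg).ge

/-- Finite sums of blocks `z ^ b S` with `b ∈ c + Γ` and `S` integrally summable of length `0` on
all petals. -/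
noncomputable def blockSpan (α : ℝ) (Γ : AddSubmonoid ℝ) (c : ℝ) : AddSubgroup Transseries :=
  AddSubgroup.closure {f | ∃ b S, b - c ∈ Γ ∧ PetalSummable α S ∧ f = zPow b * S}

/-- The `z`-adic closure of `blockSpan`. -/
def InBlocks (α : ℝ) (Γ : AddSubmonoid ℝ) (c : ℝ) (f : Transseries) : Prop :=
  ∀ B, ∃ p ∈ blockSpan α Γ c, ZGe B (f - p)

variable {α c c' : ℝ} {Γ : AddSubmonoid ℝ} {f h : Transseries}

lemma zPow_mul_mem_blockSpan {b : ℝ} {S : Transseries} (hb : b - c ∈ Γ)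
    (hS : PetalSummable α S) : zPow b * S ∈ blockSpan α Γ c :=
  AddSubgroup.subset_closure ⟨b, S, hb, hS, rfl⟩

lemma zGe_of_mem_blockSpan (hΓ : ∀ s ∈ Γ, 0 ≤ s) (hf : f ∈ blockSpan α Γ c) : ZGe c f := by
  induction hf using AddSubgroup.closure_induction with
  | mem x hx =>
    obtain ⟨b, S, hb, hS, rfl⟩ := hx
    exact (zGe_zPow_mul fun g hg => hS.isLaurent.zExp_eq hg).mono (sub_nonneg.1 (hΓ _ hb))
  | zero => exact zGe_zero c
  | add x y _ _ hx hy => exact hx.add hy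
  | neg x _ hx => exact hx.neg

lemma depth_of_mem_blockSpan (hf : f ∈ blockSpan α Γ c) : Depth 1 f := by
  induction hf using AddSubgroup.closure_induction with
  | mem x hx =>
    obtain ⟨b, S, hb, hS, rfl⟩ := hx
    exact (depth_zPow 1 b).mul hS.isLaurent.depth
  | zero => exact depth_zero 1
  | add x y _ _ hx hy => exact hx.add hy
  | neg x _ hx => exact hx.neg

lemma mul_mem_blockSpan (hα : 1 < α) (hf : f ∈ blockSpan α Γ c) (hh : h ∈ blockSpan α Γ c') :
    f * h ∈ blockSpan α Γ (c + c') := by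
  induction hf using AddSubgroup.closure_induction with
  | mem x hx =>
    obtain ⟨b, S, hb, hS, rfl⟩ := hx
    induction hh using AddSubgroup.closure_induction with
    | mem y hy =>
      obtain ⟨b', S', hb', hS', rfl⟩ := hy
      have := zPow_mul_mem_blockSpan (α := α) (c := c + c') (b := b + b')
        (by rw [add_sub_add_comm]; exact add_mem hb hb') (hS.mul hα hS')
      rw [zPow_add] at this
      convert this using 1
      ring
    | zero => rw [mul_zero]; exact zero_mem _
    | add y z _ _ hy hz => rw [mul_add]; exact add_mem hy hz
    | neg y _ hy =>
      convert neg_mem hy using 1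
      exact mul_neg_eq _ _
  | zero => rw [zero_mul]; exact zero_mem _
  | add x y _ _ hx hy => rw [add_mul]; exact add_mem hx hy
  | neg x _ hx =>
    convert neg_mem hx using 1
    exact neg_mul_eq _ _

lemma derivZ_mem_blockSpan (hα : 1 < α) (hf : f ∈ blockSpan α Γ c) :
    derivZ f ∈ blockSpan α Γ (c - 1) := by
  induction hf using AddSubgroup.closure_induction with
  | mem x hx =>
    obtain ⟨b, S, hb, hS, rfl⟩ := hx
    rw [derivZ_zPow_mul hS.isLaurent.depth, smul_eq_C_mul]
    exact zPow_mul_mem_blockSpan (by rwa [sub_sub_sub_cancel_right])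
      (((petalSummable_C hα b).mul hα hS).add hα (hS.eulerDeriv hα))
  | zero =>
    rw [derivZ, eulerDeriv_zero, mul_zero]
    exact zero_mem _
  | add x y hx' hy' hx hy =>
    rw [derivZ_add (depth_of_mem_blockSpan hx') (depth_of_mem_blockSpan hy')]
    exact add_mem hx hy
  | neg x hx' hx =>
    rw [← zero_sub, derivZ_sub (depth_zero 1) (depth_of_mem_blockSpan hx'), derivZ.eq_def 0,
      eulerDeriv_zero, mul_zero, zero_sub]
    exact neg_mem hx

/-- The block of exponent `b` of a finite sum of blocks. -/
lemma exists_slice_of_mem_blockSpan (hα : 1 < α) (hf : f ∈ blockSpan α Γ c) (b : ℝ) :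
    ∃ S, PetalSummable α S ∧ ∀ g, zExp g = b → f.coeff g = (zPow b * S).coeff g := by
  induction hf using AddSubgroup.closure_induction with
  | mem x hx =>
    obtain ⟨b', S, hb, hS, rfl⟩ := hx
    by_cases h : b' = b
    · exact ⟨S, hS, fun g _ => by rw [h]⟩
    · refine ⟨0, petalSummable_zero hα, fun g hg => ?_⟩
      rw [mul_zero]
      by_contra hne
      exact h ((zExp_eq_of_coeff_zPow_mul (fun g hg => hS.isLaurent.zExp_eq hg) hne).symm.trans hg)
  | zero => exact ⟨0, petalSummable_zero hα, fun g _ => by rw [mul_zero]⟩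
  | add x y _ _ hx hy =>
    obtain ⟨S, hS, h1⟩ := hx
    obtain ⟨S', hS', h2⟩ := hy
    exact ⟨S + S', hS.add hα hS', fun g hg => by
      rw [mul_add, HahnSeries.coeff_add, HahnSeries.coeff_add, h1 g hg, h2 g hg]⟩
  | neg x _ hx =>
    obtain ⟨S, hS, h1⟩ := hx
    have e : zPow b * -S = -(zPow b * S) := mul_neg_eq _ _
    exact ⟨-S, hS.neg hα, fun g hg => by
      rw [e, HahnSeries.coeff_neg, HahnSeries.coeff_neg, h1 g hg]⟩

lemma zExp_sub_mem_of_mem_blockSpan (hf : f ∈ blockSpan α Γ c) {g : LogExponent}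
    (hg : f.coeff g ≠ 0) : zExp g - c ∈ Γ := by
  induction hf using AddSubgroup.closure_induction with
  | mem x hx =>
    obtain ⟨b', S, hb, hS, rfl⟩ := hx
    rwa [zExp_eq_of_coeff_zPow_mul (fun g hg => hS.isLaurent.zExp_eq hg) hg]
  | zero => exact absurd rfl hg
  | add x y _ _ hx hy =>
    by_cases h : x.coeff g = 0
    · exact hy (by simpa [h] using hg)
    · exact hx h
  | neg x _ hx => exact hx (by simpa using hg)

lemma inBlocks_of_mem (hf : f ∈ blockSpan α Γ c) : InBlocks α Γ c f := fun B =>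
  ⟨f, hf, by rw [sub_self]; exact zGe_zero B⟩

lemma InBlocks.exists_coeff_eq (hf : InBlocks α Γ c f) (B : ℝ) :
    ∃ p ∈ blockSpan α Γ c, ∀ g, zExp g ≤ B → f.coeff g = p.coeff g := by
  obtain ⟨p, hp, h⟩ := hf (B + 1)
  refine ⟨p, hp, fun g hg => ?_⟩
  have := h.coeff_eq_zero (g := g) (by linarith)
  rwa [HahnSeries.coeff_sub, sub_eq_zero] at this

/-- A block of fixed exponent is already visible in a finite truncation, so the `z`-adic closure
creates no new blocks. -/
lemma InBlocks.exists_slice (hα : 1 < α) (hf : InBlocks α Γ c f) (b : ℝ) :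
    ∃ S, PetalSummable α S ∧ ∀ g, zExp g = b → f.coeff g = (zPow b * S).coeff g := by
  obtain ⟨p, hp, h⟩ := hf.exists_coeff_eq b
  obtain ⟨S, hS, h'⟩ := exists_slice_of_mem_blockSpan hα hp b
  exact ⟨S, hS, fun g hg => (h g hg.le).trans (h' g hg)⟩

lemma InBlocks.zExp_sub_mem (hf : InBlocks α Γ c f) {g : LogExponent} (hg : f.coeff g ≠ 0) :
    zExp g - c ∈ Γ := by
  obtain ⟨p, hp, h⟩ := hf.exists_coeff_eq (zExp g)
  exact zExp_sub_mem_of_mem_blockSpan hp (by rwa [← h g le_rfl])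

lemma InBlocks.zGe (hΓ : ∀ s ∈ Γ, 0 ≤ s) (hf : InBlocks α Γ c f) : ZGe c f := fun _ hg =>
  sub_nonneg.1 (hΓ _ (hf.zExp_sub_mem hg))

lemma InBlocks.depth (hf : InBlocks α Γ c f) : Depth 1 f := fun g hg => by
  obtain ⟨p, hp, h⟩ := hf.exists_coeff_eq (zExp g)
  exact depth_of_mem_blockSpan hp g (by rwa [← h g le_rfl])

/-- The closure is closed. Iterative constructions stay in the class by this. -/
lemma inBlocks_of_forall (h : ∀ B, ∃ p, InBlocks α Γ c p ∧ ZGe B (f - p)) :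
    InBlocks α Γ c f := by
  intro B
  obtain ⟨p, hp, h1⟩ := h B
  obtain ⟨q, hq, h2⟩ := hp B
  exact ⟨q, hq, by simpa using h1.add h2⟩

lemma inBlocks_zero : InBlocks α Γ c 0 := inBlocks_of_mem (zero_mem _)

lemma inBlocks_C (hα : 1 < α) (r : ℝ) : InBlocks α Γ 0 (HahnSeries.C r) := by
  have := zPow_mul_mem_blockSpan (α := α) (Γ := Γ) (c := 0) (b := 0) (by simp)
    (petalSummable_C hα r)
  rw [zPow_zero, one_mul] at this
  exact inBlocks_of_mem this

lemma inBlocks_one (hα : 1 < α) : InBlocks α Γ 0 1 := by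
  simpa using inBlocks_C (Γ := Γ) hα 1

lemma InBlocks.add (hf : InBlocks α Γ c f) (hh : InBlocks α Γ c h) : InBlocks α Γ c (f + h) := by
  intro B
  obtain ⟨p, hp, h1⟩ := hf B
  obtain ⟨q, hq, h2⟩ := hh B
  exact ⟨p + q, add_mem hp hq, by rw [add_sub_add_comm]; exact h1.add h2⟩

lemma InBlocks.sub (hf : InBlocks α Γ c f) (hh : InBlocks α Γ c h) : InBlocks α Γ c (f - h) := by
  intro B
  obtain ⟨p, hp, h1⟩ := hf B
  obtain ⟨q, hq, h2⟩ := hh B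
  exact ⟨p - q, sub_mem hp hq, by rw [sub_sub_sub_comm]; exact h1.sub h2⟩

lemma InBlocks.sum {ι : Type*} {s : Finset ι} {t : ι → Transseries}
    (ht : ∀ i ∈ s, InBlocks α Γ c (t i)) : InBlocks α Γ c (∑ i ∈ s, t i) := by
  classical
  induction s using Finset.induction_on with
  | empty => simpa using inBlocks_zero
  | insert a s ha ih =>
    rw [Finset.sum_insert ha]
    exact (ht a (by simp)).add (ih fun i hi => ht i (by simp [hi]))

lemma InBlocks.mul (hα : 1 < α) (hΓ : ∀ s ∈ Γ, 0 ≤ s) (hf : InBlocks α Γ c f)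
    (hh : InBlocks α Γ c' h) : InBlocks α Γ (c + c') (f * h) := by
  intro B
  obtain ⟨p, hp, h1⟩ := hf (B - c')
  obtain ⟨q, hq, h2⟩ := hh (B - c)
  refine ⟨p * q, mul_mem_blockSpan hα hp hq, ?_⟩
  -- The cuts at `B - c'` and `B - c` compensate the least exponents of the other factors.
  have e : f * h - p * q = (f - p) * h + p * (h - q) := by ring
  rw [e]
  have h3 := h1.mul (hh.zGe hΓ)
  have h4 := (zGe_of_mem_blockSpan hΓ hp).mul h2
  rw [sub_add_cancel] at h3
  rw [add_sub_cancel] at h4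
  exact h3.add h4

lemma InBlocks.shift (hf : InBlocks α Γ c f) (hc : c - c' ∈ Γ) : InBlocks α Γ c' f := by
  intro B
  obtain ⟨p, hp, h1⟩ := hf B
  refine ⟨p, (AddSubgroup.closure_mono ?_) hp, h1⟩
  rintro x ⟨b, S, hb, hS, rfl⟩
  exact ⟨b, S, by simpa using add_mem hb hc, hS, rfl⟩

lemma InBlocks.pow (hα : 1 < α) (hΓ : ∀ s ∈ Γ, 0 ≤ s) (hf : InBlocks α Γ c f) (n : ℕ) :
    InBlocks α Γ (n * c) (f ^ n) := by
  induction n with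
  | zero => simpa using inBlocks_one hα
  | succ n ih =>
    have := ih.mul hα hΓ hf
    rw [← add_one_mul] at this
    rw [pow_succ, Nat.cast_succ]
    exact this

lemma InBlocks.derivZ (hα : 1 < α) (hf : InBlocks α Γ c f) :
    InBlocks α Γ (c - 1) (derivZ f) := by
  intro B
  obtain ⟨p, hp, h1⟩ := hf (B + 1)
  refine ⟨Transseries.derivZ p, derivZ_mem_blockSpan hα hp, ?_⟩
  rw [← derivZ_sub hf.depth (depth_of_mem_blockSpan hp)]
  simpa using h1.derivZ

lemma InBlocks.derivZ_iterate (hα : 1 < α) (hf : InBlocks α Γ c f) (n : ℕ) :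
    InBlocks α Γ (c - n) (Transseries.derivZ^[n] f) := by
  induction n with
  | zero => simpa using hf
  | succ n ih =>
    rw [Function.iterate_succ_apply', Nat.cast_succ, ← sub_sub]
    exact ih.derivZ hα

/-- A transseries is the sum of its blocks. -/
lemma InBlocks.zGe_sub_sum (hf : InBlocks α Γ c f) {β : ℕ → ℝ} (hβ : Function.Injective β)
    (hΓβ : ∀ b, b - c ∈ Γ → b ∈ Set.range β) {S : ℕ → Transseries}
    (hS : ∀ i, PetalSummable α (S i))
    (hfS : ∀ i g, zExp g = β i → f.coeff g = (zPow (β i) * S i).coeff g)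
    {B : ℝ} {N : ℕ} (hN : ∀ n, N ≤ n → B ≤ β n) :
    ZGe B (f - ∑ i ∈ Finset.range N, zPow (β i) * S i) := by
  intro g hg
  by_contra hlt
  push Not at hlt
  apply hg
  have hz : ∀ i, (zPow (β i) * S i).coeff g ≠ 0 → zExp g = β i := fun i hi =>
    zExp_eq_of_coeff_zPow_mul (fun g hg => (hS i).isLaurent.zExp_eq hg) hi
  rw [HahnSeries.coeff_sub, HahnSeries.coeff_sum, sub_eq_zero]
  by_cases h : zExp g - c ∈ Γ
  · obtain ⟨i, hi⟩ := hΓβ _ h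
    have hiN : i < N := by
      by_contra hiN
      have := hN i (not_lt.1 hiN)
      linarith
    rw [Finset.sum_eq_single i, hfS i g hi.symm]
    · intro j _ hj
      by_contra hne
      exact hj (hβ ((hz j hne).symm.trans hi.symm))
    · intro hi
      exact absurd (Finset.mem_range.2 hiN) hi
  · have h0 : f.coeff g = 0 := by
      by_contra hne
      exact h (hf.zExp_sub_mem hne)
    rw [h0, eq_comm]
    refine Finset.sum_eq_zero fun i _ => ?_
    by_contra hne
    have := hfS i g (hz i hne)
    rw [h0] at this
    exact hne this.symm

lemma zExp_order_inv (hf : f ≠ 0) : zExp f⁻¹.order = -zExp f.order := by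
  have h1 := HahnSeries.order_mul hf (inv_ne_zero hf)
  rw [mul_inv_cancel₀ hf, HahnSeries.order_one] at h1
  have h2 := congrArg zExp h1
  rw [zExp_add, zExp_zero] at h2
  linarith

/-- The inverse of a transseries with a leading block. -/
lemma InBlocks.inv (hα : 1 < α) (hΓ : ∀ s ∈ Γ, 0 ≤ s) (hf : InBlocks α Γ c f)
    {S : Transseries} (hS : PetalSummable α S) (hS0 : S ≠ 0) {ε : ℝ} (hε : 0 < ε)
    (hfS : ZGe (c + ε) (f - zPow c * S)) : f ≠ 0 ∧ InBlocks α Γ (-c) f⁻¹ := by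
  -- `u` inverts the leading block exactly, so `f * u = 1 + w` with `w` of `z`-exponent at least
  -- `ε`.
  set u := zPow (-c) * S⁻¹ with hu
  have hu' : InBlocks α Γ (-c) u :=
    inBlocks_of_mem (zPow_mul_mem_blockSpan (by simp) (hS.inv hα))
  have hu0 : u ≠ 0 := mul_ne_zero (zPow_ne_zero _) (inv_ne_zero hS0)
  have hcu : zPow c * S * u = 1 := by
    have : zPow c * zPow (-c) = 1 := by rw [← zPow_add, add_neg_cancel, zPow_zero]
    calc zPow c * S * u = (zPow c * zPow (-c)) * (S * S⁻¹) := by rw [hu]; ring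
      _ = 1 := by rw [this, mul_inv_cancel₀ hS0, one_mul]
  set w := f * u - 1 with hw
  have hw' : InBlocks α Γ 0 w := by
    have := hf.mul hα hΓ hu'
    rw [add_neg_cancel] at this
    exact this.sub (inBlocks_one hα)
  have hwε : ZGe ε w := by
    have := hfS.mul (hu'.zGe hΓ)
    rwa [sub_mul, hcu, add_neg_cancel_comm] at this
  have hfu : f * u = 1 + w := by rw [hw]; ring
  have hcoeff : (1 + w).coeff 0 = 1 := by
    rw [HahnSeries.coeff_add, hwε.coeff_eq_zero (by simpa using hε), add_zero]
    exact HahnSeries.coeff_single_same (0 : LogExponent) (1 : ℝ)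
  have hne : 1 + w ≠ 0 := by
    intro h
    rw [h] at hcoeff
    exact zero_ne_one hcoeff
  have hf0 : f ≠ 0 := by
    rintro rfl
    rw [zero_mul] at hfu
    exact hne hfu.symm
  have hinv0 : ZGe 0 (1 + w)⁻¹ := by
    refine (zGe_order _).mono ?_
    rw [zExp_order_inv hne, Left.nonneg_neg_iff]
    exact zExp_mono (HahnSeries.order_le_of_coeff_ne_zero (g := 0) (by
      rw [hcoeff]; exact one_ne_zero))
  -- Geometric series in `-w`: cut at `n` with `n ε ≥ B`, the error is `(-w) ^ n (1 + w)⁻¹`, of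
  -- `z`-exponent at least `n ε`.
  have hinv : InBlocks α Γ 0 (1 + w)⁻¹ := by
    refine inBlocks_of_forall fun B => ?_
    obtain ⟨n, hn⟩ := Archimedean.arch B hε
    refine ⟨∑ k ∈ Finset.range n, (0 - w) ^ k, InBlocks.sum fun k _ => ?_, ?_⟩
    · simpa using (inBlocks_zero.sub hw').pow hα hΓ k
    · have hg := geom_sum_mul_neg (0 - w) n
      have e : (1 + w)⁻¹ - ∑ k ∈ Finset.range n, (0 - w) ^ k = (0 - w) ^ n * (1 + w)⁻¹ := by
        rw [zero_sub, sub_neg_eq_add] at hg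
        rw [zero_sub, eq_mul_inv_iff_mul_eq₀ hne, sub_mul, inv_mul_cancel₀ hne, hg]
        ring
      rw [e]
      have := (((zGe_zero ε).sub hwε).pow n).mul hinv0
      rw [add_zero] at this
      exact this.mono (by simpa using hn)
  refine ⟨hf0, ?_⟩
  have e : f⁻¹ = u * (1 + w)⁻¹ := by
    rw [← hfu, mul_inv, mul_left_comm, mul_inv_cancel₀ hu0, mul_one]
  rw [e]
  simpa using hu'.mul hα hΓ hinv

end Transseries

/-! ### Integration of a single block. -/

namespace Transseries

lemma scale_single (w : LogExponent → ℝ) (g : LogExponent) (r : ℝ) :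
    scale w (HahnSeries.single g r) = HahnSeries.single g (w g * r) := by
  ext h
  rw [coeff_scale]
  by_cases hg : h = g
  · rw [hg, HahnSeries.coeff_single_same, HahnSeries.coeff_single_same]
  · rw [HahnSeries.coeff_single_of_ne hg, HahnSeries.coeff_single_of_ne hg, mul_zero]

lemma IsLaurent.scale {f : Transseries} (h : IsLaurent f) (w : LogExponent → ℝ) :
    IsLaurent (scale w f) := fun g hg => h g (right_ne_zero_of_mul (by simpa using hg))

/-- The exponent of `ℓ₂⁻¹ = -log ℓ`. -/
noncomputable def ellTwoInv : LogExponent := expo 0 (Finsupp.single 1 (-1))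

/-- Since `ℓ₂⁻¹ = -log ℓ`, this supplies the primitive of the monomial `ℓ`, the only one that is not
a power of `ℓ`. -/
lemma eulerDeriv_single_ellTwoInv (r : ℝ) :
    eulerDeriv (HahnSeries.single ellTwoInv r) = HahnSeries.C (-r) * ellPow 1 := by
  have hd : Depth 2 (HahnSeries.single ellTwoInv r) := depth_single (fun j hj => by
    rw [ellTwoInv, ellExp_expo, Finsupp.single_apply, if_neg (by omega)]) r
  have h0 : ellExp ellTwoInv 0 = 0 := by simp [ellTwoInv]
  have h1 : ellExp ellTwoInv 1 = -1 := by simp [ellTwoInv]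
  have hz : zExp ellTwoInv = 0 := rfl
  have hadd : ∑ i ∈ Finset.range (1 + 1), Finsupp.single i (1 : ℤ) + Finsupp.single 1 (-1) =
      Finsupp.single 0 1 := by
    rw [Finset.sum_range_succ, Finset.sum_range_one, add_assoc, ← Finsupp.single_add,
      add_neg_cancel, Finsupp.single_zero, add_zero]
  have hprod : ellProd 1 * HahnSeries.single ellTwoInv (-r) = HahnSeries.C (-r) * ellPow 1 := by
    rw [ellProd, HahnSeries.C_apply, ellPow, HahnSeries.single_mul_single,
      HahnSeries.single_mul_single, ellTwoInv, ← expo_add, hadd, add_zero, zero_add, mul_comm]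
  rw [hd.eulerDeriv_eq, Finset.sum_range_succ, Finset.sum_range_one, scale_single, scale_single,
    scale_single, hz, h0, h1, ← hprod]
  simp

/-- The shape of a coefficient of a formal Fatou coordinate: a Laurent series in `ℓ`, plus
possibly a multiple of `ℓ₂⁻¹`. -/
def AlmostLaurent (T : Transseries) : Prop :=
  ∀ g, T.coeff g ≠ 0 → zExp g = 0 ∧ (∀ j, 2 ≤ j → ellExp g j = 0) ∧
    (ellExp g 1 ≠ 0 → g = ellTwoInv)

lemma IsLaurent.almostLaurent {T : Transseries} (h : IsLaurent T) : AlmostLaurent T := fun g hg =>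
  ⟨(h g hg).1, fun j hj => (h g hg).2 j (by omega), fun h1 => absurd ((h g hg).2 1 le_rfl) h1⟩

lemma almostLaurent_single (r : ℝ) : AlmostLaurent (HahnSeries.single ellTwoInv r) := by
  intro g hg
  have hg' : g = ellTwoInv :=
    HahnSeries.support_single_subset (HahnSeries.mem_support _ _ |>.2 hg)
  refine ⟨by rw [hg']; rfl, fun j hj => ?_, fun _ => hg'⟩
  rw [hg', ellTwoInv, ellExp_expo, Finsupp.single_apply, if_neg (by omega)]

lemma almostLaurent_C (r : ℝ) : AlmostLaurent (HahnSeries.C r) := by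
  have : IsLaurent (HahnSeries.C r) := by
    intro g hg
    have hg' : g = 0 := HahnSeries.support_single_subset (a := (0 : LogExponent)) hg
    subst hg'
    simp
  exact this.almostLaurent

lemma AlmostLaurent.add {T U : Transseries} (hT : AlmostLaurent T) (hU : AlmostLaurent U) :
    AlmostLaurent (T + U) := by
  intro g hg
  by_cases h : T.coeff g = 0
  · exact hU g (by simpa [h] using hg)
  · exact hT g h

lemma AlmostLaurent.depth {T : Transseries} (hT : AlmostLaurent T) : Depth 2 T := fun g hg =>
  (hT g hg).2.1

lemma AlmostLaurent.zExp_eq {T : Transseries} (hT : AlmostLaurent T) (g : LogExponent)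
    (hg : T.coeff g ≠ 0) : zExp g = 0 := (hT g hg).1

lemma AlmostLaurent.inLell {T : Transseries} (hT : AlmostLaurent T) : InLell T := fun g hg =>
  ⟨(hT g hg).1, (hT g hg).2.1⟩

lemma AlmostLaurent.subsingleton {T : Transseries} (hT : AlmostLaurent T) :
    {g ∈ T.support | ellExp g 1 ≠ 0}.Subsingleton := by
  rintro g ⟨hg, h1⟩ g' ⟨hg', h1'⟩
  rw [(hT g hg).2.2 h1, (hT g' hg').2.2 h1']

/-- The derivation raises degrees, so the system is triangular with diagonal `β ≠ 0`: `β q_{n+1} +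
(N + n) q_n = p_{n+1}`. -/
lemma exists_ellDeriv_eq (P : PowerSeries ℝ) (N : ℤ) {β : ℝ} (hβ : β ≠ 0) :
    ∃ Q, PowerSeries.C β * Q + (PowerSeries.C (N : ℝ) * (PowerSeries.X * Q) + ellDeriv Q) = P := by
  set q : ℕ → ℝ := Nat.rec (PowerSeries.coeff 0 P / β)
    fun n q => (PowerSeries.coeff (n + 1) P - (N + n) * q) / β with hq
  have hq0 : q 0 = PowerSeries.coeff 0 P / β := rfl
  have hq1 : ∀ n, q (n + 1) = (PowerSeries.coeff (n + 1) P - (N + n) * q n) / β := fun n => rfl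
  refine ⟨PowerSeries.mk q, PowerSeries.ext fun n => ?_⟩
  rw [map_add, map_add, PowerSeries.coeff_C_mul, PowerSeries.coeff_C_mul, PowerSeries.coeff_mk]
  rcases n with _ | n
  · rw [coeff_zero_ellDeriv, PowerSeries.coeff_zero_X_mul, hq0]
    field_simp
    ring
  · rw [coeff_succ_ellDeriv, PowerSeries.coeff_succ_X_mul, PowerSeries.coeff_mk, hq1]
    field_simp
    ring

/-- Integration of `z ^ (β - 1) S`: the equation `β T + ℓ ^ 2 dT/dℓ = S`. -/
lemma exists_eulerDeriv_eq {N : ℤ} {P : PowerSeries ℝ} (β : ℝ) :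
    ∃ T, AlmostLaurent T ∧ β • T + eulerDeriv T = ellPow N * ofPowerSeries P := by
  by_cases hβ : β = 0
  · subst hβ
    set S := ellPow N * ofPowerSeries P with hS
    have hSL : IsLaurent S := isLaurent_ellPow_mul_ofPowerSeries N P
    set s := ellCoeff S 1 with hs
    -- Termwise integration. The value `0⁻¹ = 0` drops the constant term `s` of `ℓ⁻¹ S`, which the
    -- summand `-s ℓ₂⁻¹` then accounts for.
    set L := scale (fun g => ((ellExp g 0 : ℤ) : ℝ)⁻¹) (ellPow (-1) * S) with hL
    have hLL : IsLaurent L := (hSL.ellPow_mul (-1)).scale _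
    refine ⟨L + HahnSeries.single ellTwoInv (-s), hLL.almostLaurent.add (almostLaurent_single _), ?_⟩
    rw [smul_eq_C_mul, map_zero, zero_mul, zero_add, eulerDeriv_add hLL.almostLaurent.depth (almostLaurent_single _).depth,
      eulerDeriv_single_ellTwoInv, neg_neg, hLL.eulerDeriv_eq]
    have h1 : scale (fun g => (ellExp g 0 : ℝ)) L = ellPow (-1) * S - HahnSeries.C s := by
      ext g
      rw [coeff_scale, hL, coeff_scale, HahnSeries.coeff_sub, HahnSeries.C_apply]
      by_cases hg : g = 0
      · rw [hg, ellExp_zero, HahnSeries.coeff_single_same, coeff_ellPow_mul, hs, ellCoeff]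
        have : (0 : LogExponent) - expo 0 (Finsupp.single 0 (-1)) = expo 0 (Finsupp.single 0 1) := by
          rw [sub_eq_iff_eq_add, ← expo_add, ← Finsupp.single_add, add_neg_cancel,
            Finsupp.single_zero, add_zero]
          rfl
        rw [this]
        simp
      · rw [HahnSeries.coeff_single_of_ne hg, sub_zero]
        by_cases hc : (ellPow (-1) * S).coeff g = 0
        · rw [hc, mul_zero, mul_zero]
        · have h0 : ellExp g 0 ≠ 0 := by
            intro h0
            refine hg (logExponent_ext ((hSL.ellPow_mul (-1)).zExp_eq hc) fun j => ?_)
            rcases Nat.eq_zero_or_pos j with rfl | hj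
            · rw [h0, ellExp_zero]
            · rw [(hSL.ellPow_mul (-1)).depth g hc j hj, ellExp_zero]
          have h0' : ((ellExp g 0 : ℤ) : ℝ) ≠ 0 := by exact_mod_cast h0
          rw [mul_inv_cancel_left₀ h0']
    have h2 : ellPow 1 * ellPow (-1) = 1 := by rw [← ellPow_add, add_neg_cancel, ellPow_zero]
    rw [h1, mul_sub, ← mul_assoc, h2]
    ring
  · obtain ⟨Q, hQ⟩ := exists_ellDeriv_eq P N hβ
    refine ⟨ellPow N * ofPowerSeries Q, (isLaurent_ellPow_mul_ofPowerSeries N Q).almostLaurent, ?_⟩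
    have h : ∀ Z, ofPowerSeries (PowerSeries.C β * Q + Z) =
        HahnSeries.C β * ofPowerSeries Q + ofPowerSeries Z := fun Z => by
      rw [map_add, map_mul, ofPowerSeries_C]
    rw [eulerDeriv_ellPow_mul_ofPowerSeries, smul_eq_C_mul, ← hQ, h]
    ring

lemma IsFormalSum.exists_coeff_ne_zero {t : ℕ → Transseries} {S : Transseries}
    (h : IsFormalSum t S) {g : LogExponent} (hg : S.coeff g ≠ 0) : ∃ n, (t n).coeff g ≠ 0 := by
  by_contra! h0
  exact hg (by rw [h.coeff]; simp [h0])

/-! ### The fixed-point equation for the derivative of the Fatou coordinate. -/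

section FixedPoint

variable {α : ℝ} {Γ : AddSubmonoid ℝ} {X u v : Transseries} {c : ℝ}

/-- The higher order part of the formal Taylor expansion of `(Ψ (z + X) - Ψ (z)) / X`, as an
operator on `u = Ψ'`, truncated. -/
noncomputable def taylorTail (X : Transseries) (K : ℕ) (u : Transseries) : Transseries :=
  ∑ n ∈ Finset.range K, HahnSeries.C ((((n + 2) ! : ℕ) : ℝ)⁻¹) * (derivZ^[n + 1] u * X ^ (n + 1))

lemma taylorTail_succ (X : Transseries) (K : ℕ) (u : Transseries) :
    taylorTail X (K + 1) u = taylorTail X K u +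
      HahnSeries.C ((((K + 2) ! : ℕ) : ℝ)⁻¹) * (derivZ^[K + 1] u * X ^ (K + 1)) :=
  Finset.sum_range_succ _ _

/-- Each derivative costs `1` and each factor `X` brings `α`: the gain is `α - 1` per order. -/
lemma zGe_taylorTerm (hX : ZGe α X) (hu : ZGe c u) (r : ℝ) (n : ℕ) :
    ZGe (c + n * (α - 1)) (HahnSeries.C r * (derivZ^[n] u * X ^ n)) := by
  have h := (zGe_single (0 : LogExponent) r).mul ((hu.derivZ_iterate n).mul (hX.pow n))
  rw [zExp_zero] at h
  exact h.mono (by linarith)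

lemma zGe_taylorTail (hα : 1 < α) (hX : ZGe α X) (hu : ZGe c u) (K : ℕ) :
    ZGe (c + (α - 1)) (taylorTail X K u) := by
  refine ZGe.sum fun n _ => (zGe_taylorTerm hX hu _ _).mono ?_
  push_cast
  nlinarith [mul_nonneg (n.cast_nonneg (α := ℝ)) (sub_pos.2 hα).le]

lemma taylorTail_sub {k : ℕ} (hu : Depth k u) (hv : Depth k v) (K : ℕ) :
    taylorTail X K (u - v) = taylorTail X K u - taylorTail X K v := by
  rw [taylorTail, taylorTail, taylorTail, ← Finset.sum_sub_distrib]
  refine Finset.sum_congr rfl fun n _ => ?_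
  rw [derivZ_iterate_sub hu hv]
  ring

lemma InBlocks.taylorTail (hα : 1 < α) (hΓ : ∀ s ∈ Γ, 0 ≤ s) (hαΓ : α - 1 ∈ Γ)
    (hX : InBlocks α Γ α X) (hu : InBlocks α Γ c u) (K : ℕ) :
    InBlocks α Γ c (taylorTail X K u) := by
  refine InBlocks.sum fun n _ => ?_
  refine ((inBlocks_C hα _).mul hα hΓ
    ((hu.derivZ_iterate hα (n + 1)).mul hα hΓ (hX.pow hα hΓ (n + 1)))).shift ?_
  have : 0 + (c - (n + 1 : ℕ) + (n + 1 : ℕ) * α) - c = (n + 1) • (α - 1) := by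
    rw [nsmul_eq_mul]
    ring
  rw [this]
  exact nsmul_mem hαΓ _

/-- The derivative of the formal Fatou coordinate, as a fixed point. -/
theorem exists_deriv_fatouCoordinate (hα : 1 < α) (hΓ : ∀ s ∈ Γ, 0 ≤ s) (hαΓ : α - 1 ∈ Γ)
    (hX : InBlocks α Γ α X) (hXi : InBlocks α Γ (-α) X⁻¹) :
    ∃ u, InBlocks α Γ (-α) u ∧
      ∀ K : ℕ, ZGe (-α + K * (α - 1)) (u - (X⁻¹ - taylorTail X K u)) := by
  have hδ := sub_pos.2 hα
  have hXz := hX.zGe hΓ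
  -- Picard iteration with a truncation that lengthens at each step, so that only finite sums occur
  -- and the limit still solves the full equation.
  obtain ⟨w, hw0, hw1⟩ : ∃ w : ℕ → Transseries, w 0 = 0 ∧
      ∀ k, w (k + 1) = X⁻¹ - taylorTail X (k + 1) (w k) :=
    ⟨Nat.rec 0 fun k u => X⁻¹ - taylorTail X (k + 1) u, rfl, fun k => rfl⟩
  have hwB : ∀ k, InBlocks α Γ (-α) (w k) := by
    intro k
    induction k with
    | zero => rw [hw0]; exact inBlocks_zero
    | succ k ih =>
      rw [hw1]
      exact hXi.sub (InBlocks.taylorTail hα hΓ hαΓ hX ih (k + 1))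
  have hwd : ∀ k : ℕ, ZGe (-α + k * (α - 1)) (w (k + 1) - w k) := by
    intro k
    induction k with
    | zero =>
      have h := ((hwB 1).sub (hwB 0)).zGe hΓ
      simpa using h
    | succ k ih =>
      -- The difference is the contraction applied to the previous difference, plus the single new
      -- Taylor term of the longer truncation.
      have e : w (k + 1 + 1) - w (k + 1) = -(taylorTail X (k + 1) (w (k + 1) - w k) +
          HahnSeries.C ((((k + 1 + 2) ! : ℕ) : ℝ)⁻¹) *
            (derivZ^[k + 1 + 1] (w (k + 1)) * X ^ (k + 1 + 1))) := by
        rw [taylorTail_sub (hwB _).depth (hwB _).depth, hw1 (k + 1), taylorTail_succ]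
        have := hw1 k
        rw [this]
        abel
      rw [e]
      refine ZGe.neg (ZGe.add ?_ ?_)
      · refine (zGe_taylorTail hα hXz ih _).mono ?_
        push_cast
        linarith
      · refine (zGe_taylorTerm hXz ((hwB (k + 1)).zGe hΓ) _ _).mono ?_
        push_cast
        nlinarith
  have hc : Tendsto (fun k : ℕ => -α + k * (α - 1)) atTop atTop :=
    tendsto_atTop_add_const_left _ _ (tendsto_natCast_atTop_atTop.atTop_mul_const hδ)
  obtain ⟨u, hu⟩ := exists_isFormalSum hc hwd
  have huw : ∀ k : ℕ, ZGe (-α + k * (α - 1)) (u - w k) := by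
    intro k
    have := hu.zGe_sub (N := k) (B := -α + k * (α - 1)) fun n hn => (hwd n).mono (by
      have : (k : ℝ) ≤ n := by exact_mod_cast hn
      nlinarith)
    rwa [Finset.sum_range_sub, hw0, sub_zero] at this
  have huB : InBlocks α Γ (-α) u := by
    refine inBlocks_of_forall fun B => ?_
    obtain ⟨k, hk⟩ := (hc.eventually_ge_atTop B).exists
    exact ⟨w k, hwB k, (huw k).mono hk⟩
  refine ⟨u, huB, fun K => ?_⟩
  -- Compare with `w (K + 1)`, built from `w K` with a tail one term longer. Each of the three
  -- errors has `z`-exponent at least `-α + K (α - 1)`.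
  have e : u - (X⁻¹ - taylorTail X K u) = (u - w (K + 1)) + (taylorTail X (K + 1) (u - w K) -
      HahnSeries.C ((((K + 2) ! : ℕ) : ℝ)⁻¹) * (derivZ^[K + 1] u * X ^ (K + 1))) := by
    rw [taylorTail_sub huB.depth (hwB K).depth, hw1 K, taylorTail_succ _ _ u]
    abel
  rw [e]
  refine ZGe.add ((huw (K + 1)).mono ?_) (ZGe.sub ?_ ?_)
  · push_cast
    linarith
  · refine (zGe_taylorTail hα hXz (huw K) _).mono ?_
    linarith
  · refine (zGe_taylorTerm hXz (huB.zGe hΓ) _ _).mono ?_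
    push_cast
    linarith

end FixedPoint

/-- A primitive of the fixed point is a formal Fatou coordinate. -/
theorem isFormalFatouCoordinate_of_derivZ_eq {α : ℝ} {f u Ψ : Transseries} (hα : 1 < α)
    (hX0 : f - zPow 1 ≠ 0) (hX : ZGe α (f - zPow 1)) (hΨ : ZGe (1 - α) Ψ) (hd : derivZ Ψ = u)
    (hu : ∀ K : ℕ, ZGe (-α + K * (α - 1))
      (u - ((f - zPow 1)⁻¹ - taylorTail (f - zPow 1) K u))) :
    IsFormalFatouCoordinate f Ψ := by
  refine ⟨Ψ + 1, ?_, add_sub_cancel_left _ _⟩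
  have hδ := sub_pos.2 hα
  have hc : Tendsto (fun k : ℕ => 1 - α + k * (α - 1)) atTop atTop :=
    tendsto_atTop_add_const_left _ _ (tendsto_natCast_atTop_atTop.atTop_mul_const hδ)
  unfold IsComp
  set X := f - zPow 1
  clear_value X
  refine isFormalSum_of_zGe_sub hc (fun n => ?_) fun B => ?_
  · rw [smul_eq_C_mul]
    exact zGe_taylorTerm hX hΨ _ n
  · have hc' : Tendsto (fun k : ℕ => (k : ℝ) * (α - 1)) atTop atTop :=
      tendsto_natCast_atTop_atTop.atTop_mul_const hδ
    obtain ⟨K₀, hK₀⟩ := (hc'.eventually_ge_atTop B).exists_forall_of_atTop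
    refine ⟨K₀ + 2, fun N hN => ?_⟩
    obtain ⟨K, rfl⟩ := Nat.exists_eq_add_of_le' (le_trans (Nat.le_add_left 2 K₀) hN)
    simp only [smul_eq_C_mul]
    -- The error in Abel's equation truncated after `K + 2` terms is `-X` times the defect of the
    -- fixed-point equation, hence has `z`-exponent at least `α - α + K (α - 1)`.
    have e : Ψ + 1 - ∑ n ∈ Finset.range (K + 2),
        HahnSeries.C ((n ! : ℝ)⁻¹) * (derivZ^[n] Ψ * X ^ n) =
          -(X * (u - (X⁻¹ - taylorTail X K u))) := by
      rw [Finset.sum_range_succ', Finset.sum_range_succ']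
      simp only [Function.iterate_succ_apply, hd]
      simp only [Function.iterate_zero, id_eq, zero_add, Nat.factorial_zero, Nat.factorial_one,
        Nat.cast_one, inv_one, map_one, pow_zero, pow_one, one_mul, mul_one]
      have h2 : ∑ n ∈ Finset.range K, HahnSeries.C ((((n + 1 + 1) ! : ℕ) : ℝ)⁻¹) *
          (derivZ^[n] (derivZ u) * X ^ (n + 1 + 1)) = X * taylorTail X K u := by
        rw [taylorTail, Finset.mul_sum]
        refine Finset.sum_congr rfl fun n _ => ?_
        rw [Function.iterate_succ_apply]
        ring
      rw [h2, mul_sub, mul_sub, mul_inv_cancel₀ hX0]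
      ring
    rw [e]
    refine ((hX.mul (hu K)).neg).mono ?_
    have := hK₀ K (by omega)
    linarith

end Transseries

/-! ### Nonvanishing of the leading block. -/

section LeadingCoefficient

lemma norm_zpowC (β : ℝ) (x : ℝ) : ‖zpowC β x‖ = Real.exp (-(β * x)) := by
  rw [zpowC, Complex.norm_exp]
  congr 1
  simp

lemma exists_real_mem_standardQuadraticDomain {C R : ℝ} (hC : 0 < C) :
    ∃ x : ℕ → ℝ, (∀ᶠ n in atTop, (x n : ℂ) ∈ standardQuadraticDomain C R) ∧
      Tendsto x atTop atTop := by
  -- Images of the integers `n > max 0 R` under the map defining the domain, which preserves the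
  -- positive real axis.
  refine ⟨fun n => n + C * (n + 1) ^ (1 / 2 : ℝ), ?_, ?_⟩
  · filter_upwards [tendsto_natCast_atTop_atTop.eventually_gt_atTop (max 0 R)] with n hn
    refine ⟨((n : ℝ) : ℂ), ⟨?_, ?_⟩, ?_⟩
    · simpa using (le_max_left _ _).trans_lt hn
    · rw [Complex.norm_real, Real.norm_of_nonneg n.cast_nonneg]
      exact (le_max_right _ _).trans_lt hn
    · have : (((n : ℝ) + 1) ^ (1 / 2 : ℝ) : ℝ) = (((n : ℝ) : ℂ) + 1) ^ (1 / 2 : ℂ) := by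
        rw [Complex.ofReal_cpow (by positivity)]
        push_cast
        rfl
      rw [Complex.ofReal_add, Complex.ofReal_mul, this]
  · refine tendsto_atTop_mono (fun n => ?_) tendsto_natCast_atTop_atTop
    have : 0 ≤ C * ((n : ℝ) + 1) ^ (1 / 2 : ℝ) := by positivity
    linarith

lemma tendsto_ofReal_sectorFilter {x : ℕ → ℝ} (hx : Tendsto x atTop atTop) {θ : ℝ} (hθ : 0 < θ) :
    Tendsto (fun n => (x n : ℂ)) atTop (sectorFilter 0 θ) := by
  refine tendsto_inf.2 ⟨tendsto_comap_iff.2 (by simpa [Function.comp_def] using hx), ?_⟩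
  refine tendsto_principal.2 (Eventually.of_forall fun n => ?_)
  change |(x n : ℂ).im + 0| < θ / 2
  simpa using hθ

/-- A germ with zero expansion is smaller than every power of `ℓ`: take the remainder estimate with
`n` large compared to `m`. -/
lemma HasLogGevreyExpansion.exists_norm_le_of_zero {μ d θ : ℝ} {F : ℂ → ℂ}
    (h : HasLogGevreyExpansion μ d θ F 0) {θ' : ℝ} (hθ' : θ' ∈ Set.Ioo 0 θ) (m : ℤ) :
    ∃ M > 0, ∃ K, ∀ ζ ∈ logSector d θ' M, ‖ζ‖ ^ m * ‖F ζ⁻¹‖ ≤ K * ‖ζ‖⁻¹ := by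
  obtain ⟨N, P, hP, hG⟩ := h.exists_logGevreyOn
  obtain ⟨M, hM, K, hK⟩ := hG θ' hθ'
  have hP0 : ∀ k, PowerSeries.coeff k P = 0 := fun k => by
    rw [← coeff_ellPow_mul_ofPowerSeries N, ← hP]
    rfl
  have hKpos := hK.pos
  -- Chosen so that `m - N - n ≤ -1`.
  set n := (m - N + 1).toNat with hn
  have hw := gevreyWeight_pos h.order_pos n
  refine ⟨max M 1, lt_max_of_lt_left hM, K * gevreyWeight μ n, fun ζ hζ => ?_⟩
  have h1 : 1 ≤ ‖ζ‖ := ((le_max_right M 1).trans_lt (lt_norm_of_mem_logSector hζ)).le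
  have h0 : 0 < ‖ζ‖ := by linarith
  have hb := hK.bound ζ (logSector_mono le_rfl (le_max_left _ _) hζ) n
  have hs : partialSum P n ζ⁻¹ = 0 := Finset.sum_eq_zero fun k _ => by
    rw [hP0, Complex.ofReal_zero, zero_mul]
  rw [hs, sub_zero, norm_mul, norm_zpow, norm_inv, inv_zpow', neg_neg] at hb
  have e : ‖ζ‖ ^ m * ‖F ζ⁻¹‖ = ‖ζ‖ ^ (m - N) * (‖ζ‖ ^ N * ‖F ζ⁻¹‖) := by
    rw [← mul_assoc, ← zpow_add₀ h0.ne', sub_add_cancel]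
  rw [e]
  calc ‖ζ‖ ^ (m - N) * (‖ζ‖ ^ N * ‖F ζ⁻¹‖)
      ≤ ‖ζ‖ ^ (m - N) * (K * gevreyWeight μ n * ‖ζ‖⁻¹ ^ n) :=
        mul_le_mul_of_nonneg_left hb (by positivity)
    _ = K * gevreyWeight μ n * ‖ζ‖ ^ (m - N - n) := by
        rw [zpow_sub₀ h0.ne' (m - N), zpow_natCast, inv_pow, div_eq_mul_inv]
        ring
    _ ≤ K * gevreyWeight μ n * ‖ζ‖ ^ (-1 : ℤ) := by
        refine mul_le_mul_of_nonneg_left (zpow_le_zpow_right₀ h1 ?_) (by positivity)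
        have := Int.self_le_toNat (m - N + 1)
        omega
    _ = _ := by rw [zpow_neg_one]

lemma tendsto_zpow_mul_exp_neg {δ : ℝ} (hδ : 0 < δ) (m : ℤ) :
    Tendsto (fun x : ℝ => x ^ m * Real.exp (-(δ * x))) atTop (𝓝 0) := by
  have := tendsto_rpow_mul_exp_neg_mul_atTop_nhds_zero (m : ℝ) δ hδ
  simpa [Real.rpow_intCast] using this

variable {C R : ℝ} {f : ℂ → ℂ} {α a : ℝ} {m : ℤ} {e : ℕ → ℝ} {Rhat : ℕ → Transseries}

/-- The leading block of a parabolic generalized Dulac germ does not vanish. -/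
lemma IsParabolicGeneralizedDulacGerm.Rhat_zero_ne_zero
    (hf : IsParabolicGeneralizedDulacGerm C R f α a m e Rhat) : Rhat 0 ≠ 0 := by
  intro hR
  -- The petal `k = 0` contains the real points of the quadratic domain near `0`, where the uniform
  -- estimate can be compared with the expansion.
  obtain ⟨F, hF, hexp⟩ := hf.expansion 0
  have hd : petalDirection α 0 = 0 := by simp [petalDirection]
  have hθ := petalOpening_pos hf.one_lt
  have hθ' : petalOpening α / 2 ∈ Set.Ioo 0 (petalOpening α) := ⟨by positivity, by linarith⟩
  obtain ⟨μ, -, hF0⟩ := hF 0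
  rw [hR, hd] at hF0
  obtain ⟨M, hM, K, hK⟩ := hF0.exists_norm_le_of_zero hθ' m
  obtain ⟨δ, hδ, hexp⟩ := hexp 0
  have hexp := hexp _ hθ'
  rw [hd] at hexp
  obtain ⟨c, hc, huni⟩ := hf.uniform
  obtain ⟨x, hx, hxt⟩ := exists_real_mem_standardQuadraticDomain (R := R) hf.C_pos
  have hsec := tendsto_ofReal_sectorFilter hxt hθ'.1
  have hbig := (hexp.comp_tendsto hsec).bound one_pos
  have hlim : Tendsto (fun n => c * (x n)⁻¹ + (x n) ^ m * Real.exp (-(δ * x n)) + K * (x n)⁻¹)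
      atTop (𝓝 0) := by
    have h1 := tendsto_inv_atTop_zero.comp hxt
    have h2 := (tendsto_zpow_mul_exp_neg hδ m).comp hxt
    simpa [Function.comp_def] using ((h1.const_mul c).add h2).add (h1.const_mul K)
  -- Write `a z ^ α ℓ ^ m` as the uniform error minus the expansion error minus `z ^ α F₀`, and
  -- divide by `|z ^ α ℓ ^ m|`. These give the three terms on the right, the last one by flatness of
  -- `F₀`; all tend to `0`.
  have hev : ∀ᶠ n in atTop, |a| ≤
      c * (x n)⁻¹ + (x n) ^ m * Real.exp (-(δ * x n)) + K * (x n)⁻¹ := by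
    filter_upwards [hx, hbig, hxt.eventually_gt_atTop (max M 0)] with n hn hb hxM
    have hx0 : 0 < x n := (le_max_right _ _).trans_lt hxM
    have hxn : ‖(x n : ℂ)‖ = x n := by rw [Complex.norm_real, Real.norm_of_nonneg hx0.le]
    have hmem : (x n : ℂ) ∈ logSector 0 (petalOpening α / 2) M := by
      refine ⟨?_, ?_⟩
      · simpa using hθ'.1
      · simpa using (le_max_left _ _).trans_lt hxM
    have hu := huni _ hn
    have hk := hK _ hmem
    rw [hxn] at hk
    simp only [Function.comp_apply, zero_add, Finset.sum_range_one, one_mul, hf.e_zero] at hb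
    rw [norm_zpowC] at hb
    rw [norm_mul, norm_zpow, norm_inv, hxn, norm_zpowC] at hu
    set z := zpowC α (x n) with hz
    set E := Real.exp (-(α * x n)) with hE
    have hEpos : 0 < E := Real.exp_pos _
    have hzE : ‖z‖ = E := norm_zpowC α (x n)
    have hEδ : Real.exp (-((α + δ) * x n)) = E * Real.exp (-(δ * x n)) := by
      rw [hE, ← Real.exp_add]
      congr 1
      ring
    rw [hEδ] at hb
    have hid : (a : ℂ) * z * ((x n : ℂ))⁻¹ ^ m =
        (f (x n) - zpowC 1 (x n) + (a : ℂ) * z * ((x n : ℂ))⁻¹ ^ m) -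
          (f (x n) - zpowC 1 (x n) - z * F 0 ((x n : ℂ))⁻¹) - z * F 0 ((x n : ℂ))⁻¹ := by ring
    have hn1 : |a| * E * (x n)⁻¹ ^ m ≤ c * (E * (x n)⁻¹ ^ (m + 1)) +
        E * Real.exp (-(δ * x n)) + E * ‖F 0 ((x n : ℂ))⁻¹‖ := by
      have e1 : ‖(a : ℂ) * z * ((x n : ℂ))⁻¹ ^ m‖ = |a| * E * (x n)⁻¹ ^ m := by
        rw [norm_mul, norm_mul, norm_zpow, norm_inv, hxn, hzE, Complex.norm_real, Real.norm_eq_abs]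
      rw [← e1, hid]
      refine (norm_sub_le _ _).trans (add_le_add ((norm_sub_le _ _).trans (add_le_add hu hb)) ?_)
      rw [norm_mul, hzE]
    have hxm : 0 < (x n) ^ m := by positivity
    have e2 : (x n)⁻¹ ^ m * (x n) ^ m = 1 := by
      rw [inv_zpow, inv_mul_cancel₀ hxm.ne']
    have e3 : (x n)⁻¹ ^ (m + 1) * (x n) ^ m = (x n)⁻¹ := by
      rw [zpow_add_one₀ (inv_ne_zero hx0.ne'), mul_right_comm, e2, one_mul]
    have hn2 := mul_le_mul_of_nonneg_right hn1 hxm.le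
    have hn3 : E * |a| ≤ E * (c * (x n)⁻¹ + (x n) ^ m * Real.exp (-(δ * x n)) +
        (x n) ^ m * ‖F 0 ((x n : ℂ))⁻¹‖) := by
      calc E * |a| = |a| * E * ((x n)⁻¹ ^ m * (x n) ^ m) := by rw [e2]; ring
        _ = |a| * E * (x n)⁻¹ ^ m * (x n) ^ m := by ring
        _ ≤ _ := hn2
        _ = E * (c * ((x n)⁻¹ ^ (m + 1) * (x n) ^ m) + (x n) ^ m * Real.exp (-(δ * x n)) +
              (x n) ^ m * ‖F 0 ((x n : ℂ))⁻¹‖) := by ring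
        _ = _ := by rw [e3]
    have hn4 := le_of_mul_le_mul_left hn3 hEpos
    linarith
  have := ge_of_tendsto hlim hev
  exact hf.a_ne (abs_eq_zero.1 (le_antisymm this (abs_nonneg a)))

/-- The order bound `(α - 1) / 2` is exactly `π` divided by the opening of the petals. -/
lemma IsParabolicGeneralizedDulacGerm.petalSummable
    (hf : IsParabolicGeneralizedDulacGerm C R f α a m e Rhat) (i : ℕ) :
    PetalSummable α (Rhat i) := by
  intro k
  obtain ⟨F, hF, -⟩ := hf.expansion k
  obtain ⟨μ, hμ, h⟩ := hF i
  refine ⟨μ, ?_, F i, h⟩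
  have hα := sub_pos.2 hf.one_lt
  have : Real.pi / petalOpening α = (α - 1) / 2 := by
    rw [petalOpening]
    field_simp
  rwa [this]

end LeadingCoefficient

/-! ### Assembling the Fatou coordinate from its blocks. -/

section FatouCoordinate

variable {α : ℝ}

/-- For `p = 0` the factor `z ^ β ℓ ^ (-2)` divides out of the integration equation and leaves `β T
+ ℓ² dT/dℓ = S`. -/
lemma solvesIntegrationEquation_of_eulerDeriv_eq {d θ β : ℝ} {T S : Transseries}
    (hT : AlmostLaurent T) (hS : IntegrallySummableZero d θ S)
    (h : β • T + eulerDeriv T = S) : SolvesIntegrationEquation d θ T β 0 := by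
  refine ⟨hT.inLell, hT.subsingleton, S, hS, ?_⟩
  rw [derivEll, ellPow_zero, mul_one, eulerDeriv_zPow_mul hT.depth, h, mul_zero, zero_sub]
  ring

/-- A formal Fatou coordinate, with the block structure of its expansion; `Γ` is generated by `G`. -/
theorem exists_fatouCoordinate {f : Transseries} {G : Finset ℝ} (hα : 1 < α)
    (hG : ∀ g ∈ G, 0 < g) (hαG : α - 1 ∈ G)
    (hX : InBlocks α (AddSubmonoid.closure (G : Set ℝ)) α (f - zPow 1)) (hX0 : f - zPow 1 ≠ 0)
    (hXi : InBlocks α (AddSubmonoid.closure (G : Set ℝ)) (-α) (f - zPow 1)⁻¹) :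
    ∃ (Ψ : Transseries) (β : ℕ → ℝ) (T S : ℕ → Transseries),
      IsFormalFatouCoordinate f Ψ ∧ StrictMono β ∧ β 0 = 1 - α ∧ Tendsto β atTop atTop ∧
      (∀ b, b ∈ Set.range β ↔ b - (1 - α) ∈ AddSubmonoid.closure (G : Set ℝ)) ∧
      (∀ i, AlmostLaurent (T i)) ∧ (∀ i, PetalSummable α (S i)) ∧
      (∀ i, β i • T i + eulerDeriv (T i) = S i) ∧ T 0 ≠ 0 ∧
      IsFormalSum (fun i => zPow (β i) * T i) Ψ := by
  set Γ := AddSubmonoid.closure (G : Set ℝ) with hΓdef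
  have hΓ : ∀ s ∈ Γ, 0 ≤ s := fun s hs => nonneg_of_mem_closure hG hs
  have hαΓ : α - 1 ∈ Γ := AddSubmonoid.subset_closure hαG
  have hδ := sub_pos.2 hα
  obtain ⟨u, huB, hu⟩ := exists_deriv_fatouCoordinate hα hΓ hαΓ hX hXi
  obtain ⟨β, hβmono, hβ0, hβt, hβr⟩ := exists_enumeration hG hαG (1 - α)
  -- Shift by `-1`: the derivative of `z ^ β T` is `z ^ (β - 1)` times `β T + eulerDeriv T`.
  choose S hS hSu using fun i => huB.exists_slice hα (β i - 1)
  have hT : ∀ i, ∃ T, AlmostLaurent T ∧ β i • T + eulerDeriv T = S i := fun i => by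
    -- The petal `0` is arbitrary: only the formal shape of `S i` is used here.
    obtain ⟨N, P, hSP, -⟩ := (integrallySummableZero_iff (petalOpening_pos hα)).1 (hS i 0)
    rw [hSP]
    exact exists_eulerDeriv_eq (β i)
  choose T hTA hTS using hT
  have hterm : ∀ i, ZGe (β i) (zPow (β i) * T i) := fun i => zGe_zPow_mul (hTA i).zExp_eq
  obtain ⟨Ψ, hΨ⟩ := exists_isFormalSum hβt hterm
  have hΨz : ZGe (1 - α) Ψ := by
    have := hΨ.zGe_sub (N := 0) (B := 1 - α) fun n _ => (hterm n).mono (by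
      rw [← hβ0]
      exact hβmono.monotone n.zero_le)
    simpa using this
  have hdT : ∀ i, Depth 2 (zPow (β i) * T i) := fun i => (depth_zPow 2 _).mul (hTA i).depth
  have hΨd : Depth 2 Ψ := fun g hg => by
    obtain ⟨n, hn⟩ := hΨ.exists_coeff_ne_zero hg
    exact hdT n g hn
  have hblock : ∀ {B : ℝ} {N : ℕ}, (∀ n, N ≤ n → B ≤ β n - 1) →
      ZGe B (u - ∑ i ∈ Finset.range N, zPow (β i - 1) * S i) := by
    intro B N hN
    refine huB.zGe_sub_sum (β := fun i => β i - 1) (fun i j hij => hβmono.injective (by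
      simpa using hij)) (fun b hb => ?_) hS hSu hN
    obtain ⟨i, hi⟩ := (hβr (b + 1)).2 (by
      rw [show b + 1 - (1 - α) = b - -α by ring]
      exact hb)
    exact ⟨i, by simp [hi]⟩
  have hderiv : derivZ Ψ = u := by
    refine eq_of_forall_zGe_sub fun B => ?_
    obtain ⟨N, hN⟩ := (hβt.eventually_ge_atTop (B + 1)).exists_forall_of_atTop
    have h1 := (hΨ.zGe_sub (N := N) (B := B + 1) fun n hn => (hterm n).mono (hN n hn)).derivZ
    have hsum : Depth 2 (∑ i ∈ Finset.range N, zPow (β i) * T i) := Depth.sum fun i _ => hdT i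
    have h2 : derivZ (∑ i ∈ Finset.range N, zPow (β i) * T i) =
        ∑ i ∈ Finset.range N, zPow (β i - 1) * S i := by
      rw [derivZ, eulerDeriv_sum fun i _ => hdT i, Finset.mul_sum]
      refine Finset.sum_congr rfl fun i _ => ?_
      rw [← hTS i]
      exact derivZ_zPow_mul (hTA i).depth (β i)
    rw [derivZ_sub hΨd hsum, h2, add_sub_cancel_right] at h1
    have h3 := hblock (B := B) (N := N) fun n hn => by linarith [hN n hn]
    simpa using h1.sub h3
  refine ⟨Ψ, β, T, S, isFormalFatouCoordinate_of_derivZ_eq hα hX0 (hX.zGe hΓ) hΨz hderiv hu,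
    hβmono, hβ0, hβt, hβr, hTA, hS, hTS, ?_, hΨ⟩
  -- the leading block is `X⁻¹` to first order
  intro hT0
  have hS0 : S 0 = 0 := by
    rw [← hTS 0, hT0, eulerDeriv_zero, smul_eq_C_mul, mul_zero, add_zero]
  -- With an empty leading block, `u` starts at `-α + ε`: the first entry is the gap to the next
  -- block. The second is the gain of the fixed-point equation, so `X⁻¹` starts there too. But then
  -- `1 = X X⁻¹` would have `z`-exponent at least `ε > 0`.
  set ε := min (β 1 - β 0) (α - 1) with hε
  have hεpos : 0 < ε := lt_min (sub_pos.2 (hβmono one_pos)) hδ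
  have h1 : ZGe (-α + ε) u := by
    have := hblock (B := -α + ε) (N := 1) fun n hn => by
      have h1 := hβmono.monotone hn
      have h2 := min_le_left (β 1 - β 0) (α - 1)
      rw [← hε] at h2
      linarith
    simpa [hS0] using this
  have h2 := (hu 1).mono (d := -α + ε) (by
    have := min_le_right (β 1 - β 0) (α - 1)
    rw [← hε] at this
    push_cast
    linarith)
  have h3 : ZGe (-α + ε) (taylorTail (f - zPow 1) 1 u) :=
    (zGe_taylorTail hα (hX.zGe hΓ) h1 1).mono (by linarith)
  have h4 : ZGe (-α + ε) (f - zPow 1)⁻¹ := by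
    have := (h1.sub h2).add h3
    simpa using this
  have h5 := (hX.zGe hΓ).mul h4
  rw [mul_inv_cancel₀ hX0, add_neg_cancel_left] at h5
  have h6 := h5 0 (by
    rw [show (1 : Transseries).coeff 0 = 1 from HahnSeries.coeff_single_same (0 : LogExponent) _]
    exact one_ne_zero)
  rw [zExp_zero] at h6
  linarith

end FatouCoordinate

/-! ### Existence, uniqueness and structure for an arbitrary solution. -/

theorem proposition6p7 (C R : ℝ) (f : ℂ → ℂ) (α a : ℝ) (m : ℤ) (e : ℕ → ℝ)
    (Rhat : ℕ → Transseries) (hf : IsParabolicGeneralizedDulacGerm C R f α a m e Rhat)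
    (fhat : Transseries)
    (hfhat : IsFormalSum (fun i => zPow (e i) * Rhat i) (fhat - zPow 1)) :
    (∃ Ψ, InL Ψ ∧ IsFormalFatouCoordinate fhat Ψ) ∧
    (∀ Ψ, InL Ψ → IsFormalFatouCoordinate fhat Ψ →
      ∀ Φ, InL Φ → (IsFormalFatouCoordinate fhat Φ ↔ ∃ c : ℝ, Φ = Ψ + HahnSeries.C c)) ∧
    (∀ Ψ, InL Ψ → IsFormalFatouCoordinate fhat Ψ →
      InLk 2 Ψ ∧
      ∃ (β : ℕ → ℝ) (T : ℕ → Transseries),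
        β 0 = -α + 1 ∧ StrictMono β ∧ Tendsto β atTop atTop ∧
        FinitelyGeneratedExponents (Set.range β) ∧
        (∃ n, ∀ i, β i < 0 ↔ i < n) ∧
        (∀ i, InLell (T i)) ∧ T 0 ≠ 0 ∧
        IsFormalSum (fun i => zPow (β i) * T i) Ψ ∧
        ∀ i (k : ℤ),
          SolvesIntegrationEquation (petalDirection α k) (petalOpening α) (T i) (β i) 0 ∧
          (IntegrallySummableZero (petalDirection α k) (petalOpening α) (T i) ∨
            IntegrallySummableOne (petalDirection α k) (petalOpening α) (T i) (β i) 0)) := by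
  have hα := hf.one_lt
  have hδ := sub_pos.2 hα
  obtain ⟨G₀, hG₀, heG₀⟩ := exists_closure_sub_of_finitelyGenerated hf.e_strictMono.monotone hf.e_fg
  classical
  -- `G₀` generates the gaps `e i - α`; `α - 1` is the gap introduced by each order of the Taylor
  -- expansion.
  set G := insert (α - 1) G₀ with hGdef
  have hG : ∀ g ∈ G, 0 < g := fun g hg => by
    rcases Finset.mem_insert.1 hg with rfl | hg
    · exact hδ
    · exact hG₀ g hg
  have hαG : α - 1 ∈ G := Finset.mem_insert_self _ _
  set Γ := AddSubmonoid.closure (G : Set ℝ) with hΓdef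
  have hΓ : ∀ s ∈ Γ, 0 ≤ s := fun s hs => nonneg_of_mem_closure hG hs
  have heΓ : ∀ i, e i - α ∈ Γ := fun i => by
    rw [← hf.e_zero]
    exact AddSubmonoid.closure_mono (by simp [hGdef]) (heG₀ i)
  have hz : ∀ i, ZGe (e i) (zPow (e i) * Rhat i) := fun i =>
    zGe_zPow_mul fun g hg => (hf.petalSummable i).isLaurent.zExp_eq hg
  have hX : InBlocks α Γ α (fhat - zPow 1) := fun B => by
    obtain ⟨N, hN⟩ := (hf.e_tendsto.eventually_ge_atTop B).exists_forall_of_atTop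
    exact ⟨∑ i ∈ Finset.range N, zPow (e i) * Rhat i, sum_mem fun i _ =>
      zPow_mul_mem_blockSpan (heΓ i) (hf.petalSummable i),
      hfhat.zGe_sub fun n hn => (hz n).mono (hN n hn)⟩
  have hlead : ZGe (α + (e 1 - e 0)) (fhat - zPow 1 - zPow α * Rhat 0) := by
    have := hfhat.zGe_sub (N := 1) (B := e 1) fun n hn =>
      (hz n).mono (hf.e_strictMono.monotone hn)
    rw [Finset.sum_range_one, hf.e_zero] at this
    rwa [hf.e_zero, add_sub_cancel]
  obtain ⟨hX0, hXi⟩ := hX.inv hα hΓ (hf.petalSummable 0) hf.Rhat_zero_ne_zero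
    (sub_pos.2 (hf.e_strictMono one_pos)) hlead
  have hXord : 1 < zExp (fhat - zPow 1).order :=
    hα.trans_le ((hX.zGe hΓ).le_zExp_order hX0)
  obtain ⟨Ψ₀, β, T, S, hΨ₀, hβmono, hβ0, hβt, hβr, hTA, hS, hTS, hT0, hsum⟩ :=
    exists_fatouCoordinate hα hG hαG hX hX0 hXi
  have hfg : ∀ E ⊆ Set.range β, FinitelyGeneratedExponents E := fun E hE =>
    ⟨1 - α, G, hG, fun b hb => ⟨b - (1 - α), (hβr b).1 (hE hb), by ring⟩⟩
  have hunique : ∀ Ψ Φ, InL Ψ → InL Φ → IsFormalFatouCoordinate fhat Ψ →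
      IsFormalFatouCoordinate fhat Φ → ∃ c : ℝ, Φ = Ψ + HahnSeries.C c := by
    rintro Ψ Φ ⟨k, hk, -⟩ ⟨l, hl, -⟩ h1 h2
    have hk' : Depth k Ψ := hk
    have hl' : Depth l Φ := hl
    exact fatouCoordinate_unique (hk'.mono (le_max_left k l)) (hl'.mono (le_max_right k l)) hX0
      hXord h1 h2
  -- The exponent `0` is always enumerated, because `0 - (1 - α) = α - 1` is a generator. The
  -- additive constant goes into this block, and `i₀` also counts the negative exponents.
  obtain ⟨i₀, hi₀⟩ : ∃ i, β i = 0 := (hβr 0).2 (by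
    rw [zero_sub, neg_sub]
    exact AddSubmonoid.subset_closure hαG)
  have hInLk : ∀ (T : ℕ → Transseries) Ψ, (∀ i, AlmostLaurent (T i)) →
      IsFormalSum (fun i => zPow (β i) * T i) Ψ → InLk 2 Ψ := by
    intro T Ψ hT hΨ
    refine ⟨fun g hg => ?_, hfg _ ?_⟩
    · obtain ⟨n, hn⟩ := hΨ.exists_coeff_ne_zero hg
      exact ((depth_zPow 2 _).mul (hT n).depth) g hn
    · rintro _ ⟨g, hg, rfl⟩
      obtain ⟨n, hn⟩ := hΨ.exists_coeff_ne_zero hg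
      exact ⟨n, (zExp_eq_of_coeff_zPow_mul (hT n).zExp_eq hn).symm⟩
  have hΨ₀L : InL Ψ₀ := ⟨2, hInLk T Ψ₀ hTA hsum⟩
  refine ⟨⟨Ψ₀, hΨ₀L, hΨ₀⟩, fun Ψ hΨL hΨ Φ hΦL => ⟨hunique Ψ Φ hΨL hΦL hΨ, ?_⟩, ?_⟩
  · rintro ⟨c, rfl⟩
    obtain ⟨k, hk, -⟩ := hΨL
    exact hΨ.add_C (k := k) hk c
  intro Ψ hΨL hΨ
  obtain ⟨c, rfl⟩ := hunique Ψ₀ Ψ hΨ₀L hΨL hΨ₀ hΨ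
  -- the constant belongs to the block of exponent `0`
  set T' : ℕ → Transseries := fun i => T i + if i = i₀ then HahnSeries.C c else 0 with hT'
  have hT'A : ∀ i, AlmostLaurent (T' i) := fun i => by
    by_cases hi : i = i₀
    · simp only [hT', if_pos hi]
      exact (hTA i).add (almostLaurent_C c)
    · simpa only [hT', if_neg hi, add_zero] using hTA i
  have hT'S : ∀ i, β i • T' i + eulerDeriv (T' i) = S i := fun i => by
    by_cases hi : i = i₀
    · simp only [hT', if_pos hi]
      rw [eulerDeriv_add (hTA i).depth (depth_C 2 c), eulerDeriv_C, add_zero, ← hTS i,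
        smul_eq_C_mul, smul_eq_C_mul, hi, hi₀, map_zero, zero_mul, zero_mul]
    · simpa only [hT', if_neg hi, add_zero] using hTS i
  have hsum' : IsFormalSum (fun i => zPow (β i) * T' i) (Ψ₀ + HahnSeries.C c) := by
    obtain ⟨s, hs, hsΨ⟩ := hsum
    refine ⟨s + HahnSeries.SummableFamily.single i₀ (HahnSeries.C c), fun n => ?_, ?_⟩
    · rw [HahnSeries.SummableFamily.add_apply, hs]
      by_cases hn : n = i₀
      · subst hn
        simp only [hT', if_true]
        rw [hi₀, zPow_zero, one_mul, one_mul]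
        simp
      · simp [hT', hn]
    · rw [HahnSeries.SummableFamily.hsum_add, hsΨ, HahnSeries.SummableFamily.hsum_single]
  have hsolve : ∀ i (k : ℤ),
      SolvesIntegrationEquation (petalDirection α k) (petalOpening α) (T' i) (β i) 0 :=
    fun i k => solvesIntegrationEquation_of_eulerDeriv_eq (hT'A i) (hS i k) (hT'S i)
  refine ⟨hInLk T' _ hT'A hsum', β, T', by rw [hβ0]; ring, hβmono, hβt, hfg _ le_rfl,
    ⟨i₀, fun i => by rw [← hi₀, hβmono.lt_iff_lt]⟩, fun i => (hT'A i).inLell, ?_, hsum',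
    fun i k => ⟨hsolve i k, ?_⟩⟩
  -- Since `β 0 = 1 - α < 0`, the additive constant does not affect the leading block.
  · have h0 : (0 : ℕ) ≠ i₀ := by
      rintro rfl
      rw [hβ0] at hi₀
      linarith
    simpa only [hT', if_neg h0, add_zero] using hT0
  · by_cases h : IntegrallySummableZero (petalDirection α k) (petalOpening α) (T' i)
    · exact Or.inl h
    · exact Or.inr ⟨h, hsolve i k⟩
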